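/- **T-duality between the flat 3-torus with $H$-flux and the Heisenberg nilmanifold.** Let $H(\mathbb R)$ be $\mathbb R^3$ with the group law $(a\cdot b)=(a^1+b^1,\ a^2+b^2+\tfrac12a^1b^3-\tfrac12a^3b^1,\ a^3+b^3)$, with left-invariant frames $$X_1=\partial_{1}-\tfrac12y^3\partial_{2},\ X_2=\partial_{2},\ X_3=\partial_{3}+\tfrac12y^1\partial_{2};\qquad Y^1=dy^1,\ Y^2=dy^2-\tfrac12y^1dy^3+\tfrac12y^3dy^1,\ Y^3=dy^3,$$ let $g$ be the left-invariant metric on $H(\mathbb R)$ which is the standard inner product at the identity, and let $\beta_i=\partial_{x^i}$, $\alpha^i=dx^i$ on the 3-torus with flat metric $\delta_{ij}$ and $H$-flux $\varepsilon=d\mathrm{vol}$. Put $$T:\quad \beta_1=X_1,\ \beta_2=-Y^2,\ \beta_3=X_3,\ \alpha^1=Y^1,\ \alpha^2=-X_2,\ \alpha^3=Y^3 .$$ **(1) Currents.** The spans of $(\beta_i,\alpha^i)$ and of $(X_i,Y^i)$ are closed under the Courant–Dorfman bracket (twisted by $\varepsilon$, i.e. $[v,w]=[v,w]_{\rm Lie}+\varepsilon(v,w,\cdot)$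 on vector fields, resp. untwisted), the non-zero brackets being given by $[\beta_i,\beta_j]=\varepsilon_{ijk}\alpha^k$, resp. $[X_1,X_3]=X_2$, $[X_1,Y^2]=-Y^3$, $[X_3,Y^2]=Y^1$, and $T$ is an isomorphism of the resulting complex Lie algebras preserving the tautological pairings. **(2) Hamiltonians.** Let $V^1$ denote the level one vacuum module of the affine Lie algebra of either of these Lie algebras. There is a unique linear map $\Phi$ from the $V^1$ of the nilmanifold to the $V^1$ of the torus that preserves the vacuum and intertwines the modes of the currents according to $T$. It is an isomorphism and maps $$H_X=\tfrac12\sum_i{:}Y^iY^i{:}+\tfrac12\sum_i{:}X_iX_i{:}\qquad\text{to}\qquad H_{\tilde X}=\tfrac12\sum_i\bigl({:}\alpha^i\alpha^i{:}+{:}\beta_i\beta_i{:}\bigr),$$ both as vectors and as fields (the fields create these vectors from the vacuum). The fields satisfy $$H_{\tilde X}(z)\alpha^i(w)\sim\frac{\partial\beta_i}{z-w}+\frac{\beta_i}{(z-w)^2},\qquad H_{\tilde X}(z)\beta_i(w)\sim\frac{\partial\alpha^i-\varepsilon_{ijk}{:}\beta_j\alpha^k{:}}{z-w}+\frac{\alpha^i}{(z-w)^2},$$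 and $H_X(z)A(w)\sim P(w)/(z-w)+Q(w)/(z-w)^2$ for $(A,P,Q)$ equal to $(X_1,\ \partial Y^1+{:}Y^2Y^3{:}-{:}X_3X_2{:},\ Y^1)$, $(X_2,\partial Y^2,Y^2)$, $(X_3,\ \partial Y^3+{:}X_1X_2{:}-{:}Y^2Y^1{:},\ Y^3)$, $(Y^1,\partial X_1,X_1)$, $(Y^2,\ \partial X_2+{:}X_3Y^1{:}-{:}X_1Y^3{:},\ X_2)$, $(Y^3,\partial X_3,X_3)$. For a metric $g$ write $h_g(q,r,p)=\tfrac12g_{ij}(q)r^ir^j+\tfrac12g^{ij}(q)p_ip_j$ for the Hamiltonian density, where $r=\partial_\sigma q$ and $p$ is the momentum. Then $h_\delta=\tfrac12\sum((\alpha^i)^2+(\beta_i)^2)$ with $\alpha=r$, $\beta=p$; for the left-invariant metric $h_g=\tfrac12\sum(Y^i)^2+\tfrac12\sum(X_i)^2$, with $X_i$ evaluated on $p$ and $Y^i$ on $r$; and the two densities agree whenever the currents match under $T$. **(3) Equations of motion.** Let $J\subset\mathbb R$ be an open interval, $W=\mathbb R\times J$ with coordinates $(\sigma,\tau)$, $\square=\partial_\tau^2-\partial_\sigma^2$,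 and consider fields of class $C^k$ on $W$, $2\le k\le\infty$. Hamilton's equations for $\int h\,d\sigma$ (with $\{p_i,q^j\}=\delta_i^j\delta$ and $\{p_i,p_j\}=\varepsilon_{ijk}\partial_\sigma x^k\delta$ for the torus, $\{p_i,p_j\}=0$ for the nilmanifold, and $\partial_\tau a=\{\int h\,d\sigma,a\}$) are equivalent to $p=\partial_\tau x$ together with $$\square x+\partial_\tau x\times\partial_\sigma x=0\tag{A}$$ for the torus, and to $p=g\,\partial_\tau y$ together with $$\begin{aligned}\square y^1&=\theta_\sigma\,\partial_\sigma y^3-\partial_\tau y^3\,\theta_\tau,\\ \square y^2&=\tfrac12y^1\,\square y^3-\tfrac12y^3\,\square y^1,\\ \square y^3&=\partial_\tau y^1\,\theta_\tau-\theta_\sigma\,\partial_\sigma y^1,\end{aligned}\qquad \theta_\bullet=\partial_\bullet y^2-\tfrac12y^1\partial_\bullet y^3+\tfrac12y^3\partial_\bullet y^1\tag{B}$$ for the nilmanifold. Call $x,y$ *T-dual* if $y^1=x^1$, $y^3=x^3$ and the currents $(X_i,Y^i)$ of $y$ (with momentum $g\,\partial_\tau y$) match $\beta_i=\partial_\tau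 x^i$, $\alpha^i=\partial_\sigma x^i$ under $T$. For T-dual $x,y$, $x$ solves (A) if and only if $y$ solves (B). Let $G=\mathbb R^3\times\mathbb R^3$ with $(x,x^*)(u,u^*)=(x+u,\ x^*+u^*+\tfrac12x\times u)$. A doubled motion is a $C^k$ map $(x,x^*):W\to G$ satisfying, with $\alpha=\partial_\sigma x$ and $\beta$ defined by $\partial_\sigma x^*=\beta+\tfrac12x\times\partial_\sigma x$, the equations $\partial_\tau x=\beta$ and $\partial_\tau x^*=\alpha+\tfrac12x\times\beta$. For every doubled motion, $x$ and $y=(x^1,-x^*_2,x^3)$ are T-dual. A $C^k$ map $x$ solves (A) if and only if it is the first component of a doubled motion; a $C^k$ map $y$ solves (B) if and only if $y=(x^1,-x_2^*,x^3)$ for a doubled motion $(x,x^*)$. Left translates of doubled motions are doubled motions, and two doubled motions with the same $x$ (resp. the same $y$) differ by a left translation by an element $g=(v,v^*)$ of $G$ with $v=0$ (resp. $(v^1,-v^*_2,v^3)=0$). *Boundary conditions.* For a doubled motion, $x(\sigma+1,\tau)-x(\sigma,\tau)$ is constant if and only if $(x,x^*)(\sigma+1,\tau)=\gamma\cdot(x,x^*)(\sigma,\tau)$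 for some $\gamma\in G$, if and only if $y(\sigma+1,\tau)=\gamma'\cdot y(\sigma,\tau)$ for some $\gamma'\in H(\mathbb R)$. If such a $\gamma$ lies in the lattice of $G$ generated by $(e_1,0),(e_2,0),(e_3,0)$, then $x(\sigma+1,\tau)=x(\sigma,\tau)+n$ for some $n\in\mathbb Z^3$, and $\gamma'$ can be chosen in the lattice of $H(\mathbb R)$ generated by $e_1,e_3$. -/

import Mathlib

open scoped Matrix VertexOperator TensorProduct

noncomputable section

namespace HDFT

/-! ## The two six-dimensional current Lie algebras -/

/-- Left-invariant sections of `T ⊕ T*` on the torus with `H`-flux: the pair `(b, a)` stands for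
`∑ bᵢ βᵢ + ∑ aᵢ αⁱ`. -/
def TorusCurrents (𝕜 : Type*) : Type _ := (Fin 3 → 𝕜) × (Fin 3 → 𝕜)

/-- Left-invariant sections of `T ⊕ T*` on the Heisenberg nilmanifold: the pair `(u, v)` stands for
`∑ uᵢ Xᵢ + ∑ vᵢ Yⁱ`. -/
def HeisCurrents (𝕜 : Type*) : Type _ := (Fin 3 → 𝕜) × (Fin 3 → 𝕜)

theorem TorusCurrents.ext' {𝕜 : Type*} {s t : TorusCurrents 𝕜} (h₁ : ∀ i, s.1 i = t.1 i)
    (h₂ : ∀ i, s.2 i = t.2 i) : s = t := Prod.ext (funext h₁) (funext h₂)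

theorem HeisCurrents.ext' {𝕜 : Type*} {s t : HeisCurrents 𝕜} (h₁ : ∀ i, s.1 i = t.1 i)
    (h₂ : ∀ i, s.2 i = t.2 i) : s = t := Prod.ext (funext h₁) (funext h₂)

section Currents

variable (𝕜 : Type*) [CommRing 𝕜]

instance : AddCommGroup (TorusCurrents 𝕜) :=
  inferInstanceAs (AddCommGroup ((Fin 3 → 𝕜) × (Fin 3 → 𝕜)))
instance : Module 𝕜 (TorusCurrents 𝕜) :=
  inferInstanceAs (Module 𝕜 ((Fin 3 → 𝕜) × (Fin 3 → 𝕜)))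
instance : AddCommGroup (HeisCurrents 𝕜) :=
  inferInstanceAs (AddCommGroup ((Fin 3 → 𝕜) × (Fin 3 → 𝕜)))
instance : Module 𝕜 (HeisCurrents 𝕜) :=
  inferInstanceAs (Module 𝕜 ((Fin 3 → 𝕜) × (Fin 3 → 𝕜)))

variable {𝕜}

/-- The bracket `[βᵢ, βⱼ] = ε_{ijk} αᵏ`, all other brackets of basis elements being zero. -/
instance : Bracket (TorusCurrents 𝕜) (TorusCurrents 𝕜) where
  bracket s t := (0, s.1 ⨯₃ t.1)

/-- The bracket `[X₁, X₃] = X₂`, `[X₁, Y²] = -Y³`, `[X₃, Y²] = Y¹`, all other brackets of basis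
elements being zero or given by antisymmetry. -/
instance : Bracket (HeisCurrents 𝕜) (HeisCurrents 𝕜) where
  bracket s t :=
    (![0, s.1 0 * t.1 2 - s.1 2 * t.1 0, 0],
      ![s.1 2 * t.2 1 - t.1 2 * s.2 1, 0, -(s.1 0 * t.2 1 - t.1 0 * s.2 1)])

@[simp] theorem TorusCurrents.bracket_fst (s t : TorusCurrents 𝕜) : ⁅s, t⁆.1 = 0 := rfl
@[simp] theorem TorusCurrents.bracket_snd (s t : TorusCurrents 𝕜) :
    ⁅s, t⁆.2 = s.1 ⨯₃ t.1 := rfl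
@[simp] theorem HeisCurrents.bracket_fst (s t : HeisCurrents 𝕜) :
    ⁅s, t⁆.1 = ![0, s.1 0 * t.1 2 - s.1 2 * t.1 0, 0] := rfl
@[simp] theorem HeisCurrents.bracket_snd (s t : HeisCurrents 𝕜) :
    ⁅s, t⁆.2 = ![s.1 2 * t.2 1 - t.1 2 * s.2 1, 0, -(s.1 0 * t.2 1 - t.1 0 * s.2 1)] := rfl

@[simp] theorem TorusCurrents.add_fst (s t : TorusCurrents 𝕜) : (s + t).1 = s.1 + t.1 := rfl
@[simp] theorem TorusCurrents.add_snd (s t : TorusCurrents 𝕜) : (s + t).2 = s.2 + t.2 := rfl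
@[simp] theorem TorusCurrents.zero_fst : (0 : TorusCurrents 𝕜).1 = 0 := rfl
@[simp] theorem TorusCurrents.zero_snd : (0 : TorusCurrents 𝕜).2 = 0 := rfl
@[simp] theorem TorusCurrents.smul_fst (c : 𝕜) (s : TorusCurrents 𝕜) : (c • s).1 = c • s.1 := rfl
@[simp] theorem TorusCurrents.smul_snd (c : 𝕜) (s : TorusCurrents 𝕜) : (c • s).2 = c • s.2 := rfl
@[simp] theorem HeisCurrents.add_fst (s t : HeisCurrents 𝕜) : (s + t).1 = s.1 + t.1 := rfl
@[simp] theorem HeisCurrents.add_snd (s t : HeisCurrents 𝕜) : (s + t).2 = s.2 + t.2 := rfl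
@[simp] theorem HeisCurrents.zero_fst : (0 : HeisCurrents 𝕜).1 = 0 := rfl
@[simp] theorem HeisCurrents.zero_snd : (0 : HeisCurrents 𝕜).2 = 0 := rfl
@[simp] theorem HeisCurrents.smul_fst (c : 𝕜) (s : HeisCurrents 𝕜) : (c • s).1 = c • s.1 := rfl
@[simp] theorem HeisCurrents.smul_snd (c : 𝕜) (s : HeisCurrents 𝕜) : (c • s).2 = c • s.2 := rfl

instance : LieRing (TorusCurrents 𝕜) where
  add_lie s t r := by
    apply TorusCurrents.ext' <;> intro i <;> fin_cases i <;>
      simp [cross_apply]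
  lie_add s t r := by
    apply TorusCurrents.ext' <;> intro i <;> fin_cases i <;>
      simp [cross_apply] <;> ring
  lie_self s := by
    apply TorusCurrents.ext' <;> intro i <;> fin_cases i <;>
      simp
  leibniz_lie s t r := by
    apply TorusCurrents.ext' <;> intro i <;> fin_cases i <;>
      simp [cross_apply]

instance : LieAlgebra 𝕜 (TorusCurrents 𝕜) where
  lie_smul c s t := by
    apply TorusCurrents.ext' <;> intro i <;> fin_cases i <;>
      simp

instance : LieRing (HeisCurrents 𝕜) where
  add_lie s t r := by
    apply HeisCurrents.ext' <;> intro i <;> fin_cases i <;>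
      simp <;> ring
  lie_add s t r := by
    apply HeisCurrents.ext' <;> intro i <;> fin_cases i <;>
      simp <;> ring
  lie_self s := by
    apply HeisCurrents.ext' <;> intro i <;> fin_cases i <;>
      simp <;> ring
  leibniz_lie s t r := by
    apply HeisCurrents.ext' <;> intro i <;> fin_cases i <;>
      simp <;> ring

instance : LieAlgebra 𝕜 (HeisCurrents 𝕜) where
  lie_smul c s t := by
    apply HeisCurrents.ext' <;> intro i <;> fin_cases i <;>
      simp <;> ring

variable (𝕜)

/-- The current `βᵢ`. -/
def TorusCurrents.β (i : Fin 3) : TorusCurrents 𝕜 := (Pi.single i 1, 0)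
/-- The current `αⁱ`. -/
def TorusCurrents.α (i : Fin 3) : TorusCurrents 𝕜 := (0, Pi.single i 1)
/-- The current `Xᵢ`. -/
def HeisCurrents.X (i : Fin 3) : HeisCurrents 𝕜 := (Pi.single i 1, 0)
/-- The current `Yⁱ`. -/
def HeisCurrents.Y (i : Fin 3) : HeisCurrents 𝕜 := (0, Pi.single i 1)

@[simp] theorem TorusCurrents.β_fst (i : Fin 3) : (β 𝕜 i).1 = Pi.single i 1 := rfl
@[simp] theorem TorusCurrents.β_snd (i : Fin 3) : (β 𝕜 i).2 = 0 := rfl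
@[simp] theorem TorusCurrents.α_fst (i : Fin 3) : (α 𝕜 i).1 = 0 := rfl
@[simp] theorem TorusCurrents.α_snd (i : Fin 3) : (α 𝕜 i).2 = Pi.single i 1 := rfl
@[simp] theorem HeisCurrents.X_fst (i : Fin 3) : (X 𝕜 i).1 = Pi.single i 1 := rfl
@[simp] theorem HeisCurrents.X_snd (i : Fin 3) : (X 𝕜 i).2 = 0 := rfl
@[simp] theorem HeisCurrents.Y_fst (i : Fin 3) : (Y 𝕜 i).1 = 0 := rfl
@[simp] theorem HeisCurrents.Y_snd (i : Fin 3) : (Y 𝕜 i).2 = Pi.single i 1 := rfl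

/-- The tautological pairing `(βᵢ, αʲ) = δᵢʲ`, `(βᵢ, βⱼ) = (αⁱ, αʲ) = 0`. -/
def torusPairing : LinearMap.BilinForm 𝕜 (TorusCurrents 𝕜) :=
  LinearMap.mk₂ 𝕜 (fun s t => s.1 ⬝ᵥ t.2 + s.2 ⬝ᵥ t.1)
    (by intros; simp; ring) (by intros; simp; ring)
    (by intros; simp; ring) (by intros; simp; ring)

/-- The tautological pairing `(Xᵢ, Yʲ) = δᵢʲ`, `(Xᵢ, Xⱼ) = (Yⁱ, Yʲ) = 0`. -/
def heisPairing : LinearMap.BilinForm 𝕜 (HeisCurrents 𝕜) :=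
  LinearMap.mk₂ 𝕜 (fun s t => s.1 ⬝ᵥ t.2 + s.2 ⬝ᵥ t.1)
    (by intros; simp; ring) (by intros; simp; ring)
    (by intros; simp; ring) (by intros; simp; ring)

theorem torusPairing_apply (s t : TorusCurrents 𝕜) :
    torusPairing 𝕜 s t = s.1 ⬝ᵥ t.2 + s.2 ⬝ᵥ t.1 := rfl

theorem heisPairing_apply (s t : HeisCurrents 𝕜) :
    heisPairing 𝕜 s t = s.1 ⬝ᵥ t.2 + s.2 ⬝ᵥ t.1 := rfl

variable {𝕜} in
/-- The map underlying `tDual`. -/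
def toTorus (s : HeisCurrents 𝕜) : TorusCurrents 𝕜 :=
  (![s.1 0, -s.2 1, s.1 2], ![s.2 0, -s.1 1, s.2 2])

variable {𝕜} in
/-- The inverse of the map underlying `tDual`. -/
def toHeis (s : TorusCurrents 𝕜) : HeisCurrents 𝕜 :=
  (![s.1 0, -s.2 1, s.1 2], ![s.2 0, -s.1 1, s.2 2])

@[simp] theorem toTorus_fst (s : HeisCurrents 𝕜) :
    (toTorus s).1 = ![s.1 0, -s.2 1, s.1 2] := rfl
@[simp] theorem toTorus_snd (s : HeisCurrents 𝕜) :
    (toTorus s).2 = ![s.2 0, -s.1 1, s.2 2] := rfl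
@[simp] theorem toHeis_fst (s : TorusCurrents 𝕜) :
    (toHeis s).1 = ![s.1 0, -s.2 1, s.1 2] := rfl
@[simp] theorem toHeis_snd (s : TorusCurrents 𝕜) :
    (toHeis s).2 = ![s.2 0, -s.1 1, s.2 2] := rfl

/-- The identification of currents
`β₁ = X₁, β₂ = -Y², β₃ = X₃, α¹ = Y¹, α² = -X₂, α³ = Y³`. -/
def tDual : HeisCurrents 𝕜 ≃ₗ[𝕜] TorusCurrents 𝕜 where
  toFun := toTorus
  invFun := toHeis
  map_add' s t := by
    apply TorusCurrents.ext' <;> intro i <;> fin_cases i <;> simp [add_comm]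
  map_smul' c s := by
    apply TorusCurrents.ext' <;> intro i <;> fin_cases i <;> simp
  left_inv s := by
    apply HeisCurrents.ext' <;> intro i <;> fin_cases i <;> simp
  right_inv s := by
    apply TorusCurrents.ext' <;> intro i <;> fin_cases i <;> simp

end Currents

/-! ## The affine current algebra and its level one vacuum module `V¹(𝔤)` -/

/-- A complex Lie algebra with a nondegenerate invariant symmetric bilinear form. -/
class QuadraticLieAlgebra (L : Type*) [LieRing L] [LieAlgebra ℂ L] where
  form : LinearMap.BilinForm ℂ L
  form_symm : form.IsSymm
  form_invariant : form.lieInvariant L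
  form_nondegenerate : form.Nondegenerate

instance : QuadraticLieAlgebra (TorusCurrents ℂ) where
  form := torusPairing ℂ
  form_symm := ⟨fun s t => by
    simp [torusPairing_apply, dotProduct_comm, add_comm]⟩
  form_invariant s t r := by
    simp [torusPairing_apply, cross_apply, dotProduct,
      Fin.sum_univ_three]
    ring
  form_nondegenerate := by
    refine ⟨fun s h => ?_, fun s h => ?_⟩
    · apply TorusCurrents.ext' <;> intro i
      · simpa [torusPairing_apply] using h (.α ℂ i)
      · simpa [torusPairing_apply] using h (.β ℂ i)
    · apply TorusCurrents.ext' <;> intro i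
      · simpa [torusPairing_apply] using h (.α ℂ i)
      · simpa [torusPairing_apply] using h (.β ℂ i)

instance : QuadraticLieAlgebra (HeisCurrents ℂ) where
  form := heisPairing ℂ
  form_symm := ⟨fun s t => by
    simp [heisPairing_apply, dotProduct_comm, add_comm]⟩
  form_invariant s t r := by
    simp [heisPairing_apply, dotProduct, Fin.sum_univ_three]
    ring
  form_nondegenerate := by
    refine ⟨fun s h => ?_, fun s h => ?_⟩
    · apply HeisCurrents.ext' <;> intro i
      · simpa [heisPairing_apply] using h (.Y ℂ i)
      · simpa [heisPairing_apply] using h (.X ℂ i)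
    · apply HeisCurrents.ext' <;> intro i
      · simpa [heisPairing_apply] using h (.Y ℂ i)
      · simpa [heisPairing_apply] using h (.X ℂ i)

section Vacuum

variable (L : Type*) [LieRing L] [LieAlgebra ℂ L] [QuadraticLieAlgebra L]

/-- The cocycle `(f, g) ↦ Res (df, g)` on the loop algebra `L[t, t⁻¹]`, that is
`(a tᵐ, b tⁿ) ↦ m δ_{m,-n} (a, b)`. -/
def affineCocycle : LieModule.Cohomology.twoCocycle ℂ (LieAlgebra.loopAlgebra ℂ ℤ L)
    (TrivialLieModule ℂ (LieAlgebra.loopAlgebra ℂ ℤ L) ℂ) :=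
  LieAlgebra.LoopAlgebra.twoCocycleOfBilinear ℂ ℤ L (-QuadraticLieAlgebra.form)
    (by intro x y z; simp [QuadraticLieAlgebra.form_invariant x y z])
    (by
      constructor
      intro x y
      simp [QuadraticLieAlgebra.form_symm.eq x y])

/-- The affine Lie algebra `L[t, t⁻¹] ⊕ ℂ K` with
`[a tᵐ, b tⁿ] = [a, b] tᵐ⁺ⁿ + m δ_{m,-n} (a, b) K`. -/
abbrev Affine : Type _ := LieAlgebra.ofTwoCocycle (affineCocycle L)

/-- The element `a tⁿ` of the affine Lie algebra. -/
def Affine.current (a : L) (n : ℤ) : Affine L :=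
  LieAlgebra.ofProd (affineCocycle L) (AddMonoidAlgebra.single n (1 : ℂ) ⊗ₜ[ℂ] a, 0)

/-- The central element `K` of the affine Lie algebra. -/
def Affine.central : Affine L :=
  LieAlgebra.ofProd (affineCocycle L)
    (0, (TrivialLieModule.equiv ℂ (LieAlgebra.loopAlgebra ℂ ℤ L) ℂ).symm 1)

theorem affineCocycle_apply (a b : L) (m n : ℤ) :
    (affineCocycle L : LieAlgebra.loopAlgebra ℂ ℤ L →ₗ[ℂ] LieAlgebra.loopAlgebra ℂ ℤ L →ₗ[ℂ]
        TrivialLieModule ℂ (LieAlgebra.loopAlgebra ℂ ℤ L) ℂ)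
      (AddMonoidAlgebra.single m (1 : ℂ) ⊗ₜ[ℂ] a) (AddMonoidAlgebra.single n (1 : ℂ) ⊗ₜ[ℂ] b) =
      (TrivialLieModule.equiv ℂ (LieAlgebra.loopAlgebra ℂ ℤ L) ℂ).symm
        (if m + n = 0 then (m : ℂ) * QuadraticLieAlgebra.form a b else 0) := by
  change (TrivialLieModule.equiv ℂ (LieAlgebra.loopAlgebra ℂ ℤ L) ℂ).symm
    (LieAlgebra.LoopAlgebra.residuePairing ℂ ℤ L (-QuadraticLieAlgebra.form)
      (AddMonoidAlgebra.single m (1 : ℂ) ⊗ₜ[ℂ] a)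
      (AddMonoidAlgebra.single n (1 : ℂ) ⊗ₜ[ℂ] b)) = _
  congr 1
  rw [LieAlgebra.LoopAlgebra.residuePairing_apply_apply,
    LieAlgebra.LoopAlgebra.toFinsupp_single_tmul, LieAlgebra.LoopAlgebra.toFinsupp_single_tmul,
    Finsupp.sum_single_index (by simp)]
  by_cases hmn : m + n = 0
  · obtain rfl : n = -m := by omega
    simp
  · have : m ≠ -n := by omega
    simp [hmn, this]

theorem Affine.bracket_current (a b : L) (m n : ℤ) :
    ⁅Affine.current L a m, Affine.current L b n⁆ =
      Affine.current L ⁅a, b⁆ (m + n) +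
        (if m + n = 0 then (m : ℂ) * QuadraticLieAlgebra.form a b else 0) • Affine.central L := by
  rw [LieAlgebra.bracket_ofTwoCocycle]
  simp only [Affine.current, Affine.central, Equiv.symm_apply_apply, affineCocycle_apply,
    ← LieAlgebra.of_smul, ← LieAlgebra.of_add, lie_zero, sub_zero, add_zero]
  congr 1
  refine Prod.ext ?_ ?_
  · simp only [Prod.fst_add, Prod.smul_fst, smul_zero, add_zero,
      LieAlgebra.ExtendScalars.bracket_tmul, AddMonoidAlgebra.single_mul_single, mul_one]
  · simp only [Prod.snd_add, Prod.smul_snd, zero_add, ← map_smul, smul_eq_mul, mul_one]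

theorem Affine.bracket_central (x : Affine L) : ⁅x, Affine.central L⁆ = 0 := by
  rw [LieAlgebra.bracket_ofTwoCocycle]
  simp only [Affine.central, Equiv.symm_apply_apply, map_zero, lie_zero, sub_zero,
    zero_add, trivial_lie_zero]
  rfl

/-- The universal enveloping algebra of the affine Lie algebra. -/
abbrev AffineU : Type _ := UniversalEnvelopingAlgebra ℂ (Affine L)

/-- The left ideal of `U(L[t, t⁻¹] ⊕ ℂ K)` generated by `L[t]` and `K - 1`. -/
def vacuumIdeal : Submodule (AffineU L) (AffineU L) :=
  Submodule.span (AffineU L)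
    ({u | ∃ (a : L) (n : ℤ), 0 ≤ n ∧ u = UniversalEnvelopingAlgebra.ι ℂ (Affine.current L a n)} ∪
      {UniversalEnvelopingAlgebra.ι ℂ (Affine.central L) - 1})

/-- The vacuum module `V¹(L)` of the affine Lie algebra at level one. -/
abbrev VacuumModule : Type _ := AffineU L ⧸ vacuumIdeal L

/-- The vacuum vector. -/
def vacuum : VacuumModule L := Submodule.Quotient.mk 1

/-- The mode `aₙ` of the current `a(z) = ∑ aₙ z⁻ⁿ⁻¹`, acting on the vacuum module. -/
def mode (a : L) (n : ℤ) : Module.End ℂ (VacuumModule L) :=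
  Algebra.lsmul ℂ ℂ (VacuumModule L) (UniversalEnvelopingAlgebra.ι ℂ (Affine.current L a n))

theorem affineU_induction {C : AffineU L → Prop}
    (algebraMap : ∀ r : ℂ, C (algebraMap ℂ (AffineU L) r))
    (ι : ∀ x, C (UniversalEnvelopingAlgebra.ι ℂ x))
    (mul : ∀ a b, C a → C b → C (a * b)) (add : ∀ a b, C a → C b → C (a + b))
    (u : AffineU L) : C u := by
  let s : Subalgebra ℂ (AffineU L) :=
    { carrier := {u | C u}
      mul_mem' := fun {a b} => mul a b
      add_mem' := fun {a b} => add a b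
      algebraMap_mem' := algebraMap }
  let _ := LieRing.ofAssociativeRing (A := AffineU L)
  let _ := LieRing.ofAssociativeRing (A := s)
  let f : Affine L →ₗ⁅ℂ⁆ s :=
    { toFun := fun x => ⟨UniversalEnvelopingAlgebra.ι ℂ x, ι x⟩
      map_add' := fun x y => Subtype.ext (map_add _ x y)
      map_smul' := fun c x => Subtype.ext (map_smul _ c x)
      map_lie' := fun {x y} => Subtype.ext (LieHom.map_lie _ x y) }
  have h : AlgHom.id ℂ (AffineU L) = s.val.comp (UniversalEnvelopingAlgebra.lift ℂ f) := by
    apply UniversalEnvelopingAlgebra.hom_ext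
    ext x
    simp [f]
  have hu : u = (UniversalEnvelopingAlgebra.lift ℂ f u : AffineU L) := DFunLike.congr_fun h u
  rw [hu]
  exact (UniversalEnvelopingAlgebra.lift ℂ f u).2

theorem central_smul (v : VacuumModule L) :
    UniversalEnvelopingAlgebra.ι ℂ (Affine.central L) • v = v := by
  obtain ⟨u, rfl⟩ := Submodule.Quotient.mk_surjective _ v
  have hc : ∀ u : AffineU L, UniversalEnvelopingAlgebra.ι ℂ (Affine.central L) * u =
      u * UniversalEnvelopingAlgebra.ι ℂ (Affine.central L) := by
    intro u
    induction u using affineU_induction L with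
    | algebraMap r => exact (Algebra.commutes r _).symm
    | ι x =>
      let _ := LieRing.ofAssociativeRing (A := AffineU L)
      have h := congrArg (UniversalEnvelopingAlgebra.ι ℂ) (Affine.bracket_central L x)
      rw [LieHom.map_lie, map_zero, LieRing.of_associative_ring_bracket] at h
      exact (sub_eq_zero.mp h).symm
    | mul a b ha hb => rw [← mul_assoc, ha, mul_assoc, hb, mul_assoc]
    | add a b ha hb => rw [mul_add, add_mul, ha, hb]
  rw [← Submodule.Quotient.mk_smul, Submodule.Quotient.eq, smul_eq_mul, hc]
  have : u * UniversalEnvelopingAlgebra.ι ℂ (Affine.central L) - u =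
      u • (UniversalEnvelopingAlgebra.ι ℂ (Affine.central L) - 1) := by
    rw [smul_eq_mul, mul_sub, mul_one]
  rw [this]
  exact Submodule.smul_mem _ _ (Submodule.subset_span (Or.inr rfl))

theorem mode_bracket (a b : L) (m n : ℤ) (v : VacuumModule L) :
    mode L a m (mode L b n v) = mode L b n (mode L a m v) + mode L ⁅a, b⁆ (m + n) v +
        (if m + n = 0 then (m : ℂ) * QuadraticLieAlgebra.form a b else 0) • v := by
  have h := congrArg (fun x => UniversalEnvelopingAlgebra.ι ℂ x • v)
    (Affine.bracket_current L a b m n)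
  let _ := LieRing.ofAssociativeRing (A := AffineU L)
  simp only [LieHom.map_lie, map_add, map_smul, LieRing.of_associative_ring_bracket, sub_smul,
    add_smul, mul_smul, smul_assoc, central_smul] at h
  simp only [mode, Algebra.lsmul_coe]
  rw [add_assoc, ← h]
  abel

theorem mode_vacuum (a : L) (n : ℤ) (hn : 0 ≤ n) : mode L a n (vacuum L) = 0 := by
  change UniversalEnvelopingAlgebra.ι ℂ (Affine.current L a n) •
    (Submodule.Quotient.mk 1 : VacuumModule L) = 0
  rw [← Submodule.Quotient.mk_smul, Submodule.Quotient.mk_eq_zero, smul_eq_mul, mul_one]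
  exact Submodule.subset_span (Or.inl ⟨a, n, hn, rfl⟩)

theorem affine_induction {C : Affine L → Prop} (current : ∀ a n, C (Affine.current L a n))
    (central : C (Affine.central L)) (smul : ∀ (c : ℂ) x, C x → C (c • x))
    (add : ∀ x y, C x → C y → C (x + y)) (x : Affine L) : C x := by
  have h0 : C 0 := by simpa using smul 0 _ central
  have h1 : ∀ l : LieAlgebra.loopAlgebra ℂ ℤ L, C (LieAlgebra.ofProd (affineCocycle L) (l, 0)) := by
    intro l
    obtain ⟨f, rfl⟩ := (LieAlgebra.LoopAlgebra.toFinsupp ℂ ℤ L).symm.surjective l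
    induction f using Finsupp.induction_linear with
    | zero => rw [map_zero]; exact h0
    | add f g hf hg =>
      have := add _ _ hf hg
      rwa [← LieAlgebra.of_add, Prod.mk_add_mk, add_zero, ← map_add] at this
    | single n a =>
      rw [LieAlgebra.LoopAlgebra.toFinsupp_symm_single]
      exact current a n
  obtain ⟨⟨l, c⟩, rfl⟩ := (LieAlgebra.ofProd (affineCocycle L)).surjective x
  have h2 := add _ _ (h1 l)
    (smul (TrivialLieModule.equiv ℂ (LieAlgebra.loopAlgebra ℂ ℤ L) ℂ c) _ central)
  rw [Affine.central, ← LieAlgebra.of_smul, ← LieAlgebra.of_add] at h2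
  convert h2 using 2
  refine Prod.ext ?_ ?_
  · simp
  · simp [← map_smul]

/-- Every vector is annihilated by all modes `aₙ` with `n` large. -/
theorem mode_eventually_zero (v : VacuumModule L) :
    ∃ N : ℤ, ∀ (a : L) (n : ℤ), N ≤ n → mode L a n v = 0 := by
  have hadd : ∀ v w : VacuumModule L, (∃ N : ℤ, ∀ (a : L) (n : ℤ), N ≤ n → mode L a n v = 0) →
      (∃ N : ℤ, ∀ (a : L) (n : ℤ), N ≤ n → mode L a n w = 0) →
      ∃ N : ℤ, ∀ (a : L) (n : ℤ), N ≤ n → mode L a n (v + w) = 0 := by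
    rintro v w ⟨N, hN⟩ ⟨M, hM⟩
    refine ⟨max N M, fun a n hn => ?_⟩
    rw [map_add, hN a n (le_trans (le_max_left _ _) hn), hM a n (le_trans (le_max_right _ _) hn),
      add_zero]
  have hsmul : ∀ (c : ℂ) (v : VacuumModule L),
      (∃ N : ℤ, ∀ (a : L) (n : ℤ), N ≤ n → mode L a n v = 0) →
      ∃ N : ℤ, ∀ (a : L) (n : ℤ), N ≤ n → mode L a n (c • v) = 0 := by
    rintro c v ⟨N, hN⟩
    exact ⟨N, fun a n hn => by rw [map_smul, hN a n hn, smul_zero]⟩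
  have key : ∀ (u : AffineU L) (v : VacuumModule L),
      (∃ N : ℤ, ∀ (a : L) (n : ℤ), N ≤ n → mode L a n v = 0) →
      ∃ N : ℤ, ∀ (a : L) (n : ℤ), N ≤ n → mode L a n (u • v) = 0 := by
    intro u
    induction u using affineU_induction L with
    | algebraMap r =>
      intro v hv
      rw [algebraMap_smul]
      exact hsmul r v hv
    | mul a b ha hb => exact fun v hv => by rw [mul_smul]; exact ha _ (hb v hv)
    | add a b ha hb => exact fun v hv => by rw [add_smul]; exact hadd _ _ (ha v hv) (hb v hv)
    | ι x =>
      induction x using affine_induction L with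
      | central => exact fun v hv => by rwa [central_smul]
      | smul c x hx =>
        exact fun v hv => by rw [map_smul, smul_assoc]; exact hsmul _ _ (hx v hv)
      | add x y hx hy =>
        exact fun v hv => by rw [map_add, add_smul]; exact hadd _ _ (hx v hv) (hy v hv)
      | current b k =>
        rintro v ⟨N, hN⟩
        refine ⟨max N (max (N - k) (1 - k)), fun a n hn => ?_⟩
        have h1 : N ≤ n := by omega
        have h2 : N ≤ n + k := by omega
        have h3 : n + k ≠ 0 := by omega
        change mode L a n (mode L b k v) = 0
        rw [mode_bracket, hN a n h1, hN _ _ h2, if_neg h3, map_zero, zero_smul, add_zero, add_zero]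
  obtain ⟨u, rfl⟩ := Submodule.Quotient.mk_surjective _ v
  have hu : (Submodule.Quotient.mk u : VacuumModule L) = u • vacuum L := by
    rw [vacuum, ← Submodule.Quotient.mk_smul, smul_eq_mul, mul_one]
  rw [hu]
  exact key u _ ⟨0, fun a n hn => mode_vacuum L a n hn⟩

/-- The current `a(z) = ∑ aₙ z⁻ⁿ⁻¹` as a vertex operator on the vacuum module. -/
def currentField (a : L) : VertexOperator ℂ (VacuumModule L) :=
  VertexOperator.of_coeff (fun k => mode L a (-k - 1)) (by
    intro v
    obtain ⟨N, hN⟩ := mode_eventually_zero L v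
    refine ⟨-N, fun k hk => ?_⟩
    by_contra hlt
    exact hk (hN a (-k - 1) (by omega)))

end Vacuum
/-! ## Normally ordered products, derivatives and operator product expansions -/

section Fields

variable {V : Type*} [AddCommGroup V] [Module ℂ V]

theorem ncoeff_eventually_zero (A : VertexOperator ℂ V) (v : V) :
    ∃ N : ℤ, ∀ n : ℤ, N ≤ n → (A[[n]]) v = 0 := by
  refine ⟨-HahnSeries.order ((HahnModule.of ℂ).symm (A v)), fun n hn => ?_⟩
  exact VertexOperator.ncoeff_eq_zero_of_lt_order A n v (by omega)

/-- The summands of the `n`-th mode of `:A(z) B(z):`, which is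
`∑_{m < 0} Aₘ Bₙ₋ₘ₋₁ + ∑_{m ≥ 0} Bₙ₋ₘ₋₁ Aₘ`. -/
def normalOrderTerm (A B : VertexOperator ℂ V) (n m : ℤ) : Module.End ℂ V :=
  if m < 0 then A[[m]] ∘ₗ B[[n - m - 1]] else B[[n - m - 1]] ∘ₗ A[[m]]

theorem normalOrderTerm_finite (A B : VertexOperator ℂ V) (n : ℤ) (v : V) :
    (Function.support fun m => normalOrderTerm A B n m v).Finite := by
  obtain ⟨N, hN⟩ := ncoeff_eventually_zero A v
  obtain ⟨M, hM⟩ := ncoeff_eventually_zero B v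
  refine (Set.finite_Icc (min (n - 1 - M) 0) (max N 0)).subset fun m hm => ?_
  rw [Function.mem_support] at hm
  by_cases h : m < 0
  · rw [normalOrderTerm, if_pos h, LinearMap.comp_apply] at hm
    have h1 : ¬ M ≤ n - m - 1 := fun h' => hm (by rw [hM _ h', map_zero])
    exact ⟨by omega, by omega⟩
  · rw [normalOrderTerm, if_neg h, LinearMap.comp_apply] at hm
    have h1 : ¬ N ≤ m := fun h' => hm (by rw [hN _ h', map_zero])
    exact ⟨by omega, by omega⟩

/-- The `n`-th mode of the normally ordered product `:A(z) B(z):`. -/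
def normalOrderMode (A B : VertexOperator ℂ V) (n : ℤ) : Module.End ℂ V where
  toFun v := ∑ᶠ m : ℤ, normalOrderTerm A B n m v
  map_add' v w := by
    simp only [map_add]
    exact finsum_add_distrib (normalOrderTerm_finite A B n v) (normalOrderTerm_finite A B n w)
  map_smul' c v := by
    simp only [map_smul, RingHom.id_apply]
    exact (smul_finsum' c (normalOrderTerm_finite A B n v)).symm

theorem normalOrderMode_eventually_zero (A B : VertexOperator ℂ V) (v : V) :
    ∃ N : ℤ, ∀ n : ℤ, N ≤ n → normalOrderMode A B n v = 0 := by
  obtain ⟨N, hN⟩ := ncoeff_eventually_zero A v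
  obtain ⟨M, hM⟩ := ncoeff_eventually_zero B v
  choose K hK using fun m : ℤ => ncoeff_eventually_zero B ((A[[m]]) v)
  obtain ⟨R, hR⟩ := ((Finset.Icc 0 N).image fun m => K m + m + 1).exists_le
  refine ⟨max M R, fun n hn => ?_⟩
  change ∑ᶠ m : ℤ, normalOrderTerm A B n m v = 0
  refine finsum_eq_zero_of_forall_eq_zero fun m => ?_
  by_cases h : m < 0
  · rw [normalOrderTerm, if_pos h, LinearMap.comp_apply, hM _ (by omega), map_zero]
  · rw [normalOrderTerm, if_neg h, LinearMap.comp_apply]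
    by_cases h' : N ≤ m
    · rw [hN _ h', map_zero]
    · have := hR _ (Finset.mem_image_of_mem _ (Finset.mem_Icc.mpr ⟨by omega, by omega⟩ :
        m ∈ Finset.Icc 0 N))
      exact hK m _ (by omega)

/-- The normally ordered product `:A(z) B(z):` of two vertex operators. -/
def normalOrder (A B : VertexOperator ℂ V) : VertexOperator ℂ V :=
  VertexOperator.of_coeff (fun k => normalOrderMode A B (-k - 1)) (by
    intro v
    obtain ⟨N, hN⟩ := normalOrderMode_eventually_zero A B v
    refine ⟨-N, fun k hk => ?_⟩
    by_contra hlt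
    exact hk (hN (-k - 1) (by omega)))

/-- The derivative `∂A(z) = ∑ (-n) Aₙ₋₁ z⁻ⁿ⁻¹` of a vertex operator. -/
def derivField (A : VertexOperator ℂ V) : VertexOperator ℂ V :=
  VertexOperator.of_coeff (fun k => ((k : ℂ) + 1) • A[[-k - 2]]) (by
    intro v
    obtain ⟨N, hN⟩ := ncoeff_eventually_zero A v
    refine ⟨-N - 1, fun k hk => ?_⟩
    by_contra hlt
    exact hk (by change ((k : ℂ) + 1) • (A[[-k - 2]]) v = 0; rw [ hN (-k - 2) (by omega), smul_zero]))

/-- The operator product expansion `A(z) B(w) ∼ P(w) / (z - w) + Q(w) / (z - w)²`, written as the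
equivalent commutation relations of modes `[Aₘ, Bₙ] = Pₘ₊ₙ + m Qₘ₊ₙ₋₁`. In particular
`[A₀, B(w)] = P(w)`. -/
def HasOPE (A B P Q : VertexOperator ℂ V) : Prop :=
  ∀ (m n : ℤ) (v : V),
    (A[[m]]) ((B[[n]]) v) - (B[[n]]) ((A[[m]]) v) =
      (P[[m + n]]) v + (m : ℂ) • (Q[[m + n - 1]]) v

end Fields

/-! ## The Hamiltonians -/

open TorusCurrents HeisCurrents

/-- The current `βᵢ(z)` as a vertex operator. -/
abbrev fieldβ (i : Fin 3) := currentField (TorusCurrents ℂ) (β ℂ i)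
/-- The current `αⁱ(z)` as a vertex operator. -/
abbrev fieldα (i : Fin 3) := currentField (TorusCurrents ℂ) (α ℂ i)
/-- The current `Xᵢ(z)` as a vertex operator. -/
abbrev fieldX (i : Fin 3) := currentField (HeisCurrents ℂ) (X ℂ i)
/-- The current `Yⁱ(z)` as a vertex operator. -/
abbrev fieldY (i : Fin 3) := currentField (HeisCurrents ℂ) (Y ℂ i)

/-- The Hamiltonian `½ ∑ᵢ (:αⁱ(z) αⁱ(z): + :βᵢ(z) βᵢ(z):)` of the flat torus with `H`-flux. -/
def torusHamiltonian : VertexOperator ℂ (VacuumModule (TorusCurrents ℂ)) :=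
  (1 / 2 : ℂ) • ∑ i, (normalOrder (fieldα i) (fieldα i) + normalOrder (fieldβ i) (fieldβ i))

/-- The Hamiltonian `½ ∑ᵢ :Yⁱ(z) Yⁱ(z): + ½ ∑ᵢ :Xᵢ(z) Xᵢ(z):` of the left-invariant metric on the
Heisenberg nilmanifold. -/
def heisHamiltonian : VertexOperator ℂ (VacuumModule (HeisCurrents ℂ)) :=
  (1 / 2 : ℂ) • ∑ i, normalOrder (fieldY i) (fieldY i) +
    (1 / 2 : ℂ) • ∑ i, normalOrder (fieldX i) (fieldX i)

/-- The Hamiltonian of the flat torus with `H`-flux as a vector of the vacuum module. -/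
def torusHamiltonianVector : VacuumModule (TorusCurrents ℂ) :=
  (1 / 2 : ℂ) • ∑ i,
    (mode _ (α ℂ i) (-1) (mode _ (α ℂ i) (-1) (vacuum (TorusCurrents ℂ))) +
      mode _ (β ℂ i) (-1) (mode _ (β ℂ i) (-1) (vacuum (TorusCurrents ℂ))))

/-- The Hamiltonian of the Heisenberg nilmanifold as a vector of the vacuum module. -/
def heisHamiltonianVector : VacuumModule (HeisCurrents ℂ) :=
  (1 / 2 : ℂ) • ∑ i,
    (mode _ (Y ℂ i) (-1) (mode _ (Y ℂ i) (-1) (vacuum (HeisCurrents ℂ))) +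
      mode _ (X ℂ i) (-1) (mode _ (X ℂ i) (-1) (vacuum (HeisCurrents ℂ))))

/-! ## Frames of `T ⊕ T*` and Courant-Dorfman brackets -/

/-- Points, vectors and covectors of `ℝ³`. -/
abbrev R3 : Type := Fin 3 → ℝ

/-- The partial derivative `∂f/∂qᵏ`. -/
def pd (k : Fin 3) (f : R3 → ℝ) (q : R3) : ℝ := fderiv ℝ f q (Pi.single k 1)

/-- The Courant-Dorfman bracket, twisted by a constant 3-form `H`, of sections `s = v + ξ` and
`t = w + η` of `T ⊕ T*` over `ℝ³`:
`[v + ξ, w + η] = [v, w] + L_v η - ι_w dξ + H(v, w, ·)`. -/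
def dorfman (H : R3 → R3 → R3) (s t : (R3 → R3) × (R3 → R3)) : (R3 → R3) × (R3 → R3) :=
  (VectorField.lieBracket ℝ s.1 t.1,
    fun q k =>
      ∑ j, (s.1 q j * pd j (fun q' => t.2 q' k) q + t.2 q j * pd k (fun q' => s.1 q' j) q) -
      ∑ j, t.1 q j * (pd j (fun q' => s.2 q' k) q - pd k (fun q' => s.2 q' j) q) +
      H (s.1 q) (t.1 q) k)

/-- The 3-form `ε = dvol` on `ℝ³`: `ε(v, w, ·) = v × w`. -/
def volFlux (v w : R3) : R3 := v ⨯₃ w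

/-- The left-invariant vector fields `X₁ = ∂₁ - ½ y³ ∂₂`, `X₂ = ∂₂`, `X₃ = ∂₃ + ½ y¹ ∂₂` of the
Heisenberg group. -/
def heisX : Fin 3 → R3 → R3 :=
  ![fun y => ![1, -(1 / 2) * y 2, 0], fun _ => ![0, 1, 0], fun y => ![0, 1 / 2 * y 0, 1] ]

/-- The left-invariant forms `Y¹ = dy¹`, `Y² = dy² - ½ y¹ dy³ + ½ y³ dy¹`, `Y³ = dy³` of the
Heisenberg group. -/
def heisY : Fin 3 → R3 → R3 :=
  ![fun _ => ![1, 0, 0], fun y => ![1 / 2 * y 2, 1, -(1 / 2) * y 0], fun _ => ![0, 0, 1] ]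

/-- The section `∑ bᵢ βᵢ + ∑ aᵢ αⁱ` with `βᵢ = ∂/∂xⁱ`, `αⁱ = dxⁱ`. -/
def torusSection (s : TorusCurrents ℝ) : (R3 → R3) × (R3 → R3) :=
  (fun _ => s.1, fun _ => s.2)

/-- The section `∑ uᵢ Xᵢ + ∑ vᵢ Yⁱ`. -/
def heisSection (s : HeisCurrents ℝ) : (R3 → R3) × (R3 → R3) :=
  (fun y => ∑ i, s.1 i • heisX i y, fun y => ∑ i, s.2 i • heisY i y)

/-! ## Scalar fields, Hamiltonian densities and Hamilton's equations -/

/-- The group law of the Heisenberg group `H(ℝ)`; the inverse of `y` is `-y`. -/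
def heisMul (a b : R3) : R3 :=
  ![a 0 + b 0, a 1 + b 1 + 1 / 2 * a 0 * b 2 - 1 / 2 * a 2 * b 0, a 2 + b 2]

/-- The lattice `Γ ⊂ H(ℝ)` generated by `e₁` and `e₃`. -/
inductive HeisLattice : R3 → Prop
  | e₁ : HeisLattice ![1, 0, 0]
  | e₃ : HeisLattice ![0, 0, 1]
  | mul {a b : R3} : HeisLattice a → HeisLattice b → HeisLattice (heisMul a b)
  | inv {a : R3} : HeisLattice a → HeisLattice (-a)

/-- The flat metric `δ_{ij}`. -/
def flatMetric (_ : R3) : Matrix (Fin 3) (Fin 3) ℝ := 1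

/-- The left-invariant metric on `H(ℝ)` that is the standard inner product at the identity: the
matrix of the pull back of the standard inner product under left translation by `y⁻¹`. -/
def heisMetric (y : R3) : Matrix (Fin 3) (Fin 3) ℝ :=
  let D : Matrix (Fin 3) (Fin 3) ℝ :=
    LinearMap.toMatrix' (fderiv ℝ (fun z => heisMul (-y) z) y : R3 →ₗ[ℝ] R3)
  Dᵀ * D

/-- The Hamiltonian density `½ g_{ij}(q) rⁱ rʲ + ½ g^{ij}(q) p_i p_j` of a metric `g`, where `r`
stands for `∂_σ q` and `p` for the momentum. -/
def hamDensity (g : R3 → Matrix (Fin 3) (Fin 3) ℝ) (q r p : R3) : ℝ :=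
  1 / 2 * (r ⬝ᵥ g q *ᵥ r) + 1 / 2 * (p ⬝ᵥ (g q)⁻¹ *ᵥ p)

/-- The values of the currents: `X_i` is evaluated on the momentum `p`, `Y^i` on `r = ∂_σ y`. -/
def heisCurrentsAt (y r p : R3) : HeisCurrents ℝ :=
  (fun i => heisX i y ⬝ᵥ p, fun i => heisY i y ⬝ᵥ r)

/-- The values `β_i = p_i`, `α^i = r^i` of the currents of the torus, with `r = ∂_σ x`. -/
def torusCurrentsAt (r p : R3) : TorusCurrents ℝ := (p, r)

section Worldsheet

variable {F : Type*} [NormedAddCommGroup F] [NormedSpace ℝ F]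

/-- The derivative `∂_σ f` of a function of the worldsheet coordinates `w = (σ, τ)`. -/
def dσ (f : ℝ × ℝ → F) (w : ℝ × ℝ) : F := fderiv ℝ f w (1, 0)

/-- The derivative `∂_τ f` of a function of the worldsheet coordinates `w = (σ, τ)`. -/
def dτ (f : ℝ × ℝ → F) (w : ℝ × ℝ) : F := fderiv ℝ f w (0, 1)

/-- The d'Alembertian `∂_τ² - ∂_σ²`. -/
def box (f : ℝ × ℝ → F) (w : ℝ × ℝ) : F := dτ (dτ f) w - dσ (dσ f) w

end Worldsheet

/-- The part of the universal cover `ℝ × ℝ` of the worldsheet with `τ ∈ J`. -/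
def worldsheet (J : Set ℝ) : Set (ℝ × ℝ) := {w | w.2 ∈ J}

/-- Translation `σ ↦ σ + 1`. -/
def shift (w : ℝ × ℝ) : ℝ × ℝ := (w.1 + 1, w.2)

/-- Hamilton's equations on the loop space for the Hamiltonian `∫ h(q, ∂_σ q, p) dσ` and Poisson
brackets `{p_i(σ), q^j(σ')} = δ_i^j δ(σ - σ')`, `{p_i(σ), p_j(σ')} = H(e_i, e_j, ∂_σ q) δ(σ - σ')`,
with the convention `∂_τ a = {∫ h dσ, a}`. -/
def IsHamiltonianMotion (h : R3 → R3 → R3 → ℝ) (H : R3 → R3 → R3) (W : Set (ℝ × ℝ))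
    (q p : ℝ × ℝ → R3) : Prop :=
  ∀ w ∈ W, ∀ i,
    dτ q w i = pd i (fun p' => h (q w) (dσ q w) p') (p w) ∧
    dτ p w i = - pd i (fun q' => h q' (dσ q w) (p w)) (q w)
      + dσ (fun w' => pd i (fun r => h (q w') r (p w')) (dσ q w')) w
      - H (dτ q w) (dσ q w) i

/-- The equation `□ x + ∂_τ x × ∂_σ x = 0` on `W`. -/
def TorusEOM (W : Set (ℝ × ℝ)) (x : ℝ × ℝ → R3) : Prop :=
  ∀ w ∈ W, box x w + dτ x w ⨯₃ dσ x w = 0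

/-- The equations of motion of the scalar fields of the Heisenberg nilmanifold on `W`; here
`heisY 1 (y w) ⬝ᵥ dσ y w` is `∂_σ y² - ½ y¹ ∂_σ y³ + ½ y³ ∂_σ y¹`, and similarly for `τ`. -/
def HeisEOM (W : Set (ℝ × ℝ)) (y : ℝ × ℝ → R3) : Prop :=
  ∀ w ∈ W,
    box y w 0 = (heisY 1 (y w) ⬝ᵥ dσ y w) * dσ y w 2 - dτ y w 2 * (heisY 1 (y w) ⬝ᵥ dτ y w) ∧
    box y w 1 = 1 / 2 * y w 0 * box y w 2 - 1 / 2 * y w 2 * box y w 0 ∧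
    box y w 2 = dτ y w 0 * (heisY 1 (y w) ⬝ᵥ dτ y w) - (heisY 1 (y w) ⬝ᵥ dσ y w) * dσ y w 0

/-! ## The doubled scalar fields -/

/-- The group law `(x, x*) (y, y*) = (x + y, x* + y* + ½ x × y)` of the 6-dimensional free 2-step
nilpotent group; the inverse of `z` is `-z`. -/
def doubledMul (g z : R3 × R3) : R3 × R3 :=
  (g.1 + z.1, g.2 + z.2 + (1 / 2 : ℝ) • (g.1 ⨯₃ z.1))

/-- The lattice of the double twisted torus, generated by `e₁, e₂, e₃`. -/
inductive DoubledLattice : R3 × R3 → Prop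
  | gen (i : Fin 3) : DoubledLattice (Pi.single i 1, 0)
  | mul {a b : R3 × R3} : DoubledLattice a → DoubledLattice b → DoubledLattice (doubledMul a b)
  | inv {a : R3 × R3} : DoubledLattice a → DoubledLattice (-a)

/-- The homomorphism `y¹ = x¹, y² = -x*₂, y³ = x³` onto the Heisenberg group. -/
def heisProj (z : R3 × R3) : R3 := ![z.1 0, -z.2 1, z.1 2]

/-- The current `αⁱ = ∂_σ xⁱ` of a doubled field `z = (x, x*)`. -/
def doubledα (z : ℝ × ℝ → R3 × R3) (w : ℝ × ℝ) : R3 := (dσ z w).1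

/-- The current `βᵢ` of a doubled field `z = (x, x*)`, given by
`∂_σ x*_i = β_i + ½ ε_{ijk} x^j ∂_σ x^k`. -/
def doubledβ (z : ℝ × ℝ → R3 × R3) (w : ℝ × ℝ) : R3 :=
  (dσ z w).2 - (1 / 2 : ℝ) • ((z w).1 ⨯₃ (dσ z w).1)

/-- The evolution `∂_τ x^i = β_i`, `∂_τ x*_i = α^i + ½ ε_{ijk} x^j β_k` of the doubled scalar
fields. In terms of the left-invariant vector fields `α^i = ∂/∂x*_i` and
`β_i = ∂/∂x^i - ½ ε_{ijk} x^j ∂/∂x*_k` it says that `∂_σ z = ∑ (α^i β_i + β_i α^i)` with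
coefficients `(α, β)` has `∂_τ z` with the coefficients `(β, α)` interchanged. -/
def DoubledEOM (W : Set (ℝ × ℝ)) (z : ℝ × ℝ → R3 × R3) : Prop :=
  ∀ w ∈ W, (dτ z w).1 = doubledβ z w ∧
    (dτ z w).2 = doubledα z w + (1 / 2 : ℝ) • ((z w).1 ⨯₃ doubledβ z w)

/-- T-dual scalar fields `x` (torus) and `y` (nilmanifold): `y¹ = x¹`, `y³ = x³`, and the currents
`X_i, Y^i` of `y`, with momentum `g ∂_τ y`, match the currents `β_i = ∂_τ x^i`, `α^i = ∂_σ x^i`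
of `x`. -/
def AreTDual (W : Set (ℝ × ℝ)) (x y : ℝ × ℝ → R3) : Prop :=
  ∀ w ∈ W, y w 0 = x w 0 ∧ y w 2 = x w 2 ∧
    tDual ℝ (heisCurrentsAt (y w) (dσ y w) (heisMetric (y w) *ᵥ dτ y w)) =
      torusCurrentsAt (dσ x w) (dτ x w)

end HDFT
end

/-! Everything rests on one algebraic fact: `tDual` is an isometric isomorphism of Lie algebras
(`tDual_lie`, `torusPairing_tDual`) that permutes the basis of currents up to sign. The frames
themselves are a matrix computation, since the Heisenberg frame and coframe have coefficients affine
in the coordinates.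

The vacuum module is functorial in the quadratic Lie algebra: the affine cocycle depends only on the
form, and the vacuum ideal goes to the vacuum ideal (`vacuumEquiv`). Uniqueness holds because the
modes generate the module from the vacuum (`vacuumModule_hom_ext`). Both Hamiltonians are half the
sum of normally ordered squares of a basis, so the signs in `tDual` disappear. The operator product
expansions are computed once, on the torus side, from the Wick-type formula `hasOPE_normalOrder`;
its commutation hypothesis is automatic since the algebra is two-step nilpotent.
`HasOPE.of_intertwines` pulls them back to the nilmanifold.

For the scalar fields, the Heisenberg frame is orthonormal, so T-duality says that x and y share
their outer coordinates, while the derivatives of the middle coordinate of x along τ and σ are -θ_σ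
and -θ_τ (`areTDual_iff`). The outer components of (A) then become the first and third equations of
(B). The remaining equation on each side holds automatically: the middle component of (A) because
partial derivatives of y commute, the second equation of (B) because those of x do.

A doubled motion prescribes both first derivatives of x* in terms of x. This system is integrable
exactly when x solves (A) (`pdir_integrability`), and the Poincaré lemma on the convex strip
supplies x*. Starting from y, the second equation of (B) is the closedness condition that produces
the missing coordinate of x. Constants of integration are absorbed by left translations, which gives
uniqueness. Comparing a doubled motion with its own shift in σ turns uniqueness into the statements
on boundary conditions, and `heisProj` carries them to the Heisenberg group because it is a
homomorphism. -/

noncomputable section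

namespace HDFT

/-! ### Courant–Dorfman brackets of the invariant frames -/

section Frames

theorem hasFDerivAt_mulVec_add (A : Matrix (Fin 3) (Fin 3) ℝ) (b q : R3) :
    HasFDerivAt (fun q : R3 => A *ᵥ q + b) (LinearMap.toContinuousLinearMap A.mulVecLin) q :=
  (LinearMap.toContinuousLinearMap A.mulVecLin).hasFDerivAt.add_const b

theorem pd_mulVec_add (A : Matrix (Fin 3) (Fin 3) ℝ) (b q : R3) (j k : Fin 3) :
    pd j (fun q => (A *ᵥ q + b) k) q = A k j := by
  have h := (hasFDerivAt_pi'.1 (hasFDerivAt_mulVec_add A b q)) k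
  rw [pd, h.fderiv]
  simp

theorem pd_fun_const (k : Fin 3) (c : ℝ) (q : R3) : pd k (fun _ => c) q = 0 := by
  simp [pd]

theorem lieBracket_mulVec_add (A B : Matrix (Fin 3) (Fin 3) ℝ) (a b : R3) :
    VectorField.lieBracket ℝ (fun q : R3 => A *ᵥ q + a) (fun q : R3 => B *ᵥ q + b) =
      fun q => B *ᵥ (A *ᵥ q + a) - A *ᵥ (B *ᵥ q + b) := by
  funext q
  rw [VectorField.lieBracket, (hasFDerivAt_mulVec_add A a q).fderiv,
    (hasFDerivAt_mulVec_add B b q).fderiv]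
  rfl

theorem dorfman_torusSection (s t : TorusCurrents ℝ) :
    dorfman volFlux (torusSection s) (torusSection t) = torusSection ⁅s, t⁆ := by
  refine Prod.ext ?_ ?_
  · funext q
    simp [dorfman, torusSection, VectorField.lieBracket]
  · funext q k
    simp [dorfman, torusSection, pd_fun_const, volFlux]

/-- The frame coefficients are affine in y. In the form A y + b, Lie brackets and partial
derivatives are read off from the matrix, by `lieBracket_mulVec_add` and `pd_mulVec_add`. -/
theorem heisSection_fst (s : HeisCurrents ℝ) : (heisSection s).1 = fun y =>
    !![0, 0, 0; 1 / 2 * s.1 2, 0, -(1 / 2) * s.1 0; 0, 0, 0] *ᵥ y + s.1 := by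
  funext y i
  fin_cases i <;>
    simp [heisSection, heisX, Fin.sum_univ_three, dotProduct]
  ring

theorem heisSection_snd (s : HeisCurrents ℝ) : (heisSection s).2 = fun y =>
    !![0, 0, 1 / 2 * s.2 1; 0, 0, 0; -(1 / 2) * s.2 1, 0, 0] *ᵥ y + s.2 := by
  funext y i
  fin_cases i <;>
    simp [heisSection, heisY, Fin.sum_univ_three, dotProduct] <;> ring

theorem dorfman_heisSection (s t : HeisCurrents ℝ) :
    dorfman 0 (heisSection s) (heisSection t) = heisSection ⁅s, t⁆ := by
  refine Prod.ext ?_ ?_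
  · simp only [dorfman, heisSection_fst, lieBracket_mulVec_add]
    funext q i
    fin_cases i <;> simp [dotProduct, Fin.sum_univ_three, Matrix.vecHead, Matrix.vecTail]
    ring
  · simp only [dorfman, heisSection_fst, heisSection_snd, pd_mulVec_add]
    funext q i
    fin_cases i <;> simp [dotProduct, Fin.sum_univ_three] <;> ring

theorem heisSection_pairing (s t : HeisCurrents ℝ) (q : R3) :
    (heisSection s).1 q ⬝ᵥ (heisSection t).2 q + (heisSection s).2 q ⬝ᵥ (heisSection t).1 q =
      heisPairing ℝ s t := by
  simp [heisSection_fst, heisSection_snd, heisPairing_apply, dotProduct,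
    Fin.sum_univ_three]
  ring

end Frames

/-! ### T as an isometric isomorphism of current algebras -/

section TDuality

variable {𝕜 : Type*} [CommRing 𝕜]

theorem tDual_fst (s : HeisCurrents 𝕜) : (tDual 𝕜 s).1 = ![s.1 0, -s.2 1, s.1 2] := rfl

theorem tDual_snd (s : HeisCurrents 𝕜) : (tDual 𝕜 s).2 = ![s.2 0, -s.1 1, s.2 2] := rfl

theorem tDual_lie (s t : HeisCurrents 𝕜) : tDual 𝕜 ⁅s, t⁆ = ⁅tDual 𝕜 s, tDual 𝕜 t⁆ := by
  apply TorusCurrents.ext' <;> intro i <;> fin_cases i <;>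
    simp [tDual_fst, tDual_snd, cross_apply] <;> ring

theorem torusPairing_tDual (s t : HeisCurrents 𝕜) :
    torusPairing 𝕜 (tDual 𝕜 s) (tDual 𝕜 t) = heisPairing 𝕜 s t := by
  simp [torusPairing_apply, heisPairing_apply, tDual_fst, tDual_snd, dotProduct,
    Fin.sum_univ_three]
  ring

variable (𝕜)

theorem tDual_X_zero : tDual 𝕜 (.X 𝕜 0) = .β 𝕜 0 := by
  apply TorusCurrents.ext' <;> intro i <;> fin_cases i <;> simp [tDual_fst, tDual_snd]

theorem tDual_X_one : tDual 𝕜 (.X 𝕜 1) = -.α 𝕜 1 := by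
  rw [eq_neg_iff_add_eq_zero]
  apply TorusCurrents.ext' <;> intro i <;> fin_cases i <;> simp [tDual_fst, tDual_snd]

theorem tDual_X_two : tDual 𝕜 (.X 𝕜 2) = .β 𝕜 2 := by
  apply TorusCurrents.ext' <;> intro i <;> fin_cases i <;> simp [tDual_fst, tDual_snd]

theorem tDual_Y_zero : tDual 𝕜 (.Y 𝕜 0) = .α 𝕜 0 := by
  apply TorusCurrents.ext' <;> intro i <;> fin_cases i <;> simp [tDual_fst, tDual_snd]

theorem tDual_Y_one : tDual 𝕜 (.Y 𝕜 1) = -.β 𝕜 1 := by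
  rw [eq_neg_iff_add_eq_zero]
  apply TorusCurrents.ext' <;> intro i <;> fin_cases i <;> simp [tDual_fst, tDual_snd]

theorem tDual_Y_two : tDual 𝕜 (.Y 𝕜 2) = .α 𝕜 2 := by
  apply TorusCurrents.ext' <;> intro i <;> fin_cases i <;> simp [tDual_fst, tDual_snd]

end TDuality

/-! ### Functoriality of the level one vacuum module -/

section VacuumFunctoriality

variable {L L' : Type*} [LieRing L] [LieAlgebra ℂ L] [QuadraticLieAlgebra L]
  [LieRing L'] [LieAlgebra ℂ L'] [QuadraticLieAlgebra L']

variable (L) in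
theorem mk_eq_smul_vacuum (u : AffineU L) :
    (Submodule.Quotient.mk u : VacuumModule L) = u • vacuum L := by
  rw [vacuum, ← Submodule.Quotient.mk_smul, smul_eq_mul, mul_one]

/-- The vacuum module is generated from the vacuum by the modes of the currents. -/
theorem vacuumModule_induction {C : VacuumModule L → Prop} (vacuum : C (vacuum L))
    (mode : ∀ a n v, C v → C (mode L a n v)) (smul : ∀ (c : ℂ) v, C v → C (c • v))
    (add : ∀ v w, C v → C w → C (v + w)) (v : VacuumModule L) : C v := by
  -- Quantifying over v inside the induction lets the factors of a product act one after the other.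
  have key : ∀ (u : AffineU L) (v : VacuumModule L), C v → C (u • v) := by
    intro u
    induction u using affineU_induction L with
    | algebraMap r => exact fun v hv => by rw [algebraMap_smul]; exact smul r v hv
    | mul a b ha hb => exact fun v hv => by rw [mul_smul]; exact ha _ (hb v hv)
    | add a b ha hb => exact fun v hv => by rw [add_smul]; exact add _ _ (ha v hv) (hb v hv)
    | ι x =>
      induction x using affine_induction L with
      | central => exact fun v hv => by rwa [central_smul]
      | smul c x hx => exact fun v hv => by rw [map_smul, smul_assoc]; exact smul _ _ (hx v hv)
      | add x y hx hy =>
        exact fun v hv => by rw [map_add, add_smul]; exact add _ _ (hx v hv) (hy v hv)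
      | current b k => exact fun v hv => mode b k v hv
  obtain ⟨u, rfl⟩ := Submodule.Quotient.mk_surjective _ v
  rw [mk_eq_smul_vacuum]
  exact key u _ vacuum

/-- A linear map out of the vacuum module is determined by the image of the vacuum and its
commutation with the modes. -/
theorem vacuumModule_hom_ext {M : Type*} [AddCommGroup M] [Module ℂ M]
    (act : L → ℤ → M → M) {Φ Ψ : VacuumModule L →ₗ[ℂ] M} (h : Φ (vacuum L) = Ψ (vacuum L))
    (hΦ : ∀ a n v, Φ (mode L a n v) = act a n (Φ v))
    (hΨ : ∀ a n v, Ψ (mode L a n v) = act a n (Ψ v)) : Φ = Ψ := by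
  refine LinearMap.ext fun v => ?_
  induction v using vacuumModule_induction with
  | vacuum => exact h
  | mode a n v hv => rw [hΦ, hΨ, hv]
  | smul c v hv => rw [map_smul, map_smul, hv]
  | add v w hv hw => rw [map_add, map_add, hv, hw]

/-- The linear map underlying `Affine.map`. -/
def Affine.linearMap (f : L →ₗ[ℂ] L') : Affine L →ₗ[ℂ] Affine L' where
  toFun x := LieAlgebra.ofProd (affineCocycle L')
    (f.lTensor _ ((LieAlgebra.ofProd (affineCocycle L)).symm x).1,
      (TrivialLieModule.equiv ℂ (LieAlgebra.loopAlgebra ℂ ℤ L') ℂ).symm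
        (TrivialLieModule.equiv ℂ (LieAlgebra.loopAlgebra ℂ ℤ L) ℂ
          ((LieAlgebra.ofProd (affineCocycle L)).symm x).2))
  map_add' x y := by
    rw [← LieAlgebra.of_add]
    congr 1
    refine Prod.ext ?_ ?_ <;> simp
  map_smul' c x := by
    rw [RingHom.id_apply, ← LieAlgebra.of_smul]
    congr 1
    refine Prod.ext ?_ ?_ <;> simp [-smul_eq_mul]

theorem Affine.linearMap_current (f : L →ₗ[ℂ] L') (a : L) (n : ℤ) :
    Affine.linearMap f (Affine.current L a n) = Affine.current L' (f a) n := by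
  simp [Affine.linearMap, Affine.current]

theorem Affine.linearMap_central (f : L →ₗ[ℂ] L') :
    Affine.linearMap f (Affine.central L) = Affine.central L' := by
  simp [Affine.linearMap, Affine.central]

/-- The homomorphism of affine Lie algebras induced by an isometric homomorphism. -/
def Affine.map (f : L →ₗ⁅ℂ⁆ L')
    (hf : ∀ a b, QuadraticLieAlgebra.form (f a) (f b) = QuadraticLieAlgebra.form a b) :
    Affine L →ₗ⁅ℂ⁆ Affine L' where
  toLinearMap := Affine.linearMap f
  map_lie' {x y} := by
    change Affine.linearMap f.toLinearMap ⁅x, y⁆ =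
      ⁅Affine.linearMap f.toLinearMap x, Affine.linearMap f.toLinearMap y⁆
    have hz (x : Affine L) : ⁅Affine.central L, x⁆ = 0 := by
      rw [← lie_skew, Affine.bracket_central, neg_zero]
    have hz' (x : Affine L') : ⁅Affine.central L', x⁆ = 0 := by
      rw [← lie_skew, Affine.bracket_central, neg_zero]
    induction x using affine_induction L with
    | central => rw [Affine.linearMap_central, hz, hz', map_zero]
    | smul c x hx => rw [smul_lie, map_smul, hx, map_smul, smul_lie]
    | add x x' hx hx' => rw [add_lie, map_add, hx, hx', map_add, add_lie]
    | current a m =>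
      induction y using affine_induction L with
      | central =>
        rw [Affine.linearMap_central, Affine.bracket_central, Affine.bracket_central, map_zero]
      | smul c x hx => rw [lie_smul, map_smul, hx, map_smul, lie_smul]
      | add x x' hx hx' => rw [lie_add, map_add, hx, hx', map_add, lie_add]
      -- The only case with content: `f` respects the bracket in the loop part, and the isometry
      -- hypothesis matches the coefficients of the central element.
      | current b n =>
        simp only [Affine.linearMap_current, Affine.bracket_current, map_add, map_smul,
          Affine.linearMap_central, LieHom.coe_toLinearMap, hf, LieHom.map_lie]

attribute [local instance] LieRing.ofAssociativeRing in
/-- The homomorphism of enveloping algebras induced by an isometric homomorphism. -/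
def AffineU.map (f : L →ₗ⁅ℂ⁆ L')
    (hf : ∀ a b, QuadraticLieAlgebra.form (f a) (f b) = QuadraticLieAlgebra.form a b) :
    AffineU L →ₐ[ℂ] AffineU L' :=
  UniversalEnvelopingAlgebra.lift ℂ ((UniversalEnvelopingAlgebra.ι ℂ).comp (Affine.map f hf))

theorem AffineU.map_ι (f : L →ₗ⁅ℂ⁆ L')
    (hf : ∀ a b, QuadraticLieAlgebra.form (f a) (f b) = QuadraticLieAlgebra.form a b)
    (x : Affine L) : AffineU.map f hf (UniversalEnvelopingAlgebra.ι ℂ x) =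
      UniversalEnvelopingAlgebra.ι ℂ (Affine.linearMap f.toLinearMap x) := by
  rw [AffineU.map, UniversalEnvelopingAlgebra.lift_ι_apply]
  rfl

/-- Generators go to generators: a tⁿ to f(a) tⁿ with the same n ≥ 0, and K - 1 to K - 1. This is
what lets `AffineU.map` descend to the vacuum modules. -/
theorem AffineU.map_mem_vacuumIdeal (f : L →ₗ⁅ℂ⁆ L')
    (hf : ∀ a b, QuadraticLieAlgebra.form (f a) (f b) = QuadraticLieAlgebra.form a b)
    {u : AffineU L} (hu : u ∈ vacuumIdeal L) : AffineU.map f hf u ∈ vacuumIdeal L' := by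
  induction hu using Submodule.span_induction with
  | mem u hu =>
    refine Submodule.subset_span ?_
    rcases hu with ⟨a, n, hn, rfl⟩ | rfl
    · exact Or.inl ⟨f a, n, hn, by rw [AffineU.map_ι, Affine.linearMap_current]; rfl⟩
    · right
      rw [map_sub, AffineU.map_ι, Affine.linearMap_central, map_one]
      rfl
  | zero => rw [map_zero]; exact Submodule.zero_mem _
  | add u v _ _ hu hv => rw [map_add]; exact Submodule.add_mem _ hu hv
  | smul a u _ hu =>
    rw [smul_eq_mul, map_mul]
    exact Submodule.smul_mem _ _ hu

/-- The map of vacuum modules induced by an isometric homomorphism. -/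
def vacuumMap (f : L →ₗ⁅ℂ⁆ L')
    (hf : ∀ a b, QuadraticLieAlgebra.form (f a) (f b) = QuadraticLieAlgebra.form a b) :
    VacuumModule L →ₗ[ℂ] VacuumModule L' :=
  -- Source and target are modules over different enveloping algebras, so the quotient map is built
  -- over ℂ.
  (((vacuumIdeal L).restrictScalars ℂ).liftQ
    (((vacuumIdeal L').mkQ.restrictScalars ℂ).comp (AffineU.map f hf).toLinearMap)
    fun u hu => by
      rw [LinearMap.mem_ker]
      exact (Submodule.Quotient.mk_eq_zero _).2 (AffineU.map_mem_vacuumIdeal f hf hu)).comp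
    (Submodule.Quotient.restrictScalarsEquiv ℂ (vacuumIdeal L)).symm.toLinearMap

theorem vacuumMap_mk (f : L →ₗ⁅ℂ⁆ L')
    (hf : ∀ a b, QuadraticLieAlgebra.form (f a) (f b) = QuadraticLieAlgebra.form a b)
    (u : AffineU L) : vacuumMap f hf (Submodule.Quotient.mk u) =
      Submodule.Quotient.mk (AffineU.map f hf u) := rfl

theorem vacuumMap_vacuum (f : L →ₗ⁅ℂ⁆ L')
    (hf : ∀ a b, QuadraticLieAlgebra.form (f a) (f b) = QuadraticLieAlgebra.form a b) :
    vacuumMap f hf (vacuum L) = vacuum L' := by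
  rw [vacuum, vacuumMap_mk, map_one, vacuum]

theorem vacuumMap_mode (f : L →ₗ⁅ℂ⁆ L')
    (hf : ∀ a b, QuadraticLieAlgebra.form (f a) (f b) = QuadraticLieAlgebra.form a b)
    (a : L) (n : ℤ) (v : VacuumModule L) :
    vacuumMap f hf (mode L a n v) = mode L' (f a) n (vacuumMap f hf v) := by
  obtain ⟨u, rfl⟩ := Submodule.Quotient.mk_surjective _ v
  change vacuumMap f hf (UniversalEnvelopingAlgebra.ι ℂ (Affine.current L a n) •
    Submodule.Quotient.mk u) = UniversalEnvelopingAlgebra.ι ℂ (Affine.current L' (f a) n) • _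
  rw [← Submodule.Quotient.mk_smul, vacuumMap_mk, vacuumMap_mk, smul_eq_mul, map_mul,
    AffineU.map_ι, Affine.linearMap_current, ← Submodule.Quotient.mk_smul, smul_eq_mul]
  rfl

/-- The isomorphism of vacuum modules induced by an isometric isomorphism. -/
def vacuumEquiv (e : L ≃ₗ⁅ℂ⁆ L')
    (he : ∀ a b, QuadraticLieAlgebra.form (e a) (e b) = QuadraticLieAlgebra.form a b) :
    VacuumModule L ≃ₗ[ℂ] VacuumModule L' :=
  have he' : ∀ a b,
      QuadraticLieAlgebra.form (e.symm a) (e.symm b) = QuadraticLieAlgebra.form a b :=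
    fun a b => by rw [← he, e.apply_symm_apply, e.apply_symm_apply]
  -- Both composites fix the vacuum and commute with all modes, as does the identity, so
  -- `vacuumModule_hom_ext` identifies them.
  LinearEquiv.ofLinearMap (vacuumMap e.toLieHom he) (vacuumMap e.symm.toLieHom he')
    (vacuumModule_hom_ext (fun a n => mode L' a n)
      (by simp only [LinearMap.comp_apply, vacuumMap_vacuum, LinearMap.id_apply])
      (fun a n v => by
        simp only [LinearMap.comp_apply, vacuumMap_mode]
        congr 2
        exact e.apply_symm_apply a)
      fun _ _ _ => rfl)
    (vacuumModule_hom_ext (fun a n => mode L a n)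
      (by simp only [LinearMap.comp_apply, vacuumMap_vacuum, LinearMap.id_apply])
      (fun a n v => by
        simp only [LinearMap.comp_apply, vacuumMap_mode]
        congr 2
        exact e.symm_apply_apply a)
      fun _ _ _ => rfl)

theorem vacuumEquiv_vacuum (e : L ≃ₗ⁅ℂ⁆ L')
    (he : ∀ a b, QuadraticLieAlgebra.form (e a) (e b) = QuadraticLieAlgebra.form a b) :
    vacuumEquiv e he (vacuum L) = vacuum L' := vacuumMap_vacuum e.toLieHom he

theorem vacuumEquiv_mode (e : L ≃ₗ⁅ℂ⁆ L')
    (he : ∀ a b, QuadraticLieAlgebra.form (e a) (e b) = QuadraticLieAlgebra.form a b)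
    (a : L) (n : ℤ) (v : VacuumModule L) :
    vacuumEquiv e he (mode L a n v) = mode L' (e a) n (vacuumEquiv e he v) :=
  vacuumMap_mode e.toLieHom he a n v

theorem mode_smul (c : ℂ) (a : L) (n : ℤ) : mode L (c • a) n = c • mode L a n := by
  have h : Affine.current L (c • a) n = c • Affine.current L a n := by
    rw [Affine.current, Affine.current, ← LieAlgebra.of_smul]
    congr 1
    refine Prod.ext ?_ ?_ <;> simp [TensorProduct.tmul_smul]
  rw [mode, h, map_smul, map_smul, mode]

theorem mode_neg_apply (a : L) (n : ℤ) (v : VacuumModule L) :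
    mode L (-a) n v = -mode L a n v := by
  rw [← neg_one_smul ℂ a, mode_smul, LinearMap.smul_apply, neg_one_smul]

theorem mode_zero_apply (n : ℤ) (v : VacuumModule L) : mode L 0 n v = 0 := by
  rw [← zero_smul ℂ (0 : L), mode_smul, LinearMap.smul_apply, zero_smul]

end VacuumFunctoriality

/-- T-duality as an isomorphism of Lie algebras. -/
def tDualLie : HeisCurrents ℂ ≃ₗ⁅ℂ⁆ TorusCurrents ℂ :=
  { tDual ℂ with map_lie' := fun {s t} => tDual_lie s t }

/-- The isomorphism of vacuum modules induced by T-duality. -/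
def tDualVacuum : VacuumModule (HeisCurrents ℂ) ≃ₗ[ℂ] VacuumModule (TorusCurrents ℂ) :=
  vacuumEquiv tDualLie torusPairing_tDual

theorem tDualVacuum_vacuum : tDualVacuum (vacuum _) = vacuum _ := vacuumEquiv_vacuum _ _

theorem tDualVacuum_mode (a : HeisCurrents ℂ) (n : ℤ) (v : VacuumModule (HeisCurrents ℂ)) :
    tDualVacuum (mode _ a n v) = mode _ (tDual ℂ a) n (tDualVacuum v) :=
  vacuumEquiv_mode _ _ a n v

/-! ### Modes of fields, intertwiners and operator product expansions -/

section FieldCalculus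

variable {V V' : Type*} [AddCommGroup V] [Module ℂ V] [AddCommGroup V'] [Module ℂ V']

theorem vertexOperator_ext {A B : VertexOperator ℂ V} (h : ∀ n v, (A[[n]]) v = (B[[n]]) v) :
    A = B := by
  refine HVertexOperator.coeff_inj (funext fun n => LinearMap.ext fun v => ?_)
  rw [VertexOperator.coeff_eq_ncoeff, VertexOperator.coeff_eq_ncoeff, h]

theorem ncoeff_zero_apply (n : ℤ) (v : V) : ((0 : VertexOperator ℂ V)[[n]]) v = 0 := by
  rw [map_zero]; rfl

theorem ncoeff_add_apply (A B : VertexOperator ℂ V) (n : ℤ) (v : V) :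
    ((A + B)[[n]]) v = (A[[n]]) v + (B[[n]]) v := by
  rw [map_add]; rfl

theorem ncoeff_neg_apply (A : VertexOperator ℂ V) (n : ℤ) (v : V) :
    ((-A)[[n]]) v = -(A[[n]]) v := by
  rw [map_neg]; rfl

theorem ncoeff_sub_apply (A B : VertexOperator ℂ V) (n : ℤ) (v : V) :
    ((A - B)[[n]]) v = (A[[n]]) v - (B[[n]]) v := by
  rw [map_sub]; rfl

theorem ncoeff_smul_apply (c : ℂ) (A : VertexOperator ℂ V) (n : ℤ) (v : V) :
    ((c • A)[[n]]) v = c • (A[[n]]) v := by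
  rw [map_smul]; rfl

theorem ncoeff_sum_apply {ι : Type*} (s : Finset ι) (A : ι → VertexOperator ℂ V) (n : ℤ) (v : V) :
    ((∑ i ∈ s, A i)[[n]]) v = ∑ i ∈ s, ((A i)[[n]]) v := by
  rw [map_sum, Finset.sum_apply, LinearMap.sum_apply]

theorem ncoeff_normalOrder (A B : VertexOperator ℂ V) (n : ℤ) (v : V) :
    ((normalOrder A B)[[n]]) v = ∑ᶠ m : ℤ, normalOrderTerm A B n m v := by
  -- The n-th mode is the coefficient of z^k with k = -n - 1, and this relabelling is an involution.
  rw [normalOrder, VertexOperator.ncoeff_of_coeff, show -(-n - 1) - 1 = n by ring]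
  rfl

theorem ncoeff_derivField (A : VertexOperator ℂ V) (n : ℤ) (v : V) :
    ((derivField A)[[n]]) v = (-n : ℂ) • (A[[n - 1]]) v := by
  rw [derivField, VertexOperator.ncoeff_of_coeff, show -(-n - 1) - 2 = n - 1 by ring]
  simp

theorem normalOrderTerm_of_neg (A B : VertexOperator ℂ V) (n : ℤ) {m : ℤ} (hm : m < 0) (v : V) :
    normalOrderTerm A B n m v = (A[[m]]) ((B[[n - m - 1]]) v) := by
  rw [normalOrderTerm, if_pos hm]; rfl

theorem normalOrderTerm_of_nonneg (A B : VertexOperator ℂ V) (n : ℤ) {m : ℤ} (hm : ¬ m < 0)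
    (v : V) : normalOrderTerm A B n m v = (B[[n - m - 1]]) ((A[[m]]) v) := by
  rw [normalOrderTerm, if_neg hm]; rfl

theorem derivField_neg (A : VertexOperator ℂ V) : derivField (-A) = -derivField A :=
  vertexOperator_ext fun n v => by
    simp only [ncoeff_derivField, ncoeff_neg_apply, smul_neg]

theorem normalOrder_neg_right (A B : VertexOperator ℂ V) :
    normalOrder A (-B) = -normalOrder A B :=
  vertexOperator_ext fun n v => by
    simp only [ncoeff_normalOrder, ncoeff_neg_apply, ← finsum_neg_distrib]
    refine finsum_congr fun m => ?_
    by_cases hm : m < 0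
    · simp only [normalOrderTerm_of_neg _ _ _ hm, ncoeff_neg_apply]
      rw [map_neg]
    · simp only [normalOrderTerm_of_nonneg _ _ _ hm, ncoeff_neg_apply]

theorem normalOrder_neg_left (A B : VertexOperator ℂ V) :
    normalOrder (-A) B = -normalOrder A B :=
  vertexOperator_ext fun n v => by
    simp only [ncoeff_normalOrder, ncoeff_neg_apply, ← finsum_neg_distrib]
    refine finsum_congr fun m => ?_
    by_cases hm : m < 0
    · simp only [normalOrderTerm_of_neg _ _ _ hm, ncoeff_neg_apply]
    · simp only [normalOrderTerm_of_nonneg _ _ _ hm, ncoeff_neg_apply]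
      rw [map_neg]

theorem normalOrder_zero_right (A : VertexOperator ℂ V) : normalOrder A 0 = 0 :=
  vertexOperator_ext fun n v => by
    rw [ncoeff_normalOrder, ncoeff_zero_apply]
    refine finsum_eq_zero_of_forall_eq_zero fun m => ?_
    by_cases hm : m < 0
    · rw [normalOrderTerm_of_neg _ _ _ hm, ncoeff_zero_apply, map_zero]
    · rw [normalOrderTerm_of_nonneg _ _ _ hm, ncoeff_zero_apply]

/-- Normally ordered products of commuting fields are symmetric. -/
theorem normalOrder_comm {A B : VertexOperator ℂ V}
    (h : ∀ m n v, (A[[m]]) ((B[[n]]) v) = (B[[n]]) ((A[[m]]) v)) :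
    normalOrder A B = normalOrder B A :=
  vertexOperator_ext fun n v => by
    -- The substitution m ↦ n - 1 - m exchanges the two mode indices. Since the modes commute, it
    -- does not matter that the two sides split the sum by the sign of different indices.
    rw [ncoeff_normalOrder, ncoeff_normalOrder,
      ← finsum_comp_equiv (Equiv.subLeft (n - 1)) (f := fun m => normalOrderTerm B A n m v)]
    refine finsum_congr fun m => ?_
    have e₁ : (Equiv.subLeft (n - 1)) m = n - m - 1 := by rw [Equiv.subLeft_apply]; ring
    have e₂ : n - (n - m - 1) - 1 = m := by ring
    rw [e₁]
    by_cases hm : m < 0 <;> by_cases hm' : n - m - 1 < 0 <;>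
      simp only [normalOrderTerm_of_neg, normalOrderTerm_of_nonneg, hm, hm', e₂, h,
        not_false_eq_true]

/-! ### Fields intertwined by a linear map -/

/-- The linear map `Φ` intertwines the modes of the fields `A` and `B`. -/
def Intertwines (Φ : V →ₗ[ℂ] V') (A : VertexOperator ℂ V) (B : VertexOperator ℂ V') : Prop :=
  ∀ n v, Φ ((A[[n]]) v) = (B[[n]]) (Φ v)

namespace Intertwines

variable {Φ : V →ₗ[ℂ] V'} {A A' : VertexOperator ℂ V} {B B' : VertexOperator ℂ V'}

theorem add (h : Intertwines Φ A B) (h' : Intertwines Φ A' B') :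
    Intertwines Φ (A + A') (B + B') := fun n v => by
  rw [ncoeff_add_apply, map_add, h, h', ncoeff_add_apply]

theorem sub (h : Intertwines Φ A B) (h' : Intertwines Φ A' B') :
    Intertwines Φ (A - A') (B - B') := fun n v => by
  rw [ncoeff_sub_apply, map_sub, h, h', ncoeff_sub_apply]

theorem smul (c : ℂ) (h : Intertwines Φ A B) : Intertwines Φ (c • A) (c • B) := fun n v => by
  rw [ncoeff_smul_apply, map_smul, h, ncoeff_smul_apply]

theorem derivField (h : Intertwines Φ A B) : Intertwines Φ (derivField A) (derivField B) :=
  fun n v => by rw [ncoeff_derivField, map_smul, h, ncoeff_derivField]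

theorem normalOrder (h : Intertwines Φ A B) (h' : Intertwines Φ A' B') :
    Intertwines Φ (normalOrder A A') (normalOrder B B') := fun n v => by
  -- On a fixed vector only finitely many summands are non-zero, so Φ passes through the sum.
  rw [ncoeff_normalOrder, ncoeff_normalOrder, map_finsum Φ (normalOrderTerm_finite A A' n v)]
  refine finsum_congr fun m => ?_
  by_cases hm : m < 0
  · rw [normalOrderTerm_of_neg _ _ _ hm, normalOrderTerm_of_neg _ _ _ hm, h, h']
  · rw [normalOrderTerm_of_nonneg _ _ _ hm, normalOrderTerm_of_nonneg _ _ _ hm, h', h]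

end Intertwines

/-! ### Operator product expansions -/

namespace HasOPE

variable {A A' B P P' Q Q' : VertexOperator ℂ V}

theorem add (h : HasOPE A B P Q) (h' : HasOPE A' B P' Q') :
    HasOPE (A + A') B (P + P') (Q + Q') := fun m n v => by
  have e : ((A + A')[[m]]) ((B[[n]]) v) - (B[[n]]) (((A + A')[[m]]) v) =
      ((A[[m]]) ((B[[n]]) v) - (B[[n]]) ((A[[m]]) v)) +
        ((A'[[m]]) ((B[[n]]) v) - (B[[n]]) ((A'[[m]]) v)) := by
    simp only [ncoeff_add_apply]
    simp only [map_add]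
    abel
  rw [e, h, h', ncoeff_add_apply, ncoeff_add_apply, smul_add]
  abel

theorem smul (c : ℂ) (h : HasOPE A B P Q) : HasOPE (c • A) B (c • P) (c • Q) := fun m n v => by
  simp only [ncoeff_smul_apply]
  simp only [map_smul]
  rw [← smul_sub, h, smul_add, smul_comm c (m : ℂ)]

theorem sum {ι : Type*} (s : Finset ι) {A P Q : ι → VertexOperator ℂ V}
    (h : ∀ i ∈ s, HasOPE (A i) B (P i) (Q i)) :
    HasOPE (∑ i ∈ s, A i) B (∑ i ∈ s, P i) (∑ i ∈ s, Q i) := fun m n v => by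
  simp only [ncoeff_sum_apply]
  simp only [map_sum]
  rw [← Finset.sum_sub_distrib, Finset.smul_sum, ← Finset.sum_add_distrib]
  exact Finset.sum_congr rfl fun i hi => h i hi m n v

theorem neg_right (h : HasOPE A B P Q) : HasOPE A (-B) (-P) (-Q) := fun m n v => by
  have := congrArg Neg.neg (h m n v)
  simp only [ncoeff_neg_apply]
  simp only [map_neg, smul_neg]
  rw [neg_sub_neg, ← neg_sub, this, neg_add]

/-- Operator product expansions can be pulled back along injective intertwiners. -/
theorem of_intertwines {Φ : V →ₗ[ℂ] V'} (hΦ : Function.Injective Φ)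
    {C D R S : VertexOperator ℂ V'} (h : HasOPE C D R S) (hA : Intertwines Φ A C)
    (hB : Intertwines Φ B D) (hP : Intertwines Φ P R) (hQ : Intertwines Φ Q S) :
    HasOPE A B P Q := fun m n v => hΦ (by
  rw [map_sub, map_add, map_smul, hA, hB, hB, hA, hP, hQ]
  exact h m n (Φ v))

end HasOPE

end FieldCalculus

/-! ### Operator product expansions of quadratic fields with currents -/

section CurrentFields

variable {L : Type*} [LieRing L] [LieAlgebra ℂ L] [QuadraticLieAlgebra L]

theorem ncoeff_currentField (a : L) (n : ℤ) : (currentField L a)[[n]] = mode L a n := by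
  rw [currentField, VertexOperator.ncoeff_of_coeff, show -(-n - 1) - 1 = n by ring]

theorem currentField_neg (a : L) : currentField L (-a) = -currentField L a :=
  vertexOperator_ext fun n v => by
    rw [ncoeff_currentField, mode_neg_apply, ncoeff_neg_apply, ncoeff_currentField]

theorem currentField_zero : currentField L 0 = 0 :=
  vertexOperator_ext fun n v => by
    rw [ncoeff_currentField, mode_zero_apply, ncoeff_zero_apply]

theorem mode_comm {a b : L} (h : ⁅a, b⁆ = 0) (h' : QuadraticLieAlgebra.form a b = 0)
    (m n : ℤ) (v : VacuumModule L) : mode L a m (mode L b n v) = mode L b n (mode L a m v) := by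
  rw [mode_bracket, h, h', mode_zero_apply]
  simp

/-- Only the summand m = -1 survives on the vacuum: for m ≤ -2 the mode of b has index -m - 2 ≥ 0,
and for m ≥ 0 the mode of a annihilates the vacuum. -/
theorem normalOrder_vacuum (a b : L) :
    ((normalOrder (currentField L a) (currentField L b))[[-1]]) (vacuum L) =
      mode L a (-1) (mode L b (-1) (vacuum L)) := by
  rw [ncoeff_normalOrder, finsum_eq_single _ (-1)]
  · rw [normalOrderTerm_of_neg _ _ _ (by norm_num), ncoeff_currentField, ncoeff_currentField]
    norm_num
  · intro m hm
    by_cases h : m < 0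
    · rw [normalOrderTerm_of_neg _ _ _ h, ncoeff_currentField, ncoeff_currentField,
        mode_vacuum L b _ (by omega), map_zero]
    · rw [normalOrderTerm_of_nonneg _ _ _ h, ncoeff_currentField, ncoeff_currentField,
        mode_vacuum L a _ (by omega), map_zero]

/-- The commutator with a mode of c acts as a derivation on each summand. In the [a, c] part the
index moves to k + n, while the ordering is still decided by the sign of k; the hypotheses make
modes of [a, c] and b commute, so the ordering is irrelevant there. The central terms occur only
where a mode of a or of b has index -n, that is for k = -n and k = m + n - 1. -/
theorem normalOrderTerm_comm_mode {a b c : L} (h : ⁅⁅a, c⁆, b⁆ = 0)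
    (h' : QuadraticLieAlgebra.form ⁅a, c⁆ b = 0) (m n k : ℤ) (v : VacuumModule L) :
    normalOrderTerm (currentField L a) (currentField L b) m k (mode L c n v) -
        mode L c n (normalOrderTerm (currentField L a) (currentField L b) m k v) =
      normalOrderTerm (currentField L ⁅a, c⁆) (currentField L b) (m + n) (k + n) v +
        normalOrderTerm (currentField L a) (currentField L ⁅b, c⁆) (m + n) k v +
        ((if k = -n then ((-n : ℂ) * QuadraticLieAlgebra.form a c) • mode L b (m + n - 1) v
          else 0) +
         (if k = m + n - 1 then
            ((-n : ℂ) * QuadraticLieAlgebra.form b c) • mode L a (m + n - 1) v else 0)) := by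
  have hd : normalOrderTerm (currentField L ⁅a, c⁆) (currentField L b) (m + n) (k + n) v =
      mode L b (m - k - 1) (mode L ⁅a, c⁆ (k + n) v) := by
    have e : m + n - (k + n) - 1 = m - k - 1 := by ring
    by_cases hk : k + n < 0
    · rw [normalOrderTerm_of_neg _ _ _ hk, ncoeff_currentField, ncoeff_currentField, e,
        mode_comm h h']
    · rw [normalOrderTerm_of_nonneg _ _ _ hk, ncoeff_currentField, ncoeff_currentField, e]
  have ea : (if k + n = 0 then (k : ℂ) * QuadraticLieAlgebra.form a c else 0) •
      mode L b (m - k - 1) v = if k = -n then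
        ((-n : ℂ) * QuadraticLieAlgebra.form a c) • mode L b (m + n - 1) v else 0 := by
    by_cases hk : k = -n
    · subst hk
      simp
    · rw [if_neg hk, if_neg (by omega), zero_smul]
  have eb : (if m - k - 1 + n = 0 then ((m - k - 1 : ℤ) : ℂ) * QuadraticLieAlgebra.form b c
      else 0) • mode L a k v = if k = m + n - 1 then
        ((-n : ℂ) * QuadraticLieAlgebra.form b c) • mode L a (m + n - 1) v else 0 := by
    by_cases hk : k = m + n - 1
    · subst hk
      rw [if_pos (by ring), if_pos rfl]
      congr 2
      push_cast
      ring
    · rw [if_neg hk, if_neg (by omega), zero_smul]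
  have ei : m + n - k - 1 = m - k - 1 + n := by ring
  rw [hd, ← ea, ← eb]
  by_cases hk : k < 0
  · simp only [normalOrderTerm_of_neg _ _ _ hk, ncoeff_currentField, mode_bracket L b c, map_add,
      map_smul, mode_bracket L a c, ei]
    rw [← mode_comm h h']
    abel
  · simp only [normalOrderTerm_of_nonneg _ _ _ hk, ncoeff_currentField, mode_bracket L a c, map_add,
      map_smul, mode_bracket L b c, ei]
    abel

/-- The operator product expansion of `:a(z) b(z):` and `c(w)` when `[a, c]` commutes with `b`. -/
theorem hasOPE_normalOrder {a b c : L} (h : ⁅⁅a, c⁆, b⁆ = 0)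
    (h' : QuadraticLieAlgebra.form ⁅a, c⁆ b = 0) :
    HasOPE (normalOrder (currentField L a) (currentField L b)) (currentField L c)
      (normalOrder (currentField L ⁅a, c⁆) (currentField L b) +
        normalOrder (currentField L a) (currentField L ⁅b, c⁆) +
        (QuadraticLieAlgebra.form a c • derivField (currentField L b) +
          QuadraticLieAlgebra.form b c • derivField (currentField L a)))
      (QuadraticLieAlgebra.form a c • currentField L b +
        QuadraticLieAlgebra.form b c • currentField L a) := by
  intro m n v
  have hf := normalOrderTerm_finite (currentField L a) (currentField L b) m
  -- The index shift left over from the single summands is harmless, since the sum runs over all of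
  -- ℤ.
  have hshift : (∑ᶠ k : ℤ,
      normalOrderTerm (currentField L ⁅a, c⁆) (currentField L b) (m + n) (k + n) v) =
      ∑ᶠ k : ℤ, normalOrderTerm (currentField L ⁅a, c⁆) (currentField L b) (m + n) k v :=
    finsum_comp_equiv (Equiv.addRight n) (f := fun k =>
      normalOrderTerm (currentField L ⁅a, c⁆) (currentField L b) (m + n) k v)
  have hfin : (Function.support fun k : ℤ =>
      normalOrderTerm (currentField L ⁅a, c⁆) (currentField L b) (m + n) (k + n) v).Finite :=
    (normalOrderTerm_finite (currentField L ⁅a, c⁆) (currentField L b) (m + n) v).preimage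
      (f := fun k => k + n) (add_left_injective n).injOn
  have hδ (j : ℤ) (x : VacuumModule L) :
      (Function.support fun k : ℤ => if k = j then x else 0).Finite :=
    (Set.finite_singleton j).subset fun k hk => by
      by_contra hne
      exact hk (if_neg hne)
  have hsum (j : ℤ) (x : VacuumModule L) : (∑ᶠ k : ℤ, if k = j then x else 0) = x := by
    rw [finsum_eq_single _ j fun k hk => if_neg hk, if_pos rfl]
  rw [ncoeff_normalOrder, ncoeff_normalOrder, ncoeff_currentField,
    map_finsum (mode L c n) (hf v), ← finsum_sub_distrib (hf _)]
  · simp only [normalOrderTerm_comm_mode h h']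
    rw [finsum_add_distrib ((hfin.union (normalOrderTerm_finite _ _ _ v)).subset
        (Function.support_add _ _)) (((hδ _ _).union (hδ _ _)).subset (Function.support_add _ _)),
      finsum_add_distrib hfin (normalOrderTerm_finite _ _ _ v),
      finsum_add_distrib (hδ _ _) (hδ _ _), hsum, hsum, hshift]
    simp only [ncoeff_add_apply, ncoeff_smul_apply, ncoeff_normalOrder, ncoeff_derivField,
      ncoeff_currentField]
    -- The central terms carry the factor -n = -(m + n) + m. The first part is the mode of the
    -- derivative in the simple pole, the second is the double pole.
    push_cast
    module
  · refine (hf v).subset fun k hk hk' =>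
      hk ((congrArg (mode L c n) hk').trans (map_zero _))

/-- The operator product expansion of `½ :a(z) a(z):` and `c(w)`. -/
theorem hasOPE_half_normalOrder_self {a c : L} (h : ⁅⁅a, c⁆, a⁆ = 0) :
    HasOPE ((1 / 2 : ℂ) • normalOrder (currentField L a) (currentField L a)) (currentField L c)
      (normalOrder (currentField L a) (currentField L ⁅a, c⁆) +
        QuadraticLieAlgebra.form a c • derivField (currentField L a))
      (QuadraticLieAlgebra.form a c • currentField L a) := by
  -- By invariance this pairing is minus that of c with [a, a].
  have h' : QuadraticLieAlgebra.form ⁅a, c⁆ a = 0 := by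
    rw [QuadraticLieAlgebra.form_invariant a c a, lie_self, map_zero, neg_zero]
  -- The two first order terms of the derivation coincide, which cancels the factor ½.
  have hc : normalOrder (currentField L ⁅a, c⁆) (currentField L a) =
      normalOrder (currentField L a) (currentField L ⁅a, c⁆) :=
    normalOrder_comm fun m n v => by simpa only [ncoeff_currentField] using mode_comm h h' m n v
  convert (hasOPE_normalOrder h h').smul (1 / 2 : ℂ) using 1
  · rw [hc]
    module
  · module

theorem intertwines_currentField {L' : Type*} [LieRing L'] [LieAlgebra ℂ L']
    [QuadraticLieAlgebra L'] {Φ : VacuumModule L →ₗ[ℂ] VacuumModule L'} {f : L → L'}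
    (hΦ : ∀ a n v, Φ (mode L a n v) = mode L' (f a) n (Φ v)) {a : L} {b : L'} (hab : f a = b) :
    Intertwines Φ (currentField L a) (currentField L' b) := fun n v => by
  rw [ncoeff_currentField, ncoeff_currentField, hΦ, hab]

end CurrentFields

open TorusCurrents HeisCurrents

/-! ### Brackets and pairings of the torus currents -/

theorem torus_form_apply (s t : TorusCurrents ℂ) :
    QuadraticLieAlgebra.form s t = s.1 ⬝ᵥ t.2 + s.2 ⬝ᵥ t.1 := rfl

theorem lie_α_left (i : Fin 3) (s : TorusCurrents ℂ) : ⁅α ℂ i, s⁆ = 0 := by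
  apply TorusCurrents.ext' <;> intro k <;> simp

theorem lie_α_right (i : Fin 3) (s : TorusCurrents ℂ) : ⁅s, α ℂ i⁆ = 0 := by
  apply TorusCurrents.ext' <;> intro k <;> simp

/-- Addition in `Fin 3` is cyclic, so i, i + 1, i + 2 is always a positively oriented triple; this
replaces the ε symbol. -/
theorem lie_β_β_succ (i : Fin 3) : ⁅β ℂ (i + 1), β ℂ i⁆ = -α ℂ (i + 2) := by
  rw [eq_neg_iff_add_eq_zero]
  apply TorusCurrents.ext' <;> intro k <;> fin_cases i <;> fin_cases k <;> simp [cross_apply]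

theorem lie_β_β_succ_succ (i : Fin 3) : ⁅β ℂ (i + 2), β ℂ i⁆ = α ℂ (i + 1) := by
  apply TorusCurrents.ext' <;> intro k <;> fin_cases i <;> fin_cases k <;> simp [cross_apply]

/-- Brackets lie in the span of the central currents αⁱ, so the algebra is two-step nilpotent. This
supplies the commutation hypothesis of `hasOPE_half_normalOrder_self` for every summand of the
Hamiltonian. -/
theorem lie_lie_torus (s t r : TorusCurrents ℂ) : ⁅⁅s, t⁆, r⁆ = 0 := by
  apply TorusCurrents.ext' <;> intro k <;> simp [-lie_lie]

theorem form_α_α (i j : Fin 3) : QuadraticLieAlgebra.form (α ℂ i) (α ℂ j) = 0 := by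
  simp [torus_form_apply]

theorem form_β_β (i j : Fin 3) : QuadraticLieAlgebra.form (β ℂ i) (β ℂ j) = 0 := by
  simp [torus_form_apply]

theorem form_α_β (i j : Fin 3) :
    QuadraticLieAlgebra.form (α ℂ i) (β ℂ j) = if i = j then 1 else 0 := by
  simp [torus_form_apply, Pi.single_apply, eq_comm]

theorem form_β_α (i j : Fin 3) :
    QuadraticLieAlgebra.form (β ℂ i) (α ℂ j) = if i = j then 1 else 0 := by
  simp [torus_form_apply, Pi.single_apply, eq_comm]

/-! ### Operator product expansions with the Hamiltonians -/

theorem torusHamiltonian_eq_sum : torusHamiltonian =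
    ∑ i, ((1 / 2 : ℂ) • normalOrder (fieldα i) (fieldα i) +
      (1 / 2 : ℂ) • normalOrder (fieldβ i) (fieldβ i)) := by
  simp only [torusHamiltonian, Finset.smul_sum, smul_add]

theorem hasOPE_torusHamiltonian (c : TorusCurrents ℂ) :
    HasOPE torusHamiltonian (currentField _ c)
      (∑ i, ((normalOrder (fieldα i) (currentField _ ⁅α ℂ i, c⁆) +
          QuadraticLieAlgebra.form (α ℂ i) c • derivField (fieldα i)) +
        (normalOrder (fieldβ i) (currentField _ ⁅β ℂ i, c⁆) +
          QuadraticLieAlgebra.form (β ℂ i) c • derivField (fieldβ i))))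
      (∑ i, (QuadraticLieAlgebra.form (α ℂ i) c • fieldα i +
        QuadraticLieAlgebra.form (β ℂ i) c • fieldβ i)) := by
  rw [torusHamiltonian_eq_sum]
  exact HasOPE.sum _ fun i _ => (hasOPE_half_normalOrder_self (lie_lie_torus _ _ _)).add
    (hasOPE_half_normalOrder_self (lie_lie_torus _ _ _))

/-- Since αⁱ is central, no bracket terms appear, and its only non-zero pairing is with βᵢ. -/
theorem hasOPE_torusHamiltonian_α (i : Fin 3) :
    HasOPE torusHamiltonian (fieldα i) (derivField (fieldβ i)) (fieldβ i) := by
  convert hasOPE_torusHamiltonian (α ℂ i) using 1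
  · simp [lie_α_right, form_α_α, form_β_α, currentField_zero, normalOrder_zero_right]
  · simp [form_α_α, form_β_α]

/-- Starting the cyclic sum at i allows the expansion with βᵢ to be computed for all i at once. -/
theorem sum_fin_three_eq {M : Type*} [AddCommMonoid M] (f : Fin 3 → M) (i : Fin 3) :
    ∑ j, f j = f i + f (i + 1) + f (i + 2) := by
  rw [Fin.sum_univ_three]
  fin_cases i
  · rfl
  · change f 0 + f 1 + f 2 = f 1 + f 2 + f 0
    abel
  · change f 0 + f 1 + f 2 = f 2 + f 0 + f 1
    abel

theorem hasOPE_torusHamiltonian_β (i : Fin 3) :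
    HasOPE torusHamiltonian (fieldβ i)
      (derivField (fieldα i) - (normalOrder (fieldβ (i + 1)) (fieldα (i + 2)) -
        normalOrder (fieldβ (i + 2)) (fieldα (i + 1)))) (fieldα i) := by
  convert hasOPE_torusHamiltonian (β ℂ i) using 1
  · simp only [lie_α_left, form_α_β, form_β_β, currentField_zero, normalOrder_zero_right,
      ite_smul, one_smul, zero_smul, zero_add, add_zero, Finset.sum_add_distrib,
      Finset.sum_ite_eq', Finset.mem_univ, if_true]
    rw [sum_fin_three_eq _ i, lie_self, lie_β_β_succ, lie_β_β_succ_succ, currentField_zero,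
      normalOrder_zero_right, currentField_neg, normalOrder_neg_right]
    abel
  · simp [form_α_β, form_β_β]

theorem torusHamiltonian_vacuum :
    (torusHamiltonian[[-1]]) (vacuum _) = torusHamiltonianVector := by
  simp only [torusHamiltonian, ncoeff_smul_apply, ncoeff_sum_apply, ncoeff_add_apply,
    normalOrder_vacuum, torusHamiltonianVector]

theorem heisHamiltonian_vacuum :
    (heisHamiltonian[[-1]]) (vacuum _) = heisHamiltonianVector := by
  simp only [heisHamiltonian, ncoeff_smul_apply, ncoeff_sum_apply, ncoeff_add_apply,
    normalOrder_vacuum, heisHamiltonianVector, Finset.sum_add_distrib, smul_add]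

/-! ### T-duality of fields -/

theorem intertwines_X_zero : Intertwines tDualVacuum.toLinearMap (fieldX 0) (fieldβ 0) :=
  intertwines_currentField tDualVacuum_mode (tDual_X_zero ℂ)

theorem intertwines_X_one : Intertwines tDualVacuum.toLinearMap (fieldX 1) (-fieldα 1) := by
  rw [← currentField_neg]
  exact intertwines_currentField tDualVacuum_mode (tDual_X_one ℂ)

theorem intertwines_X_two : Intertwines tDualVacuum.toLinearMap (fieldX 2) (fieldβ 2) :=
  intertwines_currentField tDualVacuum_mode (tDual_X_two ℂ)

theorem intertwines_Y_zero : Intertwines tDualVacuum.toLinearMap (fieldY 0) (fieldα 0) :=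
  intertwines_currentField tDualVacuum_mode (tDual_Y_zero ℂ)

theorem intertwines_Y_one : Intertwines tDualVacuum.toLinearMap (fieldY 1) (-fieldβ 1) := by
  rw [← currentField_neg]
  exact intertwines_currentField tDualVacuum_mode (tDual_Y_one ℂ)

theorem intertwines_Y_two : Intertwines tDualVacuum.toLinearMap (fieldY 2) (fieldα 2) :=
  intertwines_currentField tDualVacuum_mode (tDual_Y_two ℂ)

/-- T permutes the basis up to sign, and each sign occurs twice in a normally ordered square. The
squares of X₂ and Y² become those of α² and β₂, which only regroups the sum. -/
theorem intertwines_hamiltonian :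
    Intertwines tDualVacuum.toLinearMap heisHamiltonian torusHamiltonian := by
  have h := (((intertwines_Y_zero.normalOrder intertwines_Y_zero).add
      (intertwines_Y_one.normalOrder intertwines_Y_one)).add
      (intertwines_Y_two.normalOrder intertwines_Y_two)).smul (1 / 2 : ℂ) |>.add
    ((((intertwines_X_zero.normalOrder intertwines_X_zero).add
      (intertwines_X_one.normalOrder intertwines_X_one)).add
      (intertwines_X_two.normalOrder intertwines_X_two)).smul (1 / 2 : ℂ))
  convert h using 1
  · simp only [heisHamiltonian, Fin.sum_univ_three]
  · simp only [torusHamiltonian, Fin.sum_univ_three, normalOrder_neg_left, normalOrder_neg_right,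
      neg_neg]
    module

theorem tDualVacuum_heisHamiltonianVector :
    tDualVacuum heisHamiltonianVector = torusHamiltonianVector := by
  rw [← heisHamiltonian_vacuum, ← torusHamiltonian_vacuum, ← tDualVacuum_vacuum]
  exact intertwines_hamiltonian _ _

/-- T-duality is injective, so expansions on the nilmanifold can be checked on the torus. `R` is the
term-by-term image of `P`, with its signs; `R'` is the form in which the torus expansion is known.
-/
theorem hasOPE_heisHamiltonian {B P Q : VertexOperator ℂ (VacuumModule (HeisCurrents ℂ))}
    {D R S R' : VertexOperator ℂ (VacuumModule (TorusCurrents ℂ))}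
    (hB : Intertwines tDualVacuum.toLinearMap B D) (hP : Intertwines tDualVacuum.toLinearMap P R)
    (hQ : Intertwines tDualVacuum.toLinearMap Q S) (h : HasOPE torusHamiltonian D R' S)
    (hR : R = R') : HasOPE heisHamiltonian B P Q :=
  (hR ▸ h).of_intertwines tDualVacuum.injective intertwines_hamiltonian hB hP hQ

theorem hasOPE_heisHamiltonian_X_zero :
    HasOPE heisHamiltonian (fieldX 0) (derivField (fieldY 0) +
      normalOrder (fieldY 1) (fieldY 2) - normalOrder (fieldX 2) (fieldX 1)) (fieldY 0) :=
  hasOPE_heisHamiltonian intertwines_X_zero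
    ((intertwines_Y_zero.derivField.add (intertwines_Y_one.normalOrder intertwines_Y_two)).sub
      (intertwines_X_two.normalOrder intertwines_X_one))
    intertwines_Y_zero (hasOPE_torusHamiltonian_β 0) (by
      simp only [normalOrder_neg_left, normalOrder_neg_right, zero_add]
      abel)

theorem hasOPE_heisHamiltonian_X_one :
    HasOPE heisHamiltonian (fieldX 1) (derivField (fieldY 1)) (fieldY 1) :=
  hasOPE_heisHamiltonian intertwines_X_one intertwines_Y_one.derivField intertwines_Y_one
    (hasOPE_torusHamiltonian_α 1).neg_right (derivField_neg _)

theorem hasOPE_heisHamiltonian_X_two :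
    HasOPE heisHamiltonian (fieldX 2) (derivField (fieldY 2) +
      normalOrder (fieldX 0) (fieldX 1) - normalOrder (fieldY 1) (fieldY 0)) (fieldY 2) :=
  hasOPE_heisHamiltonian intertwines_X_two
    ((intertwines_Y_two.derivField.add (intertwines_X_zero.normalOrder intertwines_X_one)).sub
      (intertwines_Y_one.normalOrder intertwines_Y_zero))
    intertwines_Y_two (hasOPE_torusHamiltonian_β 2) (by
      simp only [normalOrder_neg_left, normalOrder_neg_right, show (2 + 1 : Fin 3) = 0 from rfl,
        show (2 + 2 : Fin 3) = 1 from rfl]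
      abel)

theorem hasOPE_heisHamiltonian_Y_zero :
    HasOPE heisHamiltonian (fieldY 0) (derivField (fieldX 0)) (fieldX 0) :=
  hasOPE_heisHamiltonian intertwines_Y_zero intertwines_X_zero.derivField intertwines_X_zero
    (hasOPE_torusHamiltonian_α 0) rfl

theorem hasOPE_heisHamiltonian_Y_one :
    HasOPE heisHamiltonian (fieldY 1) (derivField (fieldX 1) +
      normalOrder (fieldX 2) (fieldY 0) - normalOrder (fieldX 0) (fieldY 2)) (fieldX 1) :=
  hasOPE_heisHamiltonian intertwines_Y_one
    ((intertwines_X_one.derivField.add (intertwines_X_two.normalOrder intertwines_Y_zero)).sub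
      (intertwines_X_zero.normalOrder intertwines_Y_two))
    intertwines_X_one (hasOPE_torusHamiltonian_β 1).neg_right (by
      simp only [derivField_neg, show (1 + 1 : Fin 3) = 2 from rfl,
        show (1 + 2 : Fin 3) = 0 from rfl]
      abel)

theorem hasOPE_heisHamiltonian_Y_two :
    HasOPE heisHamiltonian (fieldY 2) (derivField (fieldX 2)) (fieldX 2) :=
  hasOPE_heisHamiltonian intertwines_Y_two intertwines_X_two.derivField intertwines_X_two
    (hasOPE_torusHamiltonian_α 2) rfl

/-! ### The left-invariant metric and the Hamiltonian densities -/

section Metric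

theorem heisMul_eq_mulVec (a b : R3) :
    heisMul a b = !![1, 0, 0; -(1 / 2) * a 2, 1, 1 / 2 * a 0; 0, 0, 1] *ᵥ b + a := by
  funext i
  fin_cases i <;> simp [heisMul, dotProduct, Fin.sum_univ_three, add_comm]
  ring

/-- Left translation is affine, so its derivative is its linear part. The rows of this matrix are
the forms Yⁱ at y, hence the coframe is orthonormal. -/
theorem heisMetric_eq (y : R3) : heisMetric y =
    !![1, 0, 0; 1 / 2 * y 2, 1, -(1 / 2) * y 0; 0, 0, 1]ᵀ *
      !![1, 0, 0; 1 / 2 * y 2, 1, -(1 / 2) * y 0; 0, 0, 1] := by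
  have h : (fun z => heisMul (-y) z) =
      fun z => !![1, 0, 0; 1 / 2 * y 2, 1, -(1 / 2) * y 0; 0, 0, 1] *ᵥ z + -y := by
    funext z
    rw [heisMul_eq_mulVec]
    simp
  have hD : LinearMap.toMatrix' (fderiv ℝ (fun z => heisMul (-y) z) y : R3 →ₗ[ℝ] R3) =
      !![1, 0, 0; 1 / 2 * y 2, 1, -(1 / 2) * y 0; 0, 0, 1] := by
    rw [h, (hasFDerivAt_mulVec_add _ _ _).fderiv]
    exact LinearMap.toMatrix'_toLin' _
  rw [heisMetric, hD]

/-- The columns of this matrix are the dual frame Xᵢ, so it inverts the coframe matrix. -/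
theorem heisMetric_inv (y : R3) : (heisMetric y)⁻¹ =
    !![1, 0, 0; -(1 / 2) * y 2, 1, 1 / 2 * y 0; 0, 0, 1] *
      !![1, 0, 0; -(1 / 2) * y 2, 1, 1 / 2 * y 0; 0, 0, 1]ᵀ := by
  refine Matrix.inv_eq_right_inv ?_
  have h : !![1, 0, 0; 1 / 2 * y 2, 1, -(1 / 2) * y 0; 0, 0, 1] *
      !![1, 0, 0; -(1 / 2) * y 2, 1, 1 / 2 * y 0; 0, 0, 1] =
      (1 : Matrix (Fin 3) (Fin 3) ℝ) := by
    ext i j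
    fin_cases i <;> fin_cases j <;> simp [Matrix.mul_apply, Fin.sum_univ_three]
  rw [heisMetric_eq, Matrix.mul_assoc, ← Matrix.mul_assoc _ _ _ᵀ, h, Matrix.one_mul,
    ← Matrix.transpose_mul, mul_eq_one_comm.1 h, Matrix.transpose_one]

theorem heisMetric_mulVec (y v : R3) : heisMetric y *ᵥ v =
    ![v 0 + 1 / 2 * y 2 * (heisY 1 y ⬝ᵥ v), heisY 1 y ⬝ᵥ v,
      v 2 - 1 / 2 * y 0 * (heisY 1 y ⬝ᵥ v)] := by
  rw [heisMetric_eq, ← Matrix.mulVec_mulVec]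
  funext i
  fin_cases i <;> simp [Matrix.mulVec, heisY, dotProduct, Fin.sum_univ_three]
  all_goals ring

theorem heisMetric_inv_mulVec (y p : R3) : (heisMetric y)⁻¹ *ᵥ p =
    ![p 0 - 1 / 2 * y 2 * p 1, p 1 - 1 / 2 * y 2 * (p 0 - 1 / 2 * y 2 * p 1) +
      1 / 2 * y 0 * (p 2 + 1 / 2 * y 0 * p 1), p 2 + 1 / 2 * y 0 * p 1] := by
  rw [heisMetric_inv, ← Matrix.mulVec_mulVec]
  funext i
  fin_cases i <;> simp [Matrix.mulVec, dotProduct, Fin.sum_univ_three] <;> ring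

theorem heisY_one_dotProduct (y v : R3) :
    heisY 1 y ⬝ᵥ v = v 1 - 1 / 2 * y 0 * v 2 + 1 / 2 * y 2 * v 0 := by
  simp [heisY, dotProduct, Fin.sum_univ_three]
  ring

theorem heisMetric_mulVec_inv_mulVec (y p : R3) :
    heisMetric y *ᵥ ((heisMetric y)⁻¹ *ᵥ p) = p := by
  rw [heisMetric_mulVec, heisMetric_inv_mulVec, heisY_one_dotProduct]
  funext i
  fin_cases i <;> simp

theorem heisMetric_inv_mulVec_mulVec (y v : R3) :
    (heisMetric y)⁻¹ *ᵥ (heisMetric y *ᵥ v) = v := by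
  rw [heisMetric_mulVec, heisMetric_inv_mulVec, heisY_one_dotProduct]
  funext i
  fin_cases i <;> simp

theorem hamDensity_flatMetric (x r p : R3) : hamDensity flatMetric x r p =
    1 / 2 * ∑ i, ((torusCurrentsAt r p).2 i ^ 2 + (torusCurrentsAt r p).1 i ^ 2) := by
  simp [hamDensity, flatMetric, torusCurrentsAt, dotProduct, Fin.sum_univ_three]
  ring

theorem heisCurrentsAt_fst (y r p : R3) : (heisCurrentsAt y r p).1 =
    ![p 0 - 1 / 2 * y 2 * p 1, p 1, p 2 + 1 / 2 * y 0 * p 1] := by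
  funext i
  fin_cases i <;> simp [heisCurrentsAt, heisX, dotProduct, Fin.sum_univ_three] <;> ring

theorem heisCurrentsAt_snd (y r p : R3) : (heisCurrentsAt y r p).2 =
    ![r 0, heisY 1 y ⬝ᵥ r, r 2] := by
  funext i
  fin_cases i <;> simp [heisCurrentsAt, heisY, dotProduct, Fin.sum_univ_three]

/-- Orthonormality of the frame: the covector g v evaluated on Xᵢ is Yⁱ(v). -/
theorem heisCurrentsAt_metric_fst (y r v : R3) : (heisCurrentsAt y r (heisMetric y *ᵥ v)).1 =
    ![v 0, heisY 1 y ⬝ᵥ v, v 2] := by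
  rw [heisCurrentsAt_fst, heisMetric_mulVec]
  funext i
  fin_cases i <;> simp

theorem hamDensity_heisMetric (y r p : R3) : hamDensity heisMetric y r p =
    1 / 2 * ∑ i, (heisCurrentsAt y r p).2 i ^ 2 +
      1 / 2 * ∑ i, (heisCurrentsAt y r p).1 i ^ 2 := by
  rw [hamDensity, heisMetric_mulVec, heisMetric_inv_mulVec, heisCurrentsAt_fst,
    heisCurrentsAt_snd, heisY_one_dotProduct]
  simp only [dotProduct, Fin.sum_univ_three, Matrix.cons_val_zero, Matrix.cons_val_one,
    Matrix.cons_val]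
  ring

/-- Each density is half the sum of the squares of its six currents, and T permutes these up to
sign. -/
theorem hamDensity_eq_of_tDual (x r p y r' p' : R3)
    (h : tDual ℝ (heisCurrentsAt y r' p') = torusCurrentsAt r p) :
    hamDensity heisMetric y r' p' = hamDensity flatMetric x r p := by
  rw [hamDensity_heisMetric, hamDensity_flatMetric, ← h, tDual_fst, tDual_snd]
  simp only [Fin.sum_univ_three, Matrix.cons_val_zero, Matrix.cons_val_one, Matrix.cons_val]
  ring

end Metric

/-! ### Partial derivatives of the densities -/

section DensityDerivatives

/-- A partial derivative can be read off from an exact quadratic expansion. -/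
theorem pd_eq_of_expansion {f : R3 → ℝ} {q : R3} {k : Fin 3} {c e : ℝ}
    (hf : DifferentiableAt ℝ f q)
    (h : ∀ t : ℝ, f (q + t • Pi.single k 1) = f q + c * t + e * t ^ 2) : pd k f q = c := by
  have h₁ : HasDerivAt (fun t : ℝ => q + t • (Pi.single k 1 : R3)) (Pi.single k 1) 0 := by
    simpa using ((hasDerivAt_id (0 : ℝ)).smul_const (Pi.single k 1 : R3)).const_add q
  have h₂ : HasDerivAt (fun t : ℝ => f (q + t • Pi.single k 1)) (pd k f q) 0 := by
    refine HasFDerivAt.comp_hasDerivAt (f := fun t : ℝ => q + t • (Pi.single k 1 : R3)) 0 ?_ h₁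
    simpa using hf.hasFDerivAt
  simp only [h] at h₂
  have h₃ : HasDerivAt (fun t : ℝ => f q + c * t + e * t ^ 2) c 0 := by
    simpa using (((hasDerivAt_id' (0 : ℝ)).const_mul c).const_add (f q)).fun_add
      ((hasDerivAt_pow 2 (0 : ℝ)).const_mul e)
  exact h₂.unique h₃

theorem hamDensity_flatMetric_eq (x r p : R3) : hamDensity flatMetric x r p =
    1 / 2 * (r 0 ^ 2 + r 1 ^ 2 + r 2 ^ 2) + 1 / 2 * (p 0 ^ 2 + p 1 ^ 2 + p 2 ^ 2) := by
  rw [hamDensity_flatMetric]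
  simp [torusCurrentsAt, Fin.sum_univ_three]
  ring

theorem pd_hamDensity_flatMetric_momentum (x r p : R3) (i : Fin 3) :
    pd i (fun p' => hamDensity flatMetric x r p') p = p i := by
  simp only [hamDensity_flatMetric_eq]
  refine pd_eq_of_expansion (e := 1 / 2) (by fun_prop) fun t => ?_
  fin_cases i <;> simp <;> ring

theorem pd_hamDensity_flatMetric_velocity (x r p : R3) (i : Fin 3) :
    pd i (fun r' => hamDensity flatMetric x r' p) r = r i := by
  simp only [hamDensity_flatMetric_eq]
  refine pd_eq_of_expansion (e := 1 / 2) (by fun_prop) fun t => ?_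
  fin_cases i <;> simp <;> ring

theorem pd_hamDensity_flatMetric_position (x r p : R3) (i : Fin 3) :
    pd i (fun x' => hamDensity flatMetric x' r p) x = 0 := by
  simp only [hamDensity_flatMetric_eq, pd_fun_const]

theorem hamDensity_heisMetric_eq (y r p : R3) : hamDensity heisMetric y r p =
    1 / 2 * (r 0 ^ 2 + (r 1 - 1 / 2 * y 0 * r 2 + 1 / 2 * y 2 * r 0) ^ 2 + r 2 ^ 2) +
      1 / 2 * ((p 0 - 1 / 2 * y 2 * p 1) ^ 2 + p 1 ^ 2 + (p 2 + 1 / 2 * y 0 * p 1) ^ 2) := by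
  rw [hamDensity_heisMetric, heisCurrentsAt_fst, heisCurrentsAt_snd, heisY_one_dotProduct]
  simp [Fin.sum_univ_three]

theorem pd_hamDensity_heisMetric_momentum (y r p : R3) (i : Fin 3) :
    pd i (fun p' => hamDensity heisMetric y r p') p = ((heisMetric y)⁻¹ *ᵥ p) i := by
  simp only [hamDensity_heisMetric_eq, heisMetric_inv_mulVec]
  -- The density is quadratic in p, so the coefficient of t² is its value on the basis covector with
  -- r = 0.
  refine pd_eq_of_expansion (e := hamDensity heisMetric y 0 (Pi.single i 1))
    (by fun_prop) fun t => ?_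
  simp only [hamDensity_heisMetric_eq]
  fin_cases i <;> simp <;> ring

theorem pd_hamDensity_heisMetric_velocity (y r p : R3) (i : Fin 3) :
    pd i (fun r' => hamDensity heisMetric y r' p) r = (heisMetric y *ᵥ r) i := by
  simp only [hamDensity_heisMetric_eq, heisMetric_mulVec, heisY_one_dotProduct]
  refine pd_eq_of_expansion (e := hamDensity heisMetric y (Pi.single i 1) 0)
    (by fun_prop) fun t => ?_
  simp only [hamDensity_heisMetric_eq]
  fin_cases i <;> simp <;> ring

/-- The momentum stays frozen at g(y) v while the position varies. The contributions come from Y² on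
r and from X₁, X₃ on p; none of these involves y². -/
theorem pd_hamDensity_heisMetric_position (y r v : R3) (i : Fin 3) :
    pd i (fun y' => hamDensity heisMetric y' r (heisMetric y *ᵥ v)) y =
      ![1 / 2 * ((heisY 1 y ⬝ᵥ v) * v 2 - (heisY 1 y ⬝ᵥ r) * r 2), 0,
        1 / 2 * ((heisY 1 y ⬝ᵥ r) * r 0 - (heisY 1 y ⬝ᵥ v) * v 0)] i := by
  simp only [hamDensity_heisMetric_eq, heisMetric_mulVec, heisY_one_dotProduct]
  -- The coefficient of t² collects the squares of the slopes ±½ r³ or ½ r¹ of Y² on r, and ±½ p₂ of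
  -- X₃ or X₁ on p, where p₂ = Y²(v).
  refine pd_eq_of_expansion
    (e := ![1 / 8 * (r 2 ^ 2 + (heisY 1 y ⬝ᵥ v) ^ 2), 0,
      1 / 8 * (r 0 ^ 2 + (heisY 1 y ⬝ᵥ v) ^ 2)] i) (by fun_prop) fun t => ?_
  simp only [heisY_one_dotProduct]
  fin_cases i <;> simp <;> ring

end DensityDerivatives

/-! ### Calculus on the worldsheet and the Poincaré lemma -/

section WorldsheetCalculus

variable {F : Type*} [NormedAddCommGroup F] [NormedSpace ℝ F]

/-- The derivative of a worldsheet field in the direction `v`; thus `dσ = pdir (1, 0)` and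
`dτ = pdir (0, 1)`. -/
def pdir (v : ℝ × ℝ) (f : ℝ × ℝ → F) (w : ℝ × ℝ) : F := fderiv ℝ f w v

theorem dσ_eq_pdir : (dσ : (ℝ × ℝ → F) → ℝ × ℝ → F) = pdir (1, 0) := rfl

theorem dτ_eq_pdir : (dτ : (ℝ × ℝ → F) → ℝ × ℝ → F) = pdir (0, 1) := rfl

theorem box_eq_pdir (f : ℝ × ℝ → F) (w : ℝ × ℝ) :
    box f w = pdir (0, 1) (pdir (0, 1) f) w - pdir (1, 0) (pdir (1, 0) f) w := rfl

variable {W : Set (ℝ × ℝ)} {w : ℝ × ℝ} {u v : ℝ × ℝ}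

theorem pdir_congr {f g : ℝ × ℝ → F} (hW : IsOpen W) (h : Set.EqOn f g W) (v : ℝ × ℝ) :
    Set.EqOn (pdir v f) (pdir v g) W := fun w hw => by
  rw [pdir, pdir, (h.eventuallyEq_of_mem (hW.mem_nhds hw)).fderiv_eq]

theorem box_congr {f g : ℝ × ℝ → F} (hW : IsOpen W) (h : Set.EqOn f g W) :
    Set.EqOn (box f) (box g) W := fun w hw => by
  rw [box_eq_pdir, box_eq_pdir, pdir_congr hW (pdir_congr hW h _) _ hw,
    pdir_congr hW (pdir_congr hW h _) _ hw]

theorem contDiffOn_pdir {f : ℝ × ℝ → F} {m n : WithTop ℕ∞} (hW : IsOpen W)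
    (hf : ContDiffOn ℝ n f W) (hmn : m + 1 ≤ n) (v : ℝ × ℝ) : ContDiffOn ℝ m (pdir v f) W :=
  (hf.fderiv_of_isOpen hW hmn).clm_apply contDiffOn_const

theorem differentiableOn_pdir {f : ℝ × ℝ → F} (hW : IsOpen W) (hf : ContDiffOn ℝ 2 f W)
    (v : ℝ × ℝ) : DifferentiableOn ℝ (pdir v f) W :=
  (contDiffOn_pdir (m := 1) hW hf (by norm_num [one_add_one_eq_two]) v).differentiableOn one_ne_zero

theorem pdir_comm {f : ℝ × ℝ → F} (hW : IsOpen W) (hf : ContDiffOn ℝ 2 f W) (hw : w ∈ W)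
    (u v : ℝ × ℝ) : pdir u (pdir v f) w = pdir v (pdir u f) w := by
  have hd : DifferentiableAt ℝ (fderiv ℝ f) w :=
    ((hf.fderiv_of_isOpen (m := 1) hW (by norm_num [one_add_one_eq_two])).differentiableOn
      one_ne_zero).differentiableAt (hW.mem_nhds hw)
  have h (u v : ℝ × ℝ) : pdir u (pdir v f) w = fderiv ℝ (fderiv ℝ f) w u v := by
    change fderiv ℝ (fun w => fderiv ℝ f w v) w u = _
    rw [fderiv_clm_apply hd (differentiableAt_const v)]
    simp
  rw [h, h]
  exact ((hf.contDiffAt (hW.mem_nhds hw)).isSymmSndFDerivAt (by simp)).eq u v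

theorem pdir_apply {x : ℝ × ℝ → R3} (hx : DifferentiableAt ℝ x w) (v : ℝ × ℝ) (i : Fin 3) :
    pdir v x w i = pdir v (fun w => x w i) w := by
  rw [pdir, pdir, (hasFDerivAt_pi'.1 hx.hasFDerivAt i).fderiv]
  rfl

theorem pdir_mul {f g : ℝ × ℝ → ℝ} (hf : DifferentiableAt ℝ f w) (hg : DifferentiableAt ℝ g w) :
    pdir u (fun w => f w * g w) w = pdir u f w * g w + f w * pdir u g w := by
  rw [pdir, fderiv_fun_mul hf hg]
  simp [pdir]
  ring

theorem pdir_const_mul {f : ℝ × ℝ → ℝ} (hf : DifferentiableAt ℝ f w) (c : ℝ) :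
    pdir u (fun w => c * f w) w = c * pdir u f w := by
  rw [pdir, fderiv_const_mul hf]
  simp [pdir]

theorem pdir_add {f g : ℝ × ℝ → F} (hf : DifferentiableAt ℝ f w) (hg : DifferentiableAt ℝ g w) :
    pdir u (fun w => f w + g w) w = pdir u f w + pdir u g w := by
  rw [pdir, fderiv_fun_add hf hg]
  simp [pdir]

theorem pdir_sub {f g : ℝ × ℝ → F} (hf : DifferentiableAt ℝ f w) (hg : DifferentiableAt ℝ g w) :
    pdir u (fun w => f w - g w) w = pdir u f w - pdir u g w := by
  rw [pdir, fderiv_fun_sub hf hg]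
  simp [pdir]

theorem pdir_neg (f : ℝ × ℝ → F) : pdir u (fun w => -f w) w = -pdir u f w := by
  rw [pdir, fderiv_fun_neg]
  simp [pdir]

theorem pdir_smul {f : ℝ × ℝ → F} (hf : DifferentiableAt ℝ f w) (c : ℝ) :
    pdir u (fun w => c • f w) w = c • pdir u f w := by
  rw [pdir, fderiv_fun_const_smul hf]
  simp [pdir]

theorem pdir_const (c : F) : pdir u (fun _ => c) w = 0 := by
  simp [pdir]

theorem pdir_fst {G : Type*} [NormedAddCommGroup G] [NormedSpace ℝ G] {z : ℝ × ℝ → F × G}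
    (hz : DifferentiableAt ℝ z w) : (pdir u z w).1 = pdir u (fun w => (z w).1) w := by
  rw [pdir, pdir, hz.hasFDerivAt.fst.fderiv]
  rfl

theorem pdir_snd {G : Type*} [NormedAddCommGroup G] [NormedSpace ℝ G] {z : ℝ × ℝ → F × G}
    (hz : DifferentiableAt ℝ z w) : (pdir u z w).2 = pdir u (fun w => (z w).2) w := by
  rw [pdir, pdir, hz.hasFDerivAt.snd.fderiv]
  rfl

/-- The cross product as a continuous bilinear map. -/
def crossCLM : R3 →L[ℝ] R3 →L[ℝ] R3 :=
  LinearMap.toContinuousBilinearMap (crossProduct : R3 →ₗ[ℝ] R3 →ₗ[ℝ] R3)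

theorem pdir_cross {x y : ℝ × ℝ → R3} (hx : DifferentiableAt ℝ x w)
    (hy : DifferentiableAt ℝ y w) :
    pdir u (fun w => x w ⨯₃ y w) w = x w ⨯₃ pdir u y w + pdir u x w ⨯₃ y w := by
  have h : HasFDerivAt (fun w => x w ⨯₃ y w) _ w :=
    crossCLM.hasFDerivAt_of_bilinear hx.hasFDerivAt hy.hasFDerivAt
  rw [pdir, h.fderiv]
  rfl

theorem contDiffOn_cross {x y : ℝ × ℝ → R3} {n : WithTop ℕ∞} (hx : ContDiffOn ℝ n x W)
    (hy : ContDiffOn ℝ n y W) : ContDiffOn ℝ n (fun w => x w ⨯₃ y w) W :=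
  (crossCLM.contDiff.comp_contDiffOn hx).clm_apply hy

theorem fderiv_eq_pdir (f : ℝ × ℝ → F) (w v : ℝ × ℝ) :
    fderiv ℝ f w v = v.1 • pdir (1, 0) f w + v.2 • pdir (0, 1) f w := by
  rw [pdir, pdir, ← map_smul, ← map_smul, ← map_add]
  simp

/-- Two fields with the same first derivatives on a convex open set differ by a constant. -/
theorem exists_eq_add_const_of_pdir_eq {f g : ℝ × ℝ → F} (hW : IsOpen W) (hc : Convex ℝ W)
    (hf : DifferentiableOn ℝ f W) (hg : DifferentiableOn ℝ g W)
    (hσ : Set.EqOn (pdir (1, 0) f) (pdir (1, 0) g) W)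
    (hτ : Set.EqOn (pdir (0, 1) f) (pdir (0, 1) g) W) :
    ∃ c, ∀ w ∈ W, f w = g w + c :=
  hW.exists_eq_add_of_fderiv_eq hc.isPreconnected hf hg fun w hw =>
    ContinuousLinearMap.ext fun v => by
      rw [fderiv_eq_pdir, fderiv_eq_pdir g, hσ hw, hτ hw]

/-- A closed pair `(P, Q)` of class `C^m` on a convex open set is the pair of first derivatives of
a function of class `C^(m + 1)`. -/
theorem exists_primitive [CompleteSpace F] {P Q : ℝ × ℝ → F} {m : ℕ∞} (hW : IsOpen W)
    (hc : Convex ℝ W) (hm : 1 ≤ m) (hP : ContDiffOn ℝ m P W) (hQ : ContDiffOn ℝ m Q W)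
    (h : ∀ w ∈ W, pdir (0, 1) P w = pdir (1, 0) Q w) :
    ∃ f : ℝ × ℝ → F, ContDiffOn ℝ (m + 1) f W ∧
      ∀ w ∈ W, pdir (1, 0) f w = P w ∧ pdir (0, 1) f w = Q w := by
  have hm' : (m : WithTop ℕ∞) ≠ 0 := by
    simpa using (zero_lt_one.trans_le hm).ne'
  -- The 1-form P dσ + Q dτ; the hypothesis `h` is its closedness, that is, symmetry of the
  -- derivative of ω.
  set ω : ℝ × ℝ → ℝ × ℝ →L[ℝ] F := fun w =>
    (ContinuousLinearMap.fst ℝ ℝ ℝ).smulRight (P w) +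
      (ContinuousLinearMap.snd ℝ ℝ ℝ).smulRight (Q w) with hω
  have hωm : ContDiffOn ℝ m ω W :=
    (contDiffOn_const.smulRight hP).add (contDiffOn_const.smulRight hQ)
  have hωd : DifferentiableOn ℝ ω W := hωm.differentiableOn hm'
  have hsymm : ∀ a ∈ W, ∀ x y, fderiv ℝ ω a x y = fderiv ℝ ω a y x := by
    intro a ha x y
    have hPa := (hP.differentiableOn hm').differentiableAt (hW.mem_nhds ha)
    have hQa := (hQ.differentiableOn hm').differentiableAt (hW.mem_nhds ha)
    have e (x y : ℝ × ℝ) :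
        fderiv ℝ ω a x y = y.1 • fderiv ℝ P a x + y.2 • fderiv ℝ Q a x := by
      have h₁ : fderiv ℝ (fun w => ω w y) a x = fderiv ℝ ω a x y := by
        rw [fderiv_clm_apply (hωd.differentiableAt (hW.mem_nhds ha)) (differentiableAt_const y)]
        simp
      rw [← h₁]
      change pdir x (fun w => y.1 • P w + y.2 • Q w) a = _
      rw [pdir_add (hPa.fun_const_smul _) (hQa.fun_const_smul _), pdir_smul hPa, pdir_smul hQa]
      rfl
    rw [e, e, fderiv_eq_pdir P, fderiv_eq_pdir Q, fderiv_eq_pdir P, fderiv_eq_pdir Q, h a ha]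
    module
  obtain ⟨f, hf⟩ := hc.exists_forall_hasFDerivAt_of_fderiv_symmetric hW hωd hsymm
  refine ⟨f, ?_, fun w hw => ?_⟩
  · rw [contDiffOn_succ_iff_fderiv_of_isOpen hW]
    refine ⟨fun w hw => (hf w hw).differentiableAt.differentiableWithinAt, fun h => ?_,
      hωm.congr fun w hw => (hf w hw).fderiv⟩
    -- The side condition concerns analytic regularity, which is excluded because m lies in ℕ∞.
    simp at h
  · rw [pdir, pdir, (hf w hw).fderiv]
    simp [hω]

theorem isOpen_worldsheet {J : Set ℝ} (hJ : IsOpen J) : IsOpen (worldsheet J) :=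
  hJ.preimage continuous_snd

theorem convex_worldsheet {J : Set ℝ} (hJ : Convex ℝ J) : Convex ℝ (worldsheet J) :=
  hJ.linear_preimage (LinearMap.snd ℝ ℝ ℝ)

theorem shift_mem_worldsheet {J : Set ℝ} (hw : w ∈ worldsheet J) : shift w ∈ worldsheet J := hw

theorem pdir_comp_shift (f : ℝ × ℝ → F) (v w : ℝ × ℝ) :
    pdir v (fun w => f (shift w)) w = pdir v f (shift w) := by
  have h : shift = fun w : ℝ × ℝ => w + (1, 0) := by
    funext w
    simp [shift, Prod.ext_iff]
  rw [pdir, pdir, h, fderiv_comp_add_right]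

theorem contDiff_shift {n : WithTop ℕ∞} : ContDiff ℝ n shift :=
  (contDiff_fst.add contDiff_const).prodMk contDiff_snd

end WorldsheetCalculus

variable {W : Set (ℝ × ℝ)} {w : ℝ × ℝ} {u v : ℝ × ℝ}

/-! ### Hamilton's equations as second order systems -/

section HamiltonEquations

/-- The component `θ_v = ∂_v y² - ½ y¹ ∂_v y³ + ½ y³ ∂_v y¹` of the Maurer-Cartan form. -/
def heisθ (v : ℝ × ℝ) (y : ℝ × ℝ → R3) (w : ℝ × ℝ) : ℝ := heisY 1 (y w) ⬝ᵥ pdir v y w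

theorem heisθ_apply (v : ℝ × ℝ) (y : ℝ × ℝ → R3) (w : ℝ × ℝ) : heisθ v y w =
    pdir v y w 1 - 1 / 2 * y w 0 * pdir v y w 2 + 1 / 2 * y w 2 * pdir v y w 0 :=
  heisY_one_dotProduct _ _

theorem differentiableAt_of_contDiffOn {F : Type*} [NormedAddCommGroup F] [NormedSpace ℝ F]
    {f : ℝ × ℝ → F} (hW : IsOpen W) (hf : ContDiffOn ℝ 2 f W) (hw : w ∈ W) :
    DifferentiableAt ℝ f w :=
  (hf.differentiableOn two_ne_zero).differentiableAt (hW.mem_nhds hw)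

theorem differentiableAt_pdir {F : Type*} [NormedAddCommGroup F] [NormedSpace ℝ F]
    {f : ℝ × ℝ → F} (hW : IsOpen W) (hf : ContDiffOn ℝ 2 f W) (hw : w ∈ W) (v : ℝ × ℝ) :
    DifferentiableAt ℝ (pdir v f) w :=
  (differentiableOn_pdir hW hf v).differentiableAt (hW.mem_nhds hw)

section SecondOrder

variable {y : ℝ × ℝ → R3} (hW : IsOpen W) (hy : ContDiffOn ℝ 2 y W) (hw : w ∈ W)
include hW hy hw

theorem differentiableAt_heisθ (v : ℝ × ℝ) : DifferentiableAt ℝ (heisθ v y) w := by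
  have h := differentiableAt_pi.1 (differentiableAt_of_contDiffOn hW hy hw)
  have h' := differentiableAt_pi.1 (differentiableAt_pdir hW hy hw v)
  rw [show heisθ v y = _ from funext (heisθ_apply v y)]
  exact ((h' 1).fun_sub (((h 0).const_mul _).fun_mul (h' 2))).fun_add
    (((h 2).const_mul _).fun_mul (h' 0))

theorem pdir_heisθ (u v : ℝ × ℝ) : pdir u (heisθ v y) w =
    pdir u (pdir v y) w 1 -
      1 / 2 * (pdir u y w 0 * pdir v y w 2 + y w 0 * pdir u (pdir v y) w 2) +
      1 / 2 * (pdir u y w 2 * pdir v y w 0 + y w 2 * pdir u (pdir v y) w 0) := by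
  have h₀ := differentiableAt_of_contDiffOn hW hy hw
  have h₁ := differentiableAt_pdir hW hy hw v
  have h := differentiableAt_pi.1 h₀
  have h' := differentiableAt_pi.1 h₁
  have e : heisθ v y = fun w => pdir v y w 1 - 1 / 2 * (y w 0 * pdir v y w 2) +
      1 / 2 * (y w 2 * pdir v y w 0) := by
    funext w
    rw [heisθ_apply]
    ring
  rw [e, pdir_add ((h' 1).fun_sub (((h 0).fun_mul (h' 2)).const_mul _))
      (((h 2).fun_mul (h' 0)).const_mul _),
    pdir_sub (h' 1) (((h 0).fun_mul (h' 2)).const_mul _),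
    pdir_const_mul ((h 0).fun_mul (h' 2)), pdir_const_mul ((h 2).fun_mul (h' 0)),
    pdir_mul (h 0) (h' 2), pdir_mul (h 2) (h' 0)]
  simp only [← pdir_apply h₀, ← pdir_apply h₁]

theorem differentiableAt_metric_mulVec_pdir (v : ℝ × ℝ) :
    DifferentiableAt ℝ (fun w => heisMetric (y w) *ᵥ pdir v y w) w := by
  have h := differentiableAt_pi.1 (differentiableAt_of_contDiffOn hW hy hw)
  have h' := differentiableAt_pi.1 (differentiableAt_pdir hW hy hw v)
  have hθ : DifferentiableAt ℝ (fun w => heisY 1 (y w) ⬝ᵥ pdir v y w) w :=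
    differentiableAt_heisθ hW hy hw v
  simp only [heisMetric_mulVec]
  refine differentiableAt_pi.2 fun i => ?_
  fin_cases i
  · exact (h' 0).fun_add (((h 2).const_mul _).fun_mul hθ)
  · exact hθ
  · exact (h' 2).fun_sub (((h 0).const_mul _).fun_mul hθ)

/-- Both the momentum g ∂_τ y and the velocity derivative g ∂_σ y of the density have this shape;
Hamilton's equations use it for u = v = ∂_τ and u = v = ∂_σ. -/
theorem pdir_metric_mulVec_pdir (u v : ℝ × ℝ) (i : Fin 3) :
    pdir u (fun w => (heisMetric (y w) *ᵥ pdir v y w) i) w =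
      ![pdir u (pdir v y) w 0 +
          1 / 2 * (pdir u y w 2 * heisθ v y w + y w 2 * pdir u (heisθ v y) w),
        pdir u (heisθ v y) w,
        pdir u (pdir v y) w 2 -
          1 / 2 * (pdir u y w 0 * heisθ v y w + y w 0 * pdir u (heisθ v y) w)] i := by
  have h₀ := differentiableAt_of_contDiffOn hW hy hw
  have h₁ := differentiableAt_pdir hW hy hw v
  have h := differentiableAt_pi.1 h₀
  have h' := differentiableAt_pi.1 h₁
  have hθ := differentiableAt_heisθ hW hy hw v
  simp only [heisMetric_mulVec]
  fin_cases i
  · change pdir u (fun w => pdir v y w 0 + 1 / 2 * y w 2 * heisθ v y w) w = _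
    simp only [mul_assoc]
    rw [pdir_add (h' 0) (((h 2).fun_mul hθ).const_mul _), pdir_const_mul ((h 2).fun_mul hθ),
      pdir_mul (h 2) hθ, ← pdir_apply h₀, ← pdir_apply h₁]
    rfl
  · rfl
  · change pdir u (fun w => pdir v y w 2 - 1 / 2 * y w 0 * heisθ v y w) w = _
    simp only [mul_assoc]
    rw [pdir_sub (h' 2) (((h 0).fun_mul hθ).const_mul _), pdir_const_mul ((h 0).fun_mul hθ),
      pdir_mul (h 0) hθ, ← pdir_apply h₀, ← pdir_apply h₁]
    rfl

/-- The second equation of the nilmanifold is the conservation law for `θ`. -/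
theorem pdir_heisθ_sub : pdir (0, 1) (heisθ (0, 1) y) w - pdir (1, 0) (heisθ (1, 0) y) w =
    box y w 1 - (1 / 2 * y w 0 * box y w 2 - 1 / 2 * y w 2 * box y w 0) := by
  -- When both directions agree, the products of first derivatives cancel and only second
  -- derivatives remain.
  rw [pdir_heisθ hW hy hw, pdir_heisθ hW hy hw]
  simp only [box_eq_pdir, Pi.sub_apply]
  ring

end SecondOrder

theorem heisEOM_iff (y : ℝ × ℝ → R3) : HeisEOM W y ↔ ∀ w ∈ W,
    box y w 0 = heisθ (1, 0) y w * pdir (1, 0) y w 2 - pdir (0, 1) y w 2 * heisθ (0, 1) y w ∧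
    box y w 1 = 1 / 2 * y w 0 * box y w 2 - 1 / 2 * y w 2 * box y w 0 ∧
    box y w 2 =
      pdir (0, 1) y w 0 * heisθ (0, 1) y w - heisθ (1, 0) y w * pdir (1, 0) y w 0 := Iff.rfl

/-- Hamilton's equations on the torus with `H`-flux. -/
theorem isHamiltonianMotion_torus_iff {x p : ℝ × ℝ → R3} (hW : IsOpen W)
    (hx : ContDiffOn ℝ 2 x W) :
    IsHamiltonianMotion (hamDensity flatMetric) volFlux W x p ↔
      (∀ w ∈ W, p w = flatMetric (x w) *ᵥ dτ x w) ∧ TorusEOM W x := by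
  have hflat (w : ℝ × ℝ) : flatMetric (x w) *ᵥ dτ x w = dτ x w := by simp [flatMetric]
  -- The first Hamilton equation fixes p; once it is substituted, the second is a component of (A).
  have key : (∀ w ∈ W, p w = dτ x w) → ∀ w ∈ W, ∀ i,
      (dτ x w i = pd i (fun p' => hamDensity flatMetric (x w) (dσ x w) p') (p w) ∧
      dτ p w i = - pd i (fun q' => hamDensity flatMetric q' (dσ x w) (p w)) (x w)
        + dσ (fun w' => pd i (fun r => hamDensity flatMetric (x w') r (p w')) (dσ x w')) w
        - volFlux (dτ x w) (dσ x w) i) ↔ (box x w + dτ x w ⨯₃ dσ x w) i = 0 := by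
    intro hp w hw i
    have hd := differentiableAt_pdir hW hx hw (1, 0)
    simp only [pd_hamDensity_flatMetric_momentum, pd_hamDensity_flatMetric_velocity,
      pd_hamDensity_flatMetric_position, hp w hw, true_and, volFlux]
    simp only [dσ_eq_pdir, dτ_eq_pdir, box_eq_pdir] at hp ⊢
    rw [pdir_congr hW hp _ hw, ← pdir_apply hd, Pi.add_apply, Pi.sub_apply]
    constructor <;> intro h <;> linear_combination h
  simp only [hflat]
  constructor
  · intro h
    have hp : ∀ w ∈ W, p w = dτ x w := fun w hw => funext fun i => by
      rw [(h w hw i).1, pd_hamDensity_flatMetric_momentum]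
    exact ⟨hp, fun w hw => funext fun i => (key hp w hw i).1 (h w hw i)⟩
  · rintro ⟨hp, h⟩ w hw i
    exact (key hp w hw i).2 (congrFun (h w hw) i)

/-- Hamilton's equations on the Heisenberg nilmanifold. -/
theorem isHamiltonianMotion_heis_iff {y p : ℝ × ℝ → R3} (hW : IsOpen W)
    (hy : ContDiffOn ℝ 2 y W) :
    IsHamiltonianMotion (hamDensity heisMetric) 0 W y p ↔
      (∀ w ∈ W, p w = heisMetric (y w) *ᵥ dτ y w) ∧ HeisEOM W y := by
  have key : (∀ w ∈ W, p w = heisMetric (y w) *ᵥ dτ y w) → ∀ w ∈ W,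
      (∀ i, (dτ y w i = pd i (fun p' => hamDensity heisMetric (y w) (dσ y w) p') (p w) ∧
      dτ p w i = - pd i (fun q' => hamDensity heisMetric q' (dσ y w) (p w)) (y w)
        + dσ (fun w' => pd i (fun r => hamDensity heisMetric (y w') r (p w')) (dσ y w')) w
        - (0 : R3 → R3 → R3) (dτ y w) (dσ y w) i)) ↔
      (box y w 0 = heisθ (1, 0) y w * pdir (1, 0) y w 2 -
          pdir (0, 1) y w 2 * heisθ (0, 1) y w ∧
        box y w 1 = 1 / 2 * y w 0 * box y w 2 - 1 / 2 * y w 2 * box y w 0 ∧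
        box y w 2 = pdir (0, 1) y w 0 * heisθ (0, 1) y w -
          heisθ (1, 0) y w * pdir (1, 0) y w 0) := by
    intro hp w hw
    simp only [pd_hamDensity_heisMetric_momentum, pd_hamDensity_heisMetric_velocity,
      hp w hw, pd_hamDensity_heisMetric_position, heisMetric_inv_mulVec_mulVec, true_and,
      Pi.zero_apply, sub_zero]
    simp only [dσ_eq_pdir, dτ_eq_pdir] at hp ⊢
    have hG := differentiableAt_metric_mulVec_pdir hW hy hw (0, 1)
    have hB := pdir_heisθ_sub hW hy hw
    have hy₀ : box y w 0 = pdir (0, 1) (pdir (0, 1) y) w 0 - pdir (1, 0) (pdir (1, 0) y) w 0 := rfl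
    have hy₂ : box y w 2 = pdir (0, 1) (pdir (0, 1) y) w 2 - pdir (1, 0) (pdir (1, 0) y) w 2 := rfl
    simp only [pdir_congr hW hp _ hw, pdir_apply hG, pdir_metric_mulVec_pdir hW hy hw]
    change (∀ i, _ = -(![1 / 2 * (heisθ (0, 1) y w * pdir (0, 1) y w 2 -
        heisθ (1, 0) y w * pdir (1, 0) y w 2), 0, 1 / 2 * (heisθ (1, 0) y w * pdir (1, 0) y w 0 -
        heisθ (0, 1) y w * pdir (0, 1) y w 0)] : Fin 3 → ℝ) i + _) ↔ _
    rw [Fin.forall_fin_succ, Fin.forall_fin_two]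
    simp only [Fin.succ_zero_eq_one, Fin.succ_one_eq_two, Matrix.cons_val_zero,
      Matrix.cons_val_one, Matrix.cons_val]
    -- The middle Hamilton equation is ∂_τ θ_τ = ∂_σ θ_σ. Its multiples by ½ y³ and ½ y¹ separate
    -- the outer Hamilton equations from those of (B). Half of each quadratic term comes from
    -- differentiating the metric along the worldsheet, half from the position derivative of the
    -- density.
    constructor
    · rintro ⟨h₀, h₁, h₂⟩
      refine ⟨?_, ?_, ?_⟩
      · linear_combination h₀ + hy₀ - 1 / 2 * y w 2 * h₁
      · linear_combination h₁ - hB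
      · linear_combination h₂ + hy₂ + 1 / 2 * y w 0 * h₁
    · rintro ⟨h₀, h₁, h₂⟩
      have e : pdir (0, 1) (heisθ (0, 1) y) w - pdir (1, 0) (heisθ (1, 0) y) w = 0 := by
        rw [hB, h₁, sub_self]
      refine ⟨?_, ?_, ?_⟩
      · linear_combination h₀ - hy₀ + 1 / 2 * y w 2 * e
      · linear_combination e
      · linear_combination h₂ - hy₂ - 1 / 2 * y w 0 * e
  constructor
  · intro h
    have hp : ∀ w ∈ W, p w = heisMetric (y w) *ᵥ dτ y w := fun w hw => by
      have e : dτ y w = (heisMetric (y w))⁻¹ *ᵥ p w := funext fun i => by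
        rw [(h w hw i).1, pd_hamDensity_heisMetric_momentum]
      rw [e, heisMetric_mulVec_inv_mulVec]
    exact ⟨hp, fun w hw => (key hp w hw).1 (h w hw)⟩
  · rintro ⟨hp, h⟩ w hw
    exact (key hp w hw).2 (h w hw)

end HamiltonEquations

/-! ### Equivalence of the equations of motion for T-dual fields -/

section TDualFields

/-- By `heisCurrentsAt_metric_fst` the currents of y are the components of ∂_τ y and ∂_σ y in the
invariant coframe. T exchanges the two middle ones with a sign, so ∂_τ x² = -θ_σ and ∂_σ x² = -θ_τ.
-/
theorem areTDual_iff {x y : ℝ × ℝ → R3} : AreTDual W x y ↔ ∀ w ∈ W,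
    (y w 0 = x w 0 ∧ y w 2 = x w 2) ∧
      pdir (0, 1) x w = ![pdir (0, 1) y w 0, -heisθ (1, 0) y w, pdir (0, 1) y w 2] ∧
      pdir (1, 0) x w = ![pdir (1, 0) y w 0, -heisθ (0, 1) y w, pdir (1, 0) y w 2] := by
  refine forall₂_congr fun w _ => ?_
  rw [and_assoc]
  refine and_congr_right fun _ => and_congr_right fun _ => ?_
  refine eq_comm.trans (Prod.ext_iff.trans ?_)
  rw [tDual_fst, tDual_snd, heisCurrentsAt_metric_fst, heisCurrentsAt_snd]
  rfl

/-- For T-dual fields the equations of motion are equivalent. -/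
theorem AreTDual.torusEOM_iff_heisEOM {x y : ℝ × ℝ → R3} (hW : IsOpen W)
    (hx : ContDiffOn ℝ 2 x W) (hy : ContDiffOn ℝ 2 y W) (h : AreTDual W x y) :
    TorusEOM W x ↔ HeisEOM W y := by
  rw [areTDual_iff] at h
  rw [heisEOM_iff]
  refine forall₂_congr fun w hw => ?_
  have hxd (u v : ℝ × ℝ) (i : Fin 3) : pdir u (pdir v x) w i = pdir u (fun w => pdir v x w i) w :=
    pdir_apply (differentiableAt_pdir hW hx hw v) u i
  have hyd (u v : ℝ × ℝ) (i : Fin 3) : pdir u (pdir v y) w i = pdir u (fun w => pdir v y w i) w :=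
    pdir_apply (differentiableAt_pdir hW hy hw v) u i
  have hτ (i : Fin 3) (w) (hw : w ∈ W) := congrFun (h w hw).2.1 i
  have hσ (i : Fin 3) (w) (hw : w ∈ W) := congrFun (h w hw).2.2 i
  have b₀ : box x w 0 = box y w 0 := by
    simp only [box_eq_pdir, Pi.sub_apply, hxd, hyd]
    rw [pdir_congr hW (hτ 0) _ hw, pdir_congr hW (hσ 0) _ hw]
    rfl
  have b₂ : box x w 2 = box y w 2 := by
    simp only [box_eq_pdir, Pi.sub_apply, hxd, hyd]
    rw [pdir_congr hW (hτ 2) _ hw, pdir_congr hW (hσ 2) _ hw]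
    rfl
  have hcomm := congrFun (pdir_comm hW hy hw (0, 1) (1, 0))
  -- This is the Maurer–Cartan identity for θ, from commuting derivatives of y. It cancels the
  -- middle component of the cross product, so that component of (A) is automatic.
  have b₁ : box x w 1 =
      pdir (0, 1) y w 0 * pdir (1, 0) y w 2 - pdir (0, 1) y w 2 * pdir (1, 0) y w 0 := by
    simp only [box_eq_pdir, Pi.sub_apply, hxd]
    rw [pdir_congr hW (hτ 1) _ hw, pdir_congr hW (hσ 1) _ hw]
    change pdir _ (fun w => -heisθ (1, 0) y w) w - pdir _ (fun w => -heisθ (0, 1) y w) w = _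
    rw [pdir_neg, pdir_neg, pdir_heisθ hW hy hw, pdir_heisθ hW hy hw, hcomm 0, hcomm 1, hcomm 2]
    ring
  -- No equation of motion is used: commuting derivatives of x² give ∂_τ θ_τ = ∂_σ θ_σ.
  have e₁ : box y w 1 = 1 / 2 * y w 0 * box y w 2 - 1 / 2 * y w 2 * box y w 0 := by
    rw [← sub_eq_zero, ← pdir_heisθ_sub hW hy hw]
    have hc := congrFun (pdir_comm hW hx hw (0, 1) (1, 0)) 1
    rw [hxd, hxd, pdir_congr hW (hτ 1) _ hw, pdir_congr hW (hσ 1) _ hw] at hc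
    change pdir _ (fun w => -heisθ (0, 1) y w) w = pdir _ (fun w => -heisθ (1, 0) y w) w at hc
    rw [pdir_neg, pdir_neg] at hc
    linear_combination -hc
  have hcross : box x w + dτ x w ⨯₃ dσ x w =
      ![box y w 0 + (-heisθ (1, 0) y w * pdir (1, 0) y w 2 +
          pdir (0, 1) y w 2 * heisθ (0, 1) y w), 0,
        box y w 2 + (-pdir (0, 1) y w 0 * heisθ (0, 1) y w +
          heisθ (1, 0) y w * pdir (1, 0) y w 0)] := by
    rw [dσ_eq_pdir, dτ_eq_pdir, (h w hw).2.1, (h w hw).2.2, cross_apply]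
    funext i
    fin_cases i
    · simp [b₀]
    · simp [b₁]
    · simp [b₂]
  rw [hcross]
  constructor
  · intro h0
    have h₀ := congrFun h0 0
    have h₂ := congrFun h0 2
    simp only [Matrix.cons_val_zero, Matrix.cons_val, Pi.zero_apply] at h₀ h₂
    exact ⟨by linear_combination h₀, e₁, by linear_combination h₂⟩
  · rintro ⟨h₀, -, h₂⟩
    funext i
    fin_cases i
    · simp only [Fin.zero_eta, Matrix.cons_val_zero, Pi.zero_apply]
      linear_combination h₀
    · rfl
    · simp only [Fin.reduceFinMk, Matrix.cons_val, Pi.zero_apply]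
      linear_combination h₂

end TDualFields

/-! ### Doubled motions: existence and uniqueness -/

section DoubledFields

/-- The equation ∂_τ x = β eliminates β. What remains prescribes both first derivatives of x* in
terms of x alone. -/
theorem doubledEOM_iff {z : ℝ × ℝ → R3 × R3} (hz : ∀ w ∈ W, DifferentiableAt ℝ z w) :
    DoubledEOM W z ↔ ∀ w ∈ W,
      pdir (1, 0) (fun w => (z w).2) w = pdir (0, 1) (fun w => (z w).1) w +
        (1 / 2 : ℝ) • ((z w).1 ⨯₃ pdir (1, 0) (fun w => (z w).1) w) ∧
      pdir (0, 1) (fun w => (z w).2) w = pdir (1, 0) (fun w => (z w).1) w +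
        (1 / 2 : ℝ) • ((z w).1 ⨯₃ pdir (0, 1) (fun w => (z w).1) w) := by
  refine forall₂_congr fun w hw => ?_
  rw [doubledβ, doubledα, dσ_eq_pdir, dτ_eq_pdir, pdir_fst (hz w hw), pdir_fst (hz w hw),
    pdir_snd (hz w hw), pdir_snd (hz w hw), eq_sub_iff_add_eq, eq_comm]
  refine and_congr_right fun h => ?_
  rw [h, add_sub_cancel_right]

theorem contDiffOn_doubled_fst {z : ℝ × ℝ → R3 × R3} {n : WithTop ℕ∞}
    (hz : ContDiffOn ℝ n z W) : ContDiffOn ℝ n (fun w => (z w).1) W :=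
  contDiff_fst.comp_contDiffOn hz

theorem contDiffOn_doubled_snd {z : ℝ × ℝ → R3 × R3} {n : WithTop ℕ∞}
    (hz : ContDiffOn ℝ n z W) : ContDiffOn ℝ n (fun w => (z w).2) W :=
  contDiff_snd.comp_contDiffOn hz

theorem contDiffOn_heisProj {z : ℝ × ℝ → R3 × R3} {n : WithTop ℕ∞}
    (hz : ContDiffOn ℝ n z W) : ContDiffOn ℝ n (fun w => heisProj (z w)) W := by
  have h₁ := contDiffOn_pi.1 (contDiffOn_doubled_fst hz)
  have h₂ := contDiffOn_pi.1 (contDiffOn_doubled_snd hz)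
  refine contDiffOn_pi.2 fun i => ?_
  fin_cases i
  · exact h₁ 0
  · exact (h₂ 1).neg
  · exact h₁ 2

/-- The two scalar fields of a doubled motion are T-dual. -/
theorem DoubledEOM.areTDual {z : ℝ × ℝ → R3 × R3} (hW : IsOpen W) (hz : ContDiffOn ℝ 2 z W)
    (h : DoubledEOM W z) : AreTDual W (fun w => (z w).1) (fun w => heisProj (z w)) := by
  rw [doubledEOM_iff fun w hw => differentiableAt_of_contDiffOn hW hz hw] at h
  rw [areTDual_iff]
  intro w hw
  have h₁ := differentiableAt_of_contDiffOn hW (contDiffOn_doubled_fst hz) hw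
  have h₂ := differentiableAt_of_contDiffOn hW (contDiffOn_doubled_snd hz) hw
  have h₃ := differentiableAt_of_contDiffOn hW (contDiffOn_heisProj hz) hw
  have e₀ (v : ℝ × ℝ) : pdir v (fun w => heisProj (z w)) w 0 = pdir v (fun w => (z w).1) w 0 := by
    rw [pdir_apply h₃, pdir_apply h₁]
    rfl
  have e₁ (v : ℝ × ℝ) :
      pdir v (fun w => heisProj (z w)) w 1 = -pdir v (fun w => (z w).2) w 1 := by
    rw [pdir_apply h₃, pdir_apply h₂, ← pdir_neg]
    rfl
  have e₂ (v : ℝ × ℝ) : pdir v (fun w => heisProj (z w)) w 2 = pdir v (fun w => (z w).1) w 2 := by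
    rw [pdir_apply h₃, pdir_apply h₁]
    rfl
  have y₀ : heisProj (z w) 0 = (z w).1 0 := rfl
  have y₂ : heisProj (z w) 2 = (z w).1 2 := rfl
  have hσ := congrFun (h w hw).1 1
  have hτ := congrFun (h w hw).2 1
  simp only [Pi.add_apply, Pi.smul_apply, cross_apply, Matrix.cons_val_one, Matrix.cons_val_zero,
    smul_eq_mul] at hσ hτ
  refine ⟨⟨rfl, rfl⟩, ?_, ?_⟩
  · funext i
    fin_cases i
    · exact (e₀ _).symm
    · simp only [Fin.mk_one, heisθ_apply, e₀, e₁, e₂, y₀, y₂, Matrix.cons_val_one,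
        Matrix.cons_val_zero]
      linear_combination -hσ
    · exact (e₂ _).symm
  · funext i
    fin_cases i
    · exact (e₀ _).symm
    · simp only [Fin.mk_one, heisθ_apply, e₀, e₁, e₂, y₀, y₂, Matrix.cons_val_one,
        Matrix.cons_val_zero]
      linear_combination -hτ
    · exact (e₂ _).symm

theorem TorusEOM.congr {x x' : ℝ × ℝ → R3} (hW : IsOpen W) (h : Set.EqOn x x' W)
    (hx : TorusEOM W x) : TorusEOM W x' := fun w hw => by
  have := hx w hw
  rwa [dσ_eq_pdir, dτ_eq_pdir, box_congr hW h hw, pdir_congr hW h _ hw,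
    pdir_congr hW h _ hw] at this

theorem HeisEOM.congr {y y' : ℝ × ℝ → R3} (hW : IsOpen W) (h : Set.EqOn y y' W)
    (hy : HeisEOM W y) : HeisEOM W y' := fun w hw => by
  have := hy w hw
  rwa [dσ_eq_pdir, dτ_eq_pdir, box_congr hW h hw, pdir_congr hW h _ hw,
    pdir_congr hW h _ hw, h hw] at this

theorem AreTDual.congr {x x' y y' : ℝ × ℝ → R3} (hW : IsOpen W) (hx : Set.EqOn x x' W)
    (hy : Set.EqOn y y' W) (h : AreTDual W x y) : AreTDual W x' y' := fun w hw => by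
  have := h w hw
  rwa [dσ_eq_pdir, dτ_eq_pdir, pdir_congr hW hx _ hw, pdir_congr hW hx _ hw,
    pdir_congr hW hy _ hw, pdir_congr hW hy _ hw, hx hw, hy hw] at this

/-- The integrability condition of the equations of a doubled motion is the equation of motion of
the torus. -/
theorem pdir_integrability {x : ℝ × ℝ → R3} (hW : IsOpen W) (hx : ContDiffOn ℝ 2 x W)
    (hw : w ∈ W) :
    pdir (0, 1) (fun w => pdir (0, 1) x w + (1 / 2 : ℝ) • (x w ⨯₃ pdir (1, 0) x w)) w -
      pdir (1, 0) (fun w => pdir (1, 0) x w + (1 / 2 : ℝ) • (x w ⨯₃ pdir (0, 1) x w)) w =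
    box x w + dτ x w ⨯₃ dσ x w := by
  have h := differentiableAt_of_contDiffOn hW hx hw
  have h' := differentiableAt_pdir hW hx hw
  have hc (v : ℝ × ℝ) : DifferentiableAt ℝ (fun w => x w ⨯₃ pdir v x w) w :=
    ((contDiffOn_cross (n := 1) (hx.of_le (by norm_num [one_le_two]))
      (contDiffOn_pdir hW hx (by norm_num [one_add_one_eq_two]) v)).differentiableOn
        one_ne_zero).differentiableAt (hW.mem_nhds hw)
  -- The mixed second derivatives cancel by symmetry, and ½ ∂_τ x × ∂_σ x - ½ ∂_σ x × ∂_τ x adds up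
  -- to the full cross product.
  rw [pdir_add (h' _) ((hc _).fun_const_smul _), pdir_add (h' _) ((hc _).fun_const_smul _),
    pdir_smul (hc _), pdir_smul (hc _), pdir_cross h (h' _), pdir_cross h (h' _),
    pdir_comm hW hx hw (1, 0) (0, 1), box_eq_pdir, dσ_eq_pdir, dτ_eq_pdir,
    ← cross_anticomm (pdir (0, 1) x w)]
  module

theorem DoubledEOM.torusEOM {z : ℝ × ℝ → R3 × R3} (hW : IsOpen W) (hz : ContDiffOn ℝ 2 z W)
    (h : DoubledEOM W z) : TorusEOM W (fun w => (z w).1) := fun w hw => by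
  rw [doubledEOM_iff fun w hw => differentiableAt_of_contDiffOn hW hz hw] at h
  rw [← pdir_integrability hW (contDiffOn_doubled_fst hz) hw, sub_eq_zero]
  have e₁ := pdir_congr hW (fun w hw => (h w hw).1) (0, 1) hw
  have e₂ := pdir_congr hW (fun w hw => (h w hw).2) (1, 0) hw
  rw [← e₁, ← e₂]
  exact pdir_comm hW (contDiffOn_doubled_snd hz) hw _ _

theorem DoubledEOM.heisEOM {z : ℝ × ℝ → R3 × R3} (hW : IsOpen W) (hz : ContDiffOn ℝ 2 z W)
    (h : DoubledEOM W z) : HeisEOM W (fun w => heisProj (z w)) :=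
  ((h.areTDual hW hz).torusEOM_iff_heisEOM hW (contDiffOn_doubled_fst hz)
    (contDiffOn_heisProj hz)).1 (h.torusEOM hW hz)

/-- Data built from first derivatives of a C^k field is of class C^m, and its primitive regains the
lost order. For k = ∞ one takes m = ∞. -/
theorem exists_eq_add_one_of_two_le {k : ℕ∞} (hk : 2 ≤ k) : ∃ m : ℕ∞, 1 ≤ m ∧ k = m + 1 := by
  induction k with
  | top => exact ⟨⊤, le_top, rfl⟩
  | coe k =>
    have hk' : 2 ≤ k := by exact_mod_cast hk
    exact ⟨(k - 1 : ℕ), by exact_mod_cast (by omega : 1 ≤ k - 1),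
      by exact_mod_cast (by omega : k = k - 1 + 1)⟩

/-- By `pdir_integrability`, (A) is the closedness of the 1-form that should be the differential of
x*; `exists_primitive` integrates it. -/
theorem TorusEOM.exists_doubled {x : ℝ × ℝ → R3} {k : ℕ∞} (hW : IsOpen W) (hc : Convex ℝ W)
    (hk : 2 ≤ k) (hx : ContDiffOn ℝ k x W) (h : TorusEOM W x) :
    ∃ s : ℝ × ℝ → R3, ContDiffOn ℝ k (fun w => (x w, s w)) W ∧
      DoubledEOM W (fun w => (x w, s w)) := by
  have hx₂ : ContDiffOn ℝ 2 x W := hx.of_le (WithTop.coe_le_coe.2 hk)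
  obtain ⟨m, hm, rfl⟩ := exists_eq_add_one_of_two_le hk
  rw [WithTop.coe_add, WithTop.coe_one] at hx ⊢
  have hp (v : ℝ × ℝ) : ContDiffOn ℝ m (pdir v x) W := contDiffOn_pdir hW hx le_rfl v
  have hxm : ContDiffOn ℝ m x W := hx.of_le le_self_add
  have hP (u v : ℝ × ℝ) :
      ContDiffOn ℝ m (fun w => pdir u x w + (1 / 2 : ℝ) • (x w ⨯₃ pdir v x w)) W :=
    (hp u).add ((contDiffOn_cross hxm (hp v)).const_smul _)
  obtain ⟨s, hs, hs'⟩ := exists_primitive hW hc hm (hP (0, 1) (1, 0)) (hP (1, 0) (0, 1))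
    fun w hw => by rw [← sub_eq_zero, pdir_integrability hW hx₂ hw, h w hw]
  refine ⟨s, hx.prodMk hs, ?_⟩
  rw [doubledEOM_iff fun w hw => ((hx.prodMk hs).differentiableOn
    (by simp)).differentiableAt (hW.mem_nhds hw)]
  exact hs'

theorem contDiffOn_doubledMul {z : ℝ × ℝ → R3 × R3} {n : WithTop ℕ∞} (g : R3 × R3)
    (hz : ContDiffOn ℝ n z W) : ContDiffOn ℝ n (fun w => HDFT.doubledMul g (z w)) W :=
  (contDiffOn_const.add (contDiffOn_doubled_fst hz)).prodMk
    ((contDiffOn_const.add (contDiffOn_doubled_snd hz)).add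
      ((contDiffOn_cross contDiffOn_const (contDiffOn_doubled_fst hz)).const_smul _))

/-- Left translations preserve doubled motions. -/
theorem DoubledEOM.doubledMul {z : ℝ × ℝ → R3 × R3} (hW : IsOpen W) (hz : ContDiffOn ℝ 2 z W)
    (h : DoubledEOM W z) (g : R3 × R3) : DoubledEOM W (fun w => HDFT.doubledMul g (z w)) := by
  rw [doubledEOM_iff fun w hw => differentiableAt_of_contDiffOn hW (contDiffOn_doubledMul g hz) hw]
  rw [doubledEOM_iff fun w hw => differentiableAt_of_contDiffOn hW hz hw] at h
  intro w hw
  have h₁ := differentiableAt_of_contDiffOn hW (contDiffOn_doubled_fst hz) hw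
  have h₂ := differentiableAt_of_contDiffOn hW (contDiffOn_doubled_snd hz) hw
  have h₃ := differentiableAt_of_contDiffOn hW
    (contDiffOn_cross (contDiffOn_const (c := g.1)) (contDiffOn_doubled_fst hz)) hw
  have e₁ (v : ℝ × ℝ) : pdir v (fun w => (HDFT.doubledMul g (z w)).1) w =
      pdir v (fun w => (z w).1) w := by
    change pdir v (fun w => g.1 + (z w).1) w = _
    rw [pdir_add (differentiableAt_const _) h₁, pdir_const, zero_add]
  have e₂ (v : ℝ × ℝ) : pdir v (fun w => (HDFT.doubledMul g (z w)).2) w =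
      pdir v (fun w => (z w).2) w + (1 / 2 : ℝ) • (g.1 ⨯₃ pdir v (fun w => (z w).1) w) := by
    change pdir v (fun w => (g.2 + (z w).2) + (1 / 2 : ℝ) • (g.1 ⨯₃ (z w).1)) w = _
    rw [pdir_add ((differentiableAt_const _).fun_add h₂) (h₃.fun_const_smul _),
      pdir_add (differentiableAt_const _) h₂, pdir_const, zero_add, pdir_smul h₃,
      pdir_cross (differentiableAt_const _) h₁, pdir_const, map_zero, LinearMap.zero_apply,
      add_zero]
  -- The translation adds ½ g.1 × ∂x to the derivatives of x*, exactly the change of ½ x × ∂x when x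
  -- moves by the constant g.1.
  rw [e₁, e₁, e₂, e₂, (h w hw).1, (h w hw).2]
  simp only [HDFT.doubledMul, map_add, LinearMap.add_apply]
  constructor <;> module

/-- Doubled motions with the same first component differ by a translation of the second. -/
theorem DoubledEOM.exists_translation_of_fst_eq {z z' : ℝ × ℝ → R3 × R3} (hW : IsOpen W)
    (hc : Convex ℝ W) (hz : ContDiffOn ℝ 2 z W) (hz' : ContDiffOn ℝ 2 z' W)
    (h : DoubledEOM W z) (h' : DoubledEOM W z') (he : ∀ w ∈ W, (z' w).1 = (z w).1) :
    ∃ g : R3 × R3, g.1 = 0 ∧ ∀ w ∈ W, z' w = HDFT.doubledMul g (z w) := by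
  rw [doubledEOM_iff fun w hw => differentiableAt_of_contDiffOn hW hz hw] at h
  rw [doubledEOM_iff fun w hw => differentiableAt_of_contDiffOn hW hz' hw] at h'
  have hp (v : ℝ × ℝ) := pdir_congr hW he v
  obtain ⟨c, hc⟩ := exists_eq_add_const_of_pdir_eq hW hc
    ((contDiffOn_doubled_snd hz').differentiableOn two_ne_zero)
    ((contDiffOn_doubled_snd hz).differentiableOn two_ne_zero)
    (fun w hw => by rw [(h w hw).1, (h' w hw).1, hp _ hw, hp _ hw, he w hw])
    (fun w hw => by rw [(h w hw).2, (h' w hw).2, hp _ hw, hp _ hw, he w hw])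
  refine ⟨(0, c), rfl, fun w hw => Prod.ext ?_ ?_⟩
  · simp [HDFT.doubledMul, he w hw]
  · simp [HDFT.doubledMul, hc w hw, add_comm]

/-- The middle component of the cross product, with the sign in y² = -x*₂, is the Heisenberg
cocycle. -/
theorem heisProj_doubledMul (g z : R3 × R3) :
    heisProj (HDFT.doubledMul g z) = heisMul (heisProj g) (heisProj z) := by
  funext i
  fin_cases i <;> simp [heisProj, HDFT.doubledMul, heisMul, cross_apply, Matrix.vecHead,
    Matrix.vecTail]
  ring

theorem doubledMul_doubledMul (g g' z : R3 × R3) :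
    HDFT.doubledMul g (HDFT.doubledMul g' z) = HDFT.doubledMul (HDFT.doubledMul g g') z := by
  refine Prod.ext ?_ ?_
  · simp [HDFT.doubledMul, add_assoc]
  · simp only [HDFT.doubledMul, map_add, LinearMap.add_apply]
    module

/-- Doubled motions with the same image in the Heisenberg group differ by a left translation by
an element of the kernel of the projection. -/
theorem DoubledEOM.exists_translation_of_heisProj_eq {z z' : ℝ × ℝ → R3 × R3} (hW : IsOpen W)
    (hc : Convex ℝ W) (hz : ContDiffOn ℝ 2 z W) (hz' : ContDiffOn ℝ 2 z' W)
    (h : DoubledEOM W z) (h' : DoubledEOM W z')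
    (he : ∀ w ∈ W, heisProj (z' w) = heisProj (z w)) :
    ∃ g : R3 × R3, heisProj g = 0 ∧ ∀ w ∈ W, z' w = HDFT.doubledMul g (z w) := by
  -- A base point is needed at the end to see that the translation has trivial projection.
  rcases W.eq_empty_or_nonempty with rfl | ⟨w₀, hw₀⟩
  · exact ⟨0, by simp [heisProj], by simp⟩
  have hd := areTDual_iff.1 (h.areTDual hW hz)
  have hd' := areTDual_iff.1 ((h'.areTDual hW hz').congr hW (fun _ _ => rfl) he)
  have hf := contDiffOn_pi.1 (contDiffOn_doubled_fst hz)
  have hf' := contDiffOn_pi.1 (contDiffOn_doubled_fst hz')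
  have hp (v : ℝ × ℝ) (w) (hw : w ∈ W) := pdir_apply
    (differentiableAt_of_contDiffOn hW (contDiffOn_doubled_fst hz) hw) v 1
  have hp' (v : ℝ × ℝ) (w) (hw : w ∈ W) := pdir_apply
    (differentiableAt_of_contDiffOn hW (contDiffOn_doubled_fst hz') hw) v 1
  -- Both derivatives of x² are determined by y through θ, so the two middle coordinates differ by a
  -- constant. Translating by it makes the first components agree and reduces to the previous
  -- uniqueness statement.
  obtain ⟨c, hcc⟩ := exists_eq_add_const_of_pdir_eq hW hc
    ((hf' 1).differentiableOn two_ne_zero) ((hf 1).differentiableOn two_ne_zero)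
    (fun w hw => by rw [← hp _ w hw, ← hp' _ w hw, (hd w hw).2.2, (hd' w hw).2.2])
    (fun w hw => by rw [← hp _ w hw, ← hp' _ w hw, (hd w hw).2.1, (hd' w hw).2.1])
  set g₀ : R3 × R3 := (![0, c, 0], 0) with hg₀
  have hfst : ∀ w ∈ W, (z' w).1 = (HDFT.doubledMul g₀ (z w)).1 := fun w hw => by
    have e₀ := congrFun (he w hw) 0
    have e₂ := congrFun (he w hw) 2
    funext i
    fin_cases i
    · simpa [HDFT.doubledMul, hg₀, heisProj, Matrix.vecHead, Matrix.vecTail] using e₀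
    · simpa [HDFT.doubledMul, hg₀, add_comm, Matrix.vecHead, Matrix.vecTail] using hcc w hw
    · simpa [HDFT.doubledMul, hg₀, heisProj, Matrix.vecHead, Matrix.vecTail] using e₂
  obtain ⟨g₁, hg₁, hz₁⟩ := (h.doubledMul hW hz g₀).exists_translation_of_fst_eq hW hc
    (contDiffOn_doubledMul g₀ hz) hz' h' hfst
  have hz₂ : ∀ w ∈ W, z' w = HDFT.doubledMul (HDFT.doubledMul g₁ g₀) (z w) := fun w hw => by
    rw [hz₁ w hw, doubledMul_doubledMul]
  refine ⟨_, ?_, hz₂⟩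
  have e := he w₀ hw₀
  rw [hz₂ w₀ hw₀, heisProj_doubledMul] at e
  have e₁ := congrFun e 1
  funext i
  fin_cases i
  · simp [heisProj, HDFT.doubledMul, hg₀, hg₁]
  · simpa [heisProj, HDFT.doubledMul, hg₀, hg₁, heisMul] using e₁
  · simp [heisProj, HDFT.doubledMul, hg₀, hg₁]

/-- The torus field dual to a solution on the nilmanifold. -/
theorem HeisEOM.exists_areTDual {y : ℝ × ℝ → R3} {k : ℕ∞} (hW : IsOpen W) (hc : Convex ℝ W)
    (hk : 2 ≤ k) (hy : ContDiffOn ℝ k y W) (h : HeisEOM W y) :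
    ∃ x : ℝ × ℝ → R3, ContDiffOn ℝ k x W ∧ AreTDual W x y := by
  have hy₂ : ContDiffOn ℝ 2 y W := hy.of_le (WithTop.coe_le_coe.2 hk)
  obtain ⟨m, hm, rfl⟩ := exists_eq_add_one_of_two_le hk
  rw [WithTop.coe_add, WithTop.coe_one] at hy ⊢
  have hyi := contDiffOn_pi.1 hy
  have hyim (i : Fin 3) : ContDiffOn ℝ m (fun w => y w i) W := (hyi i).of_le le_self_add
  have hp (v : ℝ × ℝ) := contDiffOn_pi.1 (contDiffOn_pdir hW hy le_rfl v)
  have hθ (v : ℝ × ℝ) : ContDiffOn ℝ m (fun w => -heisθ v y w) W := by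
    simp only [heisθ_apply]
    exact (((hp v 1).sub ((contDiffOn_const.mul (hyim 0)).mul (hp v 2))).add
      ((contDiffOn_const.mul (hyim 2)).mul (hp v 0))).neg
  -- The missing coordinate x² is a primitive of -θ_τ dσ - θ_σ dτ, which is closed by the second
  -- equation of (B).
  obtain ⟨f, hf, hf'⟩ := exists_primitive hW hc hm (hθ (0, 1)) (hθ (1, 0)) fun w hw => by
    rw [pdir_neg, pdir_neg, neg_inj, ← sub_eq_zero]
    change pdir (0, 1) (heisθ (0, 1) y) w - pdir (1, 0) (heisθ (1, 0) y) w = 0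
    rw [pdir_heisθ_sub hW hy₂ hw, (h w hw).2.1, sub_self]
  have hx : ContDiffOn ℝ (m + 1) (fun w => ![y w 0, f w, y w 2]) W := by
    refine contDiffOn_pi.2 fun i => ?_
    fin_cases i
    · exact hyi 0
    · exact hf
    · exact hyi 2
  refine ⟨fun w => ![y w 0, f w, y w 2], hx, areTDual_iff.2 fun w hw => ?_⟩
  have hxd : DifferentiableAt ℝ (fun w => ![y w 0, f w, y w 2]) w :=
    (hx.differentiableOn (by simp)).differentiableAt (hW.mem_nhds hw)
  have hyd := differentiableAt_of_contDiffOn hW hy₂ hw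
  refine ⟨⟨rfl, rfl⟩, ?_, ?_⟩
  · funext i
    rw [pdir_apply hxd]
    fin_cases i
    · exact (pdir_apply hyd _ 0).symm
    · exact (hf' w hw).2
    · exact (pdir_apply hyd _ 2).symm
  · funext i
    rw [pdir_apply hxd]
    fin_cases i
    · exact (pdir_apply hyd _ 0).symm
    · exact (hf' w hw).1
    · exact (pdir_apply hyd _ 2).symm

/-- Doubling the T-dual x of y gives a second field T-dual to x. The two fields agree in the outer
coordinates, and their middle coordinates have equal first derivatives, so a translation of x*₂ by a
constant removes the difference. -/
theorem HeisEOM.exists_doubled {y : ℝ × ℝ → R3} {k : ℕ∞} (hW : IsOpen W) (hc : Convex ℝ W)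
    (hk : 2 ≤ k) (hy : ContDiffOn ℝ k y W) (h : HeisEOM W y) :
    ∃ z : ℝ × ℝ → R3 × R3, ContDiffOn ℝ k z W ∧ DoubledEOM W z ∧
      ∀ w ∈ W, heisProj (z w) = y w := by
  have hk₂ : (2 : WithTop ℕ∞) ≤ k := WithTop.coe_le_coe.2 hk
  have hy₂ : ContDiffOn ℝ 2 y W := hy.of_le hk₂
  obtain ⟨x, hx, hxy⟩ := h.exists_areTDual hW hc hk hy
  obtain ⟨s, hz, hs⟩ := ((hxy.torusEOM_iff_heisEOM hW (hx.of_le hk₂) hy₂).2 h).exists_doubled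
    hW hc hk hx
  set z : ℝ × ℝ → R3 × R3 := fun w => (x w, s w) with hzdef
  have hz₂ := hz.of_le hk₂
  have hxy := areTDual_iff.1 hxy
  have hzy := areTDual_iff.1 (hs.areTDual hW hz₂)
  have hp (v : ℝ × ℝ) (w) (hw : w ∈ W) := pdir_apply
    (differentiableAt_of_contDiffOn hW (contDiffOn_heisProj hz₂) hw) v 1
  have hp' (v : ℝ × ℝ) (w) (hw : w ∈ W) := pdir_apply
    (differentiableAt_of_contDiffOn hW hy₂ hw) v 1
  have key : ∀ w ∈ W, pdir (1, 0) (fun w => heisProj (z w)) w 1 = pdir (1, 0) y w 1 ∧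
      pdir (0, 1) (fun w => heisProj (z w)) w 1 = pdir (0, 1) y w 1 := fun w hw => by
    obtain ⟨⟨a₀, a₂⟩, aτ, aσ⟩ := hxy w hw
    obtain ⟨⟨b₀, b₂⟩, bτ, bσ⟩ := hzy w hw
    have cτ := aτ.symm.trans bτ
    have cσ := aσ.symm.trans bσ
    have t₀ := congrFun cτ 0
    have t₁ := congrFun cτ 1
    have t₂ := congrFun cτ 2
    have s₀ := congrFun cσ 0
    have s₁ := congrFun cσ 1
    have s₂ := congrFun cσ 2
    simp only [Matrix.cons_val_zero, Matrix.cons_val_one, Matrix.cons_val] at t₀ t₁ t₂ s₀ s₁ s₂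
    rw [heisθ_apply, heisθ_apply, b₀, b₂, ← s₀, ← s₂, ← show y w 0 = (z w).1 0 from a₀,
      ← show y w 2 = (z w).1 2 from a₂] at t₁
    rw [heisθ_apply, heisθ_apply, b₀, b₂, ← t₀, ← t₂, ← show y w 0 = (z w).1 0 from a₀,
      ← show y w 2 = (z w).1 2 from a₂] at s₁
    exact ⟨by linear_combination t₁, by linear_combination s₁⟩
  obtain ⟨c, hcc⟩ := exists_eq_add_const_of_pdir_eq hW hc
    (((contDiffOn_pi.1 hy₂) 1).differentiableOn two_ne_zero)
    (((contDiffOn_pi.1 (contDiffOn_heisProj hz₂)) 1).differentiableOn two_ne_zero)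
    (fun w hw => by rw [← hp _ w hw, ← hp' _ w hw, (key w hw).1])
    (fun w hw => by rw [← hp _ w hw, ← hp' _ w hw, (key w hw).2])
  -- The sign is that of y² = -x*₂: moving x*₂ by -c raises y² by c.
  refine ⟨fun w => HDFT.doubledMul (0, ![0, -c, 0]) (z w), contDiffOn_doubledMul _ hz,
    hs.doubledMul hW hz₂ _, fun w hw => ?_⟩
  rw [heisProj_doubledMul]
  funext i
  fin_cases i
  · simpa [heisMul, heisProj] using (hxy w hw).1.1.symm
  · simpa [heisMul, heisProj, add_comm] using (hcc w hw).symm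
  · simpa [heisMul, heisProj] using (hxy w hw).1.2.symm

end DoubledFields

/-! ### Quasi-periodicity and lattices -/

section BoundaryConditions

theorem DoubledEOM.comp_shift {J : Set ℝ} {z : ℝ × ℝ → R3 × R3} (h : DoubledEOM (worldsheet J) z) :
    DoubledEOM (worldsheet J) (fun w => z (shift w)) := fun w hw => by
  have := h (shift w) (shift_mem_worldsheet hw)
  simpa only [doubledα, doubledβ, dσ_eq_pdir, dτ_eq_pdir, pdir_comp_shift] using this

theorem contDiffOn_comp_shift {J : Set ℝ} {z : ℝ × ℝ → R3 × R3} {n : WithTop ℕ∞}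
    (hz : ContDiffOn ℝ n z (worldsheet J)) :
    ContDiffOn ℝ n (fun w => z (shift w)) (worldsheet J) :=
  hz.comp contDiff_shift.contDiffOn fun _ hw => hw

/-- The shifted field and the left translate by (c, 0) are doubled motions with the same x, so
uniqueness relates them by a further translation. -/
theorem DoubledEOM.fst_shift_iff {J : Set ℝ} {z : ℝ × ℝ → R3 × R3}
    (hJ : IsOpen J) (hc : Convex ℝ J) (hz : ContDiffOn ℝ 2 z (worldsheet J))
    (h : DoubledEOM (worldsheet J) z) :
    (∃ c : R3, ∀ w ∈ worldsheet J, (z (shift w)).1 = (z w).1 + c) ↔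
      ∃ g : R3 × R3, ∀ w ∈ worldsheet J, z (shift w) = HDFT.doubledMul g (z w) := by
  have hW := isOpen_worldsheet hJ
  constructor
  · rintro ⟨c, hc'⟩
    obtain ⟨g, -, hg⟩ := (h.doubledMul hW hz (c, 0)).exists_translation_of_fst_eq hW
      (convex_worldsheet hc) (contDiffOn_doubledMul _ hz) (contDiffOn_comp_shift hz) h.comp_shift
      fun w hw => by rw [hc' w hw, add_comm]; rfl
    exact ⟨_, fun w hw => by rw [hg w hw, doubledMul_doubledMul]⟩
  · rintro ⟨g, hg⟩
    exact ⟨g.1, fun w hw => by rw [hg w hw, add_comm]; rfl⟩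

theorem DoubledEOM.heisProj_shift_iff {J : Set ℝ} {z : ℝ × ℝ → R3 × R3}
    (hJ : IsOpen J) (hc : Convex ℝ J) (hz : ContDiffOn ℝ 2 z (worldsheet J))
    (h : DoubledEOM (worldsheet J) z) :
    (∃ γ : R3, ∀ w ∈ worldsheet J, heisProj (z (shift w)) = heisMul γ (heisProj (z w))) ↔
      ∃ g : R3 × R3, ∀ w ∈ worldsheet J, z (shift w) = HDFT.doubledMul g (z w) := by
  have hW := isOpen_worldsheet hJ
  constructor
  · rintro ⟨γ, hγ⟩
    -- Any lift of γ would do: the uniqueness statement for equal projections corrects the choice.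
    have hp : heisProj (![γ 0, 0, γ 2], ![0, -γ 1, 0]) = γ := by
      funext i
      fin_cases i <;> simp [heisProj]
    obtain ⟨g, -, hg⟩ := (h.doubledMul hW hz (![γ 0, 0, γ 2],
      ![0, -γ 1, 0])).exists_translation_of_heisProj_eq hW (convex_worldsheet hc)
      (contDiffOn_doubledMul _ hz) (contDiffOn_comp_shift hz) h.comp_shift
      fun w hw => by rw [hγ w hw, heisProj_doubledMul, hp]
    exact ⟨_, fun w hw => by rw [hg w hw, doubledMul_doubledMul]⟩
  · rintro ⟨g, hg⟩
    exact ⟨heisProj g, fun w hw => by rw [hg w hw, heisProj_doubledMul]⟩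

theorem DoubledLattice.exists_int_fst {g : R3 × R3} (hg : DoubledLattice g) :
    ∃ n : Fin 3 → ℤ, g.1 = fun i => (n i : ℝ) := by
  induction hg with
  | gen i =>
    refine ⟨Pi.single i 1, funext fun j => ?_⟩
    by_cases h : j = i
    · subst h
      simp
    · simp [h]
  | mul _ _ ha hb =>
    obtain ⟨m, hm⟩ := ha
    obtain ⟨n, hn⟩ := hb
    exact ⟨m + n, funext fun i => by simp [HDFT.doubledMul, hm, hn]⟩
  | inv _ ha =>
    obtain ⟨m, hm⟩ := ha
    exact ⟨-m, funext fun i => by simp [hm]⟩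

theorem HeisLattice.zero : HeisLattice 0 := by
  have h := HeisLattice.e₁.mul HeisLattice.e₁.inv
  convert h using 1
  funext i
  fin_cases i <;> simp [heisMul]

/-- The projection is a homomorphism sending e₁ and e₃ to the generators and e₂ to the identity. -/
theorem DoubledLattice.heisProj {g : R3 × R3} (hg : DoubledLattice g) :
    HeisLattice (heisProj g) := by
  induction hg with
  | gen i =>
    fin_cases i
    · convert HeisLattice.e₁ using 1
      funext i
      fin_cases i <;> simp [HDFT.heisProj]
    · convert HeisLattice.zero using 1
      funext i
      fin_cases i <;> simp [HDFT.heisProj]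
    · convert HeisLattice.e₃ using 1
      funext i
      fin_cases i <;> simp [HDFT.heisProj]
  | mul _ _ ha hb =>
    rw [heisProj_doubledMul]
    exact ha.mul hb
  | inv _ ha =>
    convert ha.inv using 1
    funext i
    fin_cases i <;> simp [HDFT.heisProj]

end BoundaryConditions

end HDFT

end

theorem mainTheorem4 :
    -- the frames close under the Courant-Dorfman brackets and realise the two current algebras
    (∀ s t : HDFT.TorusCurrents ℝ,
      HDFT.dorfman HDFT.volFlux (HDFT.torusSection s) (HDFT.torusSection t) =
        HDFT.torusSection ⁅s, t⁆ ∧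
      ∀ q, (HDFT.torusSection s).1 q ⬝ᵥ (HDFT.torusSection t).2 q +
        (HDFT.torusSection s).2 q ⬝ᵥ (HDFT.torusSection t).1 q = HDFT.torusPairing ℝ s t) ∧
    (∀ s t : HDFT.HeisCurrents ℝ,
      HDFT.dorfman 0 (HDFT.heisSection s) (HDFT.heisSection t) = HDFT.heisSection ⁅s, t⁆ ∧
      ∀ q, (HDFT.heisSection s).1 q ⬝ᵥ (HDFT.heisSection t).2 q +
        (HDFT.heisSection s).2 q ⬝ᵥ (HDFT.heisSection t).1 q = HDFT.heisPairing ℝ s t) ∧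
    -- the identification of currents is an isomorphism of Lie algebras and an isometry
    (∀ s t : HDFT.HeisCurrents ℂ,
      HDFT.tDual ℂ ⁅s, t⁆ = ⁅HDFT.tDual ℂ s, HDFT.tDual ℂ t⁆ ∧
      HDFT.torusPairing ℂ (HDFT.tDual ℂ s) (HDFT.tDual ℂ t) = HDFT.heisPairing ℂ s t) ∧
    -- it extends uniquely to the vacuum modules, and maps Hamiltonian to Hamiltonian
    (∃ Φ : HDFT.VacuumModule (HDFT.HeisCurrents ℂ) ≃ₗ[ℂ] HDFT.VacuumModule (HDFT.TorusCurrents ℂ),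
      Φ (HDFT.vacuum _) = HDFT.vacuum _ ∧
      (∀ a n v, Φ (HDFT.mode _ a n v) = HDFT.mode _ (HDFT.tDual ℂ a) n (Φ v)) ∧
      (∀ Ψ : HDFT.VacuumModule (HDFT.HeisCurrents ℂ) →ₗ[ℂ]
          HDFT.VacuumModule (HDFT.TorusCurrents ℂ),
        Ψ (HDFT.vacuum _) = HDFT.vacuum _ →
        (∀ a n v, Ψ (HDFT.mode _ a n v) = HDFT.mode _ (HDFT.tDual ℂ a) n (Ψ v)) →
        Ψ = Φ.toLinearMap) ∧
      Φ HDFT.heisHamiltonianVector = HDFT.torusHamiltonianVector ∧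
      ∀ n v, Φ ((HDFT.heisHamiltonian[[n]]) v) = (HDFT.torusHamiltonian[[n]]) (Φ v)) ∧
    -- the Hamiltonian fields create the Hamiltonian vectors from the vacuum
    (HDFT.heisHamiltonian[[-1]]) (HDFT.vacuum _) = HDFT.heisHamiltonianVector ∧
    (HDFT.torusHamiltonian[[-1]]) (HDFT.vacuum _) = HDFT.torusHamiltonianVector ∧
    -- operator product expansions giving the equations of motion of the currents
    (∀ i : Fin 3,
      HDFT.HasOPE HDFT.torusHamiltonian (HDFT.fieldα i)
        (HDFT.derivField (HDFT.fieldβ i)) (HDFT.fieldβ i) ∧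
      HDFT.HasOPE HDFT.torusHamiltonian (HDFT.fieldβ i)
        (HDFT.derivField (HDFT.fieldα i) -
          (HDFT.normalOrder (HDFT.fieldβ (i + 1)) (HDFT.fieldα (i + 2)) -
            HDFT.normalOrder (HDFT.fieldβ (i + 2)) (HDFT.fieldα (i + 1))))
        (HDFT.fieldα i)) ∧
    (HDFT.HasOPE HDFT.heisHamiltonian (HDFT.fieldX 0)
        (HDFT.derivField (HDFT.fieldY 0) + HDFT.normalOrder (HDFT.fieldY 1) (HDFT.fieldY 2) -
          HDFT.normalOrder (HDFT.fieldX 2) (HDFT.fieldX 1)) (HDFT.fieldY 0) ∧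
      HDFT.HasOPE HDFT.heisHamiltonian (HDFT.fieldX 1)
        (HDFT.derivField (HDFT.fieldY 1)) (HDFT.fieldY 1) ∧
      HDFT.HasOPE HDFT.heisHamiltonian (HDFT.fieldX 2)
        (HDFT.derivField (HDFT.fieldY 2) + HDFT.normalOrder (HDFT.fieldX 0) (HDFT.fieldX 1) -
          HDFT.normalOrder (HDFT.fieldY 1) (HDFT.fieldY 0)) (HDFT.fieldY 2) ∧
      HDFT.HasOPE HDFT.heisHamiltonian (HDFT.fieldY 0)
        (HDFT.derivField (HDFT.fieldX 0)) (HDFT.fieldX 0) ∧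
      HDFT.HasOPE HDFT.heisHamiltonian (HDFT.fieldY 1)
        (HDFT.derivField (HDFT.fieldX 1) + HDFT.normalOrder (HDFT.fieldX 2) (HDFT.fieldY 0) -
          HDFT.normalOrder (HDFT.fieldX 0) (HDFT.fieldY 2)) (HDFT.fieldX 1) ∧
      HDFT.HasOPE HDFT.heisHamiltonian (HDFT.fieldY 2)
        (HDFT.derivField (HDFT.fieldX 2)) (HDFT.fieldX 2)) ∧
    -- the Hamiltonian densities of the two metrics, and their matching
    (∀ x r p : HDFT.R3, HDFT.hamDensity HDFT.flatMetric x r p =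
      1 / 2 * ∑ i, ((HDFT.torusCurrentsAt r p).2 i ^ 2 + (HDFT.torusCurrentsAt r p).1 i ^ 2)) ∧
    (∀ y r p : HDFT.R3, HDFT.hamDensity HDFT.heisMetric y r p =
      1 / 2 * ∑ i, (HDFT.heisCurrentsAt y r p).2 i ^ 2 +
        1 / 2 * ∑ i, (HDFT.heisCurrentsAt y r p).1 i ^ 2) ∧
    (∀ x r p y r' p' : HDFT.R3,
      HDFT.tDual ℝ (HDFT.heisCurrentsAt y r' p') = HDFT.torusCurrentsAt r p →
        HDFT.hamDensity HDFT.heisMetric y r' p' = HDFT.hamDensity HDFT.flatMetric x r p) ∧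
    -- equations of motion of the scalar fields, for times in an open interval `J`
    (∀ (J : Set ℝ) (k : ℕ∞), IsOpen J → Convex ℝ J → 2 ≤ k →
      -- Hamilton's equations are the second order systems
      (∀ x p : ℝ × ℝ → HDFT.R3, ContDiffOn ℝ k x (HDFT.worldsheet J) →
        (HDFT.IsHamiltonianMotion (HDFT.hamDensity HDFT.flatMetric) HDFT.volFlux
            (HDFT.worldsheet J) x p ↔
          (∀ w ∈ HDFT.worldsheet J, p w = HDFT.flatMetric (x w) *ᵥ HDFT.dτ x w) ∧
            HDFT.TorusEOM (HDFT.worldsheet J) x)) ∧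
      (∀ y p : ℝ × ℝ → HDFT.R3, ContDiffOn ℝ k y (HDFT.worldsheet J) →
        (HDFT.IsHamiltonianMotion (HDFT.hamDensity HDFT.heisMetric) 0
            (HDFT.worldsheet J) y p ↔
          (∀ w ∈ HDFT.worldsheet J, p w = HDFT.heisMetric (y w) *ᵥ HDFT.dτ y w) ∧
            HDFT.HeisEOM (HDFT.worldsheet J) y)) ∧
      -- the two systems are equivalent for T-dual fields
      (∀ x y : ℝ × ℝ → HDFT.R3, ContDiffOn ℝ k x (HDFT.worldsheet J) →
        ContDiffOn ℝ k y (HDFT.worldsheet J) → HDFT.AreTDual (HDFT.worldsheet J) x y →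
          (HDFT.TorusEOM (HDFT.worldsheet J) x ↔ HDFT.HeisEOM (HDFT.worldsheet J) y)) ∧
      -- doubled fields give T-dual pairs, and every solution of either system arises from one
      (∀ z : ℝ × ℝ → HDFT.R3 × HDFT.R3, ContDiffOn ℝ k z (HDFT.worldsheet J) →
        HDFT.DoubledEOM (HDFT.worldsheet J) z →
          HDFT.AreTDual (HDFT.worldsheet J) (fun w => (z w).1) (fun w => HDFT.heisProj (z w))) ∧
      (∀ x : ℝ × ℝ → HDFT.R3, ContDiffOn ℝ k x (HDFT.worldsheet J) →
        (HDFT.TorusEOM (HDFT.worldsheet J) x ↔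
          ∃ z : ℝ × ℝ → HDFT.R3 × HDFT.R3, ContDiffOn ℝ k z (HDFT.worldsheet J) ∧
            HDFT.DoubledEOM (HDFT.worldsheet J) z ∧
            ∀ w ∈ HDFT.worldsheet J, (z w).1 = x w)) ∧
      (∀ y : ℝ × ℝ → HDFT.R3, ContDiffOn ℝ k y (HDFT.worldsheet J) →
        (HDFT.HeisEOM (HDFT.worldsheet J) y ↔
          ∃ z : ℝ × ℝ → HDFT.R3 × HDFT.R3, ContDiffOn ℝ k z (HDFT.worldsheet J) ∧
            HDFT.DoubledEOM (HDFT.worldsheet J) z ∧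
            ∀ w ∈ HDFT.worldsheet J, HDFT.heisProj (z w) = y w)) ∧
      -- the doubled field is unique up to translations that do not change the given scalar field
      (∀ (g : HDFT.R3 × HDFT.R3) (z : ℝ × ℝ → HDFT.R3 × HDFT.R3),
        ContDiffOn ℝ k z (HDFT.worldsheet J) → HDFT.DoubledEOM (HDFT.worldsheet J) z →
          HDFT.DoubledEOM (HDFT.worldsheet J) (fun w => HDFT.doubledMul g (z w))) ∧
      (∀ z z' : ℝ × ℝ → HDFT.R3 × HDFT.R3, ContDiffOn ℝ k z (HDFT.worldsheet J) →
        ContDiffOn ℝ k z' (HDFT.worldsheet J) → HDFT.DoubledEOM (HDFT.worldsheet J) z →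
        HDFT.DoubledEOM (HDFT.worldsheet J) z' →
          ((∀ w ∈ HDFT.worldsheet J, (z' w).1 = (z w).1) →
            ∃ g : HDFT.R3 × HDFT.R3, g.1 = 0 ∧
              ∀ w ∈ HDFT.worldsheet J, z' w = HDFT.doubledMul g (z w)) ∧
          ((∀ w ∈ HDFT.worldsheet J, HDFT.heisProj (z' w) = HDFT.heisProj (z w)) →
            ∃ g : HDFT.R3 × HDFT.R3, HDFT.heisProj g = 0 ∧
              ∀ w ∈ HDFT.worldsheet J, z' w = HDFT.doubledMul g (z w))) ∧
      -- periodic boundary conditions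
      (∀ z : ℝ × ℝ → HDFT.R3 × HDFT.R3, ContDiffOn ℝ k z (HDFT.worldsheet J) →
        HDFT.DoubledEOM (HDFT.worldsheet J) z →
          ((∃ c : HDFT.R3, ∀ w ∈ HDFT.worldsheet J, (z (HDFT.shift w)).1 = (z w).1 + c) ↔
            ∃ g : HDFT.R3 × HDFT.R3, ∀ w ∈ HDFT.worldsheet J,
              z (HDFT.shift w) = HDFT.doubledMul g (z w)) ∧
          ((∃ γ : HDFT.R3, ∀ w ∈ HDFT.worldsheet J,
              HDFT.heisProj (z (HDFT.shift w)) = HDFT.heisMul γ (HDFT.heisProj (z w))) ↔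
            ∃ g : HDFT.R3 × HDFT.R3, ∀ w ∈ HDFT.worldsheet J,
              z (HDFT.shift w) = HDFT.doubledMul g (z w)) ∧
          ∀ g : HDFT.R3 × HDFT.R3, HDFT.DoubledLattice g →
            (∀ w ∈ HDFT.worldsheet J, z (HDFT.shift w) = HDFT.doubledMul g (z w)) →
            (∃ n : Fin 3 → ℤ, ∀ w ∈ HDFT.worldsheet J,
              (z (HDFT.shift w)).1 = (z w).1 + fun i => (n i : ℝ)) ∧
            ∃ γ : HDFT.R3, HDFT.HeisLattice γ ∧ ∀ w ∈ HDFT.worldsheet J,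
              HDFT.heisProj (z (HDFT.shift w)) = HDFT.heisMul γ (HDFT.heisProj (z w)))) := by
  refine ⟨fun s t => ⟨HDFT.dorfman_torusSection s t, fun q => rfl⟩,
    fun s t => ⟨HDFT.dorfman_heisSection s t, HDFT.heisSection_pairing s t⟩,
    fun s t => ⟨HDFT.tDual_lie s t, HDFT.torusPairing_tDual s t⟩,
    ⟨HDFT.tDualVacuum, HDFT.tDualVacuum_vacuum, HDFT.tDualVacuum_mode,
      fun Ψ h₀ h₁ => HDFT.vacuumModule_hom_ext (fun a n => HDFT.mode _ (HDFT.tDual ℂ a) n)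
        (h₀.trans HDFT.tDualVacuum_vacuum.symm) h₁ HDFT.tDualVacuum_mode,
      HDFT.tDualVacuum_heisHamiltonianVector, HDFT.intertwines_hamiltonian⟩,
    HDFT.heisHamiltonian_vacuum, HDFT.torusHamiltonian_vacuum,
    fun i => ⟨HDFT.hasOPE_torusHamiltonian_α i, HDFT.hasOPE_torusHamiltonian_β i⟩,
    ⟨HDFT.hasOPE_heisHamiltonian_X_zero, HDFT.hasOPE_heisHamiltonian_X_one,
      HDFT.hasOPE_heisHamiltonian_X_two, HDFT.hasOPE_heisHamiltonian_Y_zero,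
      HDFT.hasOPE_heisHamiltonian_Y_one, HDFT.hasOPE_heisHamiltonian_Y_two⟩,
    HDFT.hamDensity_flatMetric, HDFT.hamDensity_heisMetric, HDFT.hamDensity_eq_of_tDual, ?_⟩
  intro J k hJ hJc hk
  have hW := HDFT.isOpen_worldsheet hJ
  have hc := HDFT.convex_worldsheet hJc
  -- Only the existence of doubled motions uses the full regularity C^k; every other claim reduces
  -- to C².
  have hk₂ : (2 : WithTop ℕ∞) ≤ k := WithTop.coe_le_coe.2 hk
  refine ⟨fun x p hx => HDFT.isHamiltonianMotion_torus_iff hW (hx.of_le hk₂),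
    fun y p hy => HDFT.isHamiltonianMotion_heis_iff hW (hy.of_le hk₂),
    fun x y hx hy h => h.torusEOM_iff_heisEOM hW (hx.of_le hk₂) (hy.of_le hk₂),
    fun z hz h => h.areTDual hW (hz.of_le hk₂),
    fun x hx => ⟨fun h => ?_, fun ⟨z, hz, h, e⟩ => (h.torusEOM hW (hz.of_le hk₂)).congr hW e⟩,
    fun y hy => ⟨fun h => h.exists_doubled hW hc hk hy,
      fun ⟨z, hz, h, e⟩ => (h.heisEOM hW (hz.of_le hk₂)).congr hW e⟩,
    fun g z hz h => h.doubledMul hW (hz.of_le hk₂) g,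
    fun z z' hz hz' h h' =>
      ⟨h.exists_translation_of_fst_eq hW hc (hz.of_le hk₂) (hz'.of_le hk₂) h',
        h.exists_translation_of_heisProj_eq hW hc (hz.of_le hk₂) (hz'.of_le hk₂) h'⟩,
    fun z hz h => ⟨h.fst_shift_iff hJ hJc (hz.of_le hk₂),
      h.heisProj_shift_iff hJ hJc (hz.of_le hk₂), fun g hg hzg => ⟨?_, ?_⟩⟩⟩
  · obtain ⟨s, hs, hs'⟩ := h.exists_doubled hW hc hk hx
    exact ⟨_, hs, hs', fun _ _ => rfl⟩
  · obtain ⟨n, hn⟩ := hg.exists_int_fst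
    exact ⟨n, fun w hw => by rw [hzg w hw, ← hn, add_comm]; rfl⟩
  · exact ⟨_, hg.heisProj, fun w hw => by rw [hzg w hw, HDFT.heisProj_doubledMul]⟩
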